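/- Let $d\in\mathbb N$, $s\ge 0$, and let $G:\mathbb R^d\to\mathbb R$ be a Borel function in the Sobolev space $W^s_2(\mathbb R^d)$ of real $f\in L_2(\mathbb R^d)$ with $\|f\|_{W^s_2}^2=(2\pi)^{-d}\int(1+|\xi|^2)^s|\hat f(\xi)|^2\,d\xi<\infty$, where $\hat f(\xi)=\int e^{i\xi\cdot x}f(x)\,dx$. Let $\Omega=\mathbb R^d\times\mathcal S^d_+$ be the set of pairs $\omega=(\chi,\Lambda)$ of a location $\chi$ and a positive definite symmetric $d\times d$ matrix $\Lambda$, with determinant $|\Lambda|$ and spectral radius (largest eigenvalue) $\rho(\Lambda)$, and put $\phi(x,\omega)=G(\Lambda(x-\chi))$. Let $\nu(d\beta\,d\omega)=\nu_\beta(d\beta)\,\pi_\omega(d\omega)$ be a Lévy measure on $\mathbb R\times\Omega$ (so $\nu(\{0\}\times\Omega)=0$ and $\iint_{\mathbb R\times K}(1\wedge\beta^2)\,d\nu<\infty$ for compact $K\subset\Omega$), with $\nu_\beta$ a $\sigma$-finite measure on $\mathbb R$ and $\pi_\omega$ a probability measure on $\Omega$ such that $$\int_{\mathbb R}(1\wedge\beta^2)\,\nu_\beta(d\beta)<\infty,\qquad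 \int_\Omega|\Lambda|^{-1}(1+\rho(\Lambda))^{2s}\,\pi_\omega(d\omega)<\infty .$$ Then $$\iint_{\mathbb R\times\Omega}|\Lambda|^{-1}\,[1+\rho(\Lambda)^{2s}]\,(1\wedge\beta^2)\,\nu(d\beta\,d\omega)<\infty .$$ Moreover, let $N$ be a Poisson random measure on $\mathbb R\times\Omega$ with intensity $\nu$, let $\tilde N=N-\nu$ be its compensated measure, and let $h$ be a compensator: a bounded measurable function with $h(\beta)=\beta+O(\beta^2)$ as $\beta\to0$, or $h\equiv0$ in case $\iint_{\mathbb R\times K}(1\wedge|\beta|)\,d\nu<\infty$ for all compact $K\subset\Omega$. For $\varepsilon>0$ put $$f(x)=\iint_{\mathbb R\times\Omega}\phi(x,\omega)[\beta-h(\beta)]\,N(d\beta\,d\omega)+\iint_{\mathbb R\times\Omega}\phi(x,\omega)h(\beta)\,\tilde N(d\beta\,d\omega),$$ $$f_\varepsilon(x)=\iint_{[-\varepsilon,\varepsilon]^c\times\Omega}\phi(x,\omega)[\beta-h(\beta)]\,N(d\beta\,d\omega)+\iint_{[-\varepsilon,\varepsilon]^c\times\Omega}\phi(x,\omega)h(\beta)\,\tilde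 N(d\beta\,d\omega),$$ where the integral against $\tilde N$ in $f$ is the $L_2$-isometric extension of $u\mapsto\int u\,dN-\int u\,d\nu$. The integrals for $f(x)$ converge for almost every $x$, and $f$ has a jointly measurable version. For every such version, almost surely: for every $\varepsilon>0$ the integrals for $f_\varepsilon(x)$ converge absolutely for almost every $x$ and $f_\varepsilon\in W^s_2(\mathbb R^d)$; $f\in W^s_2(\mathbb R^d)$; and $\|f_\varepsilon-f\|_{W^s_2}\to0$ as $\varepsilon\to0$. -/

import Mathlib

open MeasureTheory ProbabilityTheory Filter Topology
open scoped ENNReal NNReal FourierTransform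

noncomputable section

namespace Lark

/-! ### Sobolev spaces `W^s_2(ℝ^d)` -/

/-- `ℝ^d` with its Euclidean norm. -/
abbrev Rd (d : ℕ) : Type := EuclideanSpace ℝ (Fin d)

/-- The Fourier transform `f̂(ξ) = ∫ e^{i ξ·x} f(x) dx`, extended to `L²` by continuity.  Mathlib's
`𝓕` is the `L²` extension of `∫ e^{-2πi η·x} f(x) dx`, so it is evaluated at `η = -ξ / (2π)`. -/
def fourierHat {d : ℕ} (f : Lp (α := Rd d) ℂ 2 volume) : Rd d → ℂ :=
  fun ξ => (𝓕 f : Lp (α := Rd d) ℂ 2 volume) (-((2 * Real.pi)⁻¹ • ξ))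

open Classical in
/-- The Sobolev norm `((2π)^{-d} ∫ (1 + |ξ|²)^s |f̂(ξ)|² dξ)^{1/2}` of a real-valued function,
with value `∞` when `f` is not in `L²` or when the integral diverges. -/
def sobolevENorm {d : ℕ} (s : ℝ) (f : Rd d → ℝ) : ℝ≥0∞ :=
  if hf : MemLp (fun x => (f x : ℂ)) 2 volume then
    (ENNReal.ofReal (((2 * Real.pi) ^ d)⁻¹) *
      ∫⁻ ξ : Rd d, ENNReal.ofReal ((1 + ‖ξ‖ ^ 2) ^ s) * ‖fourierHat hf.toLp ξ‖ₑ ^ 2) ^ (1 / 2 : ℝ)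
  else ∞

/-- Membership in `W^s_2(ℝ^d)`. -/
def MemW {d : ℕ} (s : ℝ) (f : Rd d → ℝ) : Prop := sobolevENorm s f < ∞

/-! ### Location-scale parameters `ω = (χ, Λ)` -/

/-- The set `S_+^d` of positive definite (symmetric) real `d × d` matrices. -/
def PosDefMatrix (d : ℕ) : Type := {A : Matrix (Fin d) (Fin d) ℝ // A.PosDef}

instance (d : ℕ) : TopologicalSpace (PosDefMatrix d) :=
  inferInstanceAs (TopologicalSpace {A : Matrix (Fin d) (Fin d) ℝ // A.PosDef})

instance (d : ℕ) : MeasurableSpace (PosDefMatrix d) := borel _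

instance (d : ℕ) : BorelSpace (PosDefMatrix d) := ⟨rfl⟩

/-- The parameter space of pairs `(χ, Λ)` of a location and a scale matrix. -/
abbrev LocScale (d : ℕ) : Type := Rd d × PosDefMatrix d

/-- `|Λ|⁻¹`, the reciprocal of the determinant of the scale matrix. -/
def invDet {d : ℕ} (ω : LocScale d) : ℝ≥0∞ := ENNReal.ofReal (ω.2.1.det)⁻¹

/-- `ρ(Λ)`, the spectral radius of the scale matrix. -/
def specRad {d : ℕ} (ω : LocScale d) : ℝ≥0∞ := spectralRadius ℝ ω.2.1

/-- The location-scale generating function `φ(x, ω) = G(Λ(x - χ))`. -/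
def locScaleKernel {d : ℕ} (G : Rd d → ℝ) (x : Rd d) (ω : LocScale d) : ℝ :=
  G (Matrix.toEuclideanLin ω.2.1 (x - ω.1))

/-- The condition `∬ |Λ|⁻¹ [1 + ρ(Λ)^{2s}] (1 ∧ β²) ν(dβ dω) < ∞`. -/
def SobolevLevyCondition {d : ℕ} (s : ℝ) (ν : Measure (ℝ × LocScale d)) : Prop :=
  ∫⁻ p, invDet p.2 * (1 + specRad p.2 ^ (2 * s)) * ENNReal.ofReal (min 1 (p.1 ^ 2)) ∂ν < ∞

/-! ### Lévy measures, compensators, Poisson random measures -/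

section Levy

variable {Θ : Type*} [MeasurableSpace Θ]

/-- The local `L₂` condition together with the absence of mass on `{0} × Ω`. -/
structure IsLevyMeasure [TopologicalSpace Θ] (ν : Measure (ℝ × Θ)) : Prop where
  zero : ν ({0} ×ˢ Set.univ) = 0
  localL2 : ∀ K : Set Θ, IsCompact K →
    ∫⁻ p in Set.univ ×ˢ K, ENNReal.ofReal (min 1 (p.1 ^ 2)) ∂ν < ∞

/-- The local `L₁` condition, under which no compensation is needed. -/
def LocalL1 [TopologicalSpace Θ] (ν : Measure (ℝ × Θ)) : Prop :=
  ∀ K : Set Θ, IsCompact K → ∫⁻ p in Set.univ ×ˢ K, ENNReal.ofReal (min 1 |p.1|) ∂ν < ∞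

/-- Admissible compensators for `ν`: bounded measurable `h` with `h(β) = β + O(β²)` near `0`, and
also `h = 0` when `ν` satisfies the local `L₁` condition. -/
def IsCompensator [TopologicalSpace Θ] (ν : Measure (ℝ × Θ)) (h : ℝ → ℝ) : Prop :=
  (Measurable h ∧ (∃ C, ∀ β, |h β| ≤ C) ∧
    (fun β => h β - β) =O[𝓝 0] (fun β => β ^ 2)) ∨
  (h = 0 ∧ LocalL1 ν)

end Levy

section Poisson

variable {S : Type*} [MeasurableSpace S] {W : Type*} [MeasurableSpace W]

/-- `N` is a Poisson random measure with intensity `ν` on the probability space `(W, P)`: the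
numbers `N(C)` are Poisson with mean `ν(C)` (a.s. infinite if `ν(C) = ∞`), and independent for
disjoint measurable sets. -/
structure IsPoissonRandomMeasure (N : W → Measure S) (ν : Measure S) (P : Measure W) : Prop where
  measurable : Measurable N
  law : ∀ C, MeasurableSet C → ν C ≠ ∞ →
    P.map (fun w => N w C) = (poissonMeasure (ν C).toNNReal).map (fun n : ℕ => (n : ℝ≥0∞))
  law_top : ∀ C, MeasurableSet C → ν C = ∞ → ∀ᵐ w ∂P, N w C = ∞
  indep : ∀ (n : ℕ) (C : Fin n → Set S), (∀ i, MeasurableSet (C i)) →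
    Pairwise (fun i j => Disjoint (C i) (C j)) → iIndepFun (fun i w => N w (C i)) P

/-- `Z` is (a version of) the integral of `ψ ∈ L²(ν)` against the compensated measure
`Ñ = N - ν`, i.e. the image of `ψ` under the isometry of `L²(ν)` into `L²(P)` that extends
`u ↦ ∫ u dN - ∫ u dν` from `L¹(ν) ∩ L²(ν)`. -/
def IsCompensatedIntegral (N : W → Measure S) (ν : Measure S) (P : Measure W)
    (ψ : S → ℝ) (Z : W → ℝ) : Prop :=
  MemLp ψ 2 ν ∧ MemLp Z 2 P ∧ ∃ u : ℕ → S → ℝ,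
    (∀ n, Measurable (u n) ∧ Integrable (u n) ν ∧ MemLp (u n) 2 ν) ∧
    Tendsto (fun n => eLpNorm (u n - ψ) 2 ν) atTop (𝓝 0) ∧
    Tendsto (fun n => eLpNorm (fun w => (∫ p, u n p ∂(N w) - ∫ p, u n p ∂ν) - Z w) 2 P)
      atTop (𝓝 0)

end Poisson

/-! ### Lévy random fields and their truncations -/

section Field

variable {Θ : Type*} [MeasurableSpace Θ] {W : Type*} [MeasurableSpace W]

/-- `Y` is a version of
`L[φ] = ∬ [β - h(β)] φ(ω) N(dβ dω) + ∬ h(β) φ(ω) Ñ(dβ dω)`, both integrals being convergent. -/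
def IsLevyIntegral (N : W → Measure (ℝ × Θ)) (ν : Measure (ℝ × Θ)) (P : Measure W)
    (h : ℝ → ℝ) (φ : Θ → ℝ) (Y : W → ℝ) : Prop :=
  (∀ᵐ w ∂P, Integrable (fun p : ℝ × Θ => φ p.2 * (p.1 - h p.1)) (N w)) ∧
  ∃ Z : W → ℝ, IsCompensatedIntegral N ν P (fun p => φ p.2 * h p.1) Z ∧
    ∀ᵐ w ∂P, Y w = ∫ p, φ p.2 * (p.1 - h p.1) ∂(N w) + Z w

/-- `f` is a jointly measurable version of the random function `f(x) = L[φ(x, ·)]`; being an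
element of a space of classes of functions of `x`, it is determined for almost every `x`. -/
def IsKernelIntegral {d : ℕ} (N : W → Measure (ℝ × Θ)) (ν : Measure (ℝ × Θ)) (P : Measure W)
    (h : ℝ → ℝ) (φ : Rd d → Θ → ℝ) (f : Rd d → W → ℝ) : Prop :=
  Measurable (Function.uncurry f) ∧ ∀ᵐ x : Rd d, IsLevyIntegral N ν P h (φ x) (f x)

/-- The set `[-ε, ε]ᶜ × Ω`. -/
def bigJumps (Θ : Type*) (ε : ℝ) : Set (ℝ × Θ) := {p | ε < |p.1|}

/-- The truncated field `f_ε(x) = ∬_{[-ε,ε]ᶜ×Ω} φ(x,ω) [β - h(β)] N(dβ dω)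
+ ∬_{[-ε,ε]ᶜ×Ω} φ(x,ω) h(β) Ñ(dβ dω)`, for the realization `μ = N w` of the random measure. -/
def truncField {d : ℕ} (μ ν : Measure (ℝ × Θ)) (h : ℝ → ℝ) (φ : Rd d → Θ → ℝ) (ε : ℝ)
    (x : Rd d) : ℝ :=
  ∫ p in bigJumps Θ ε, φ x p.2 * (p.1 - h p.1) ∂μ +
    (∫ p in bigJumps Θ ε, φ x p.2 * h p.1 ∂μ - ∫ p in bigJumps Θ ε, φ x p.2 * h p.1 ∂ν)

/-- The three integrals that define `f_ε(x)` converge absolutely. -/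
def TruncConverges {d : ℕ} (μ ν : Measure (ℝ × Θ)) (h : ℝ → ℝ) (φ : Rd d → Θ → ℝ) (ε : ℝ)
    (x : Rd d) : Prop :=
  IntegrableOn (fun p : ℝ × Θ => φ x p.2 * (p.1 - h p.1)) (bigJumps Θ ε) μ ∧
  IntegrableOn (fun p : ℝ × Θ => φ x p.2 * h p.1) (bigJumps Θ ε) μ ∧
  IntegrableOn (fun p : ℝ × Θ => φ x p.2 * h p.1) (bigJumps Θ ε) ν

end Field

end Lark

end

noncomputable section

namespace Lark

/-! ### Moments of the Poisson distribution -/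

/-! The field is a sum over Poisson points of functions φ(·, ω), and the Sobolev statement becomes
an L² statement on the Fourier side. In Mathlib's normalization the transform of x ↦ G(Λ(x − χ)) is
a phase times |Λ|⁻¹F(Λ⁻¹η), where F is the transform of G. Its squared norm for the weight (1 +
|2πη|²)^s dη is at most |Λ|⁻¹(1 + ρ(Λ))^{2s} times that of F, which is π-integrable
(`eLpNorm_locScaleTransform_sq_le`). The transform of a truncation is therefore a truncated Lévy
field with another kernel (`isFourierPair_truncField`). It remains to study truncations in L²(m),
for an s-finite measure m and a real kernel with ∫ ‖φ(·, ω)‖² dπ < ∞, the norm being that of L²(m).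

Passing from level δ to a smaller ε adds the jumps with sizes in (ε, δ]. The residual part, with
coefficients β − h(β), is almost surely absolutely summable in L²(m), because β − h(β) is
ν_β-integrable near 0; Minkowski's inequality then makes it small. The compensated part is
controlled only in mean square. To treat all ε at once on one almost sure event, the second-moment
bound is upgraded to a Kolmogorov maximal inequality in L²(m) (`mul_measure_exists_finset_le`,
`mul_measure_exists_pos_le`), which rests on the independence of N on disjoint sets
(`indepFun_restrict`). So the truncations are almost surely Cauchy as ε → 0
(`ae_forall_exists_eLpNorm_truncField_sub_le`).

The limit is identified as follows. Along a deterministic sequence of levels with summable mean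
square errors, the truncations converge to f for almost every x (`ae_exists_tendsto_truncField`), so
the L² limit is f. On the Fourier side, Plancherel and an almost everywhere convergent subsequence
show that the weighted limit is the transform of f (`memW_and_tendsto_of_cauchy`).

Transforms are handled by duality with Schwartz functions (`IsFourierPair`), so that exchanging
transform and jump sum is Fubini's theorem. Joint measurability in (x, w) comes from replacing N w
by an s-finite kernel that agrees with it almost surely (`exists_isSFiniteKernel`). -/

theorem hasSum_poisson_mul (r : ℝ≥0) :
    HasSum (fun n : ℕ => Real.exp (-r) * r ^ n / n.factorial * (n : ℝ)) r := by
  rw [← hasSum_nat_add_iff' 1]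
  have h := (hasSum_one_poissonMeasure r).mul_left (r : ℝ)
  simp only [Finset.range_one, Finset.sum_singleton, Nat.cast_zero, mul_zero, sub_zero]
  rw [mul_one] at h
  convert! h using 1
  funext n
  rw [Nat.factorial_succ]
  push_cast
  field_simp
  exact pow_succ' _ _

theorem hasSum_poisson_mul_sq (r : ℝ≥0) :
    HasSum (fun n : ℕ => Real.exp (-r) * r ^ n / n.factorial * (n : ℝ) ^ 2) (r ^ 2 + r : ℝ) := by
  rw [← hasSum_nat_add_iff' 1]
  have h := ((hasSum_poisson_mul r).add (hasSum_one_poissonMeasure r)).mul_left (r : ℝ)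
  simp only [Finset.range_one, Finset.sum_singleton, Nat.cast_zero, mul_zero, sub_zero, ne_eq,
    OfNat.ofNat_ne_zero, not_false_eq_true, zero_pow]
  convert! h using 1
  · funext n
    rw [Nat.factorial_succ]
    push_cast
    field_simp
    exact pow_succ' _ _
  · ring

theorem memLp_two_poissonMeasure (r : ℝ≥0) :
    MemLp (fun n : ℕ => (n : ℝ)) 2 (poissonMeasure r) := by
  rw [memLp_two_iff_integrable_sq (by fun_prop), integrable_poissonMeasure_iff]
  simpa using (hasSum_poisson_mul_sq r).summable

theorem integral_poissonMeasure_id (r : ℝ≥0) : ∫ n : ℕ, (n : ℝ) ∂poissonMeasure r = r := by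
  rw [integral_poissonMeasure]
  simpa using (hasSum_poisson_mul r).tsum_eq

theorem variance_poissonMeasure (r : ℝ≥0) :
    Var[fun n : ℕ => (n : ℝ); poissonMeasure r] = r := by
  rw [variance_eq_sub (memLp_two_poissonMeasure r), integral_poissonMeasure_id,
    integral_poissonMeasure]
  have := (hasSum_poisson_mul_sq r).tsum_eq
  simp only [Pi.pow_apply, smul_eq_mul, this]
  ring

/-! ### First and second moments of a Poisson random measure -/

namespace IsPoissonRandomMeasure

variable {S : Type*} [MeasurableSpace S] {W : Type*} [MeasurableSpace W]
  {N : W → Measure S} {ν : Measure S} {P : Measure W} {C : Set S}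

theorem measurable_apply (hN : IsPoissonRandomMeasure N ν P) (hC : MeasurableSet C) :
    Measurable fun w => N w C :=
  (Measure.measurable_coe hC).comp hN.measurable

theorem map_toReal (hN : IsPoissonRandomMeasure N ν P) (hC : MeasurableSet C) (hνC : ν C ≠ ∞) :
    P.map (fun w => (N w).real C) = (poissonMeasure (ν C).toNNReal).map (fun n : ℕ => (n : ℝ)) := by
  have := congrArg (Measure.map ENNReal.toReal) (hN.law C hC hνC)
  rw [Measure.map_map ENNReal.measurable_toReal (hN.measurable_apply hC),
    Measure.map_map ENNReal.measurable_toReal (by fun_prop)] at this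
  simpa [Function.comp_def, Measure.real] using this

theorem ae_eq_natCast (hN : IsPoissonRandomMeasure N ν P) (hC : MeasurableSet C) (hνC : ν C ≠ ∞) :
    ∀ᵐ w ∂P, N w C ∈ Set.range (fun n : ℕ => (n : ℝ≥0∞)) := by
  have hr : MeasurableSet (Set.range (fun n : ℕ => (n : ℝ≥0∞))) :=
    (Set.countable_range _).measurableSet
  have h : ∀ᵐ y ∂(P.map fun w => N w C), y ∈ Set.range (fun n : ℕ => (n : ℝ≥0∞)) := by
    rw [hN.law C hC hνC, ae_map_iff (p := fun y => y ∈ Set.range (fun n : ℕ => (n : ℝ≥0∞)))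
      (Measurable.of_discrete.aemeasurable) hr]
    exact ae_of_all _ fun n => ⟨n, rfl⟩
  exact (ae_map_iff (hN.measurable_apply hC).aemeasurable hr).1 h

theorem ae_lt_top (hN : IsPoissonRandomMeasure N ν P) (hC : MeasurableSet C) (hνC : ν C ≠ ∞) :
    ∀ᵐ w ∂P, N w C < ∞ := by
  filter_upwards [hN.ae_eq_natCast hC hνC] with w ⟨n, hn⟩
  rw [← hn]
  exact ENNReal.natCast_lt_top n

theorem measurable_real (hN : IsPoissonRandomMeasure N ν P) (hC : MeasurableSet C) :
    Measurable fun w => (N w).real C :=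
  (hN.measurable_apply hC).ennreal_toReal

theorem memLp_two_real (hN : IsPoissonRandomMeasure N ν P) (hC : MeasurableSet C)
    (hνC : ν C ≠ ∞) : MemLp (fun w => (N w).real C) 2 P := by
  have h : MemLp id 2 (P.map fun w => (N w).real C) := by
    rw [hN.map_toReal hC hνC, memLp_map_measure_iff (by fun_prop) (by fun_prop)]
    exact memLp_two_poissonMeasure _
  exact (memLp_map_measure_iff (by fun_prop) (hN.measurable_real hC).aemeasurable).1 h

theorem integral_real (hN : IsPoissonRandomMeasure N ν P) (hC : MeasurableSet C)
    (hνC : ν C ≠ ∞) : ∫ w, (N w).real C ∂P = ν.real C := by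
  rw [← integral_map (f := fun y : ℝ => y) (hN.measurable_real hC).aemeasurable (by fun_prop),
    hN.map_toReal hC hνC, integral_map (by fun_prop) (by fun_prop), integral_poissonMeasure_id]
  rfl

theorem variance_real (hN : IsPoissonRandomMeasure N ν P) (hC : MeasurableSet C)
    (hνC : ν C ≠ ∞) : Var[fun w => (N w).real C; P] = ν.real C := by
  have h1 : Var[id; P.map fun w => (N w).real C] = Var[fun w => (N w).real C; P] :=
    variance_map (by fun_prop) (hN.measurable_real hC).aemeasurable
  rw [← h1, hN.map_toReal hC hνC, variance_map (by fun_prop) (by fun_prop)]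
  exact variance_poissonMeasure _

theorem lintegral_apply (hN : IsPoissonRandomMeasure N ν P) [IsProbabilityMeasure P]
    (hC : MeasurableSet C) : ∫⁻ w, N w C ∂P = ν C := by
  by_cases hνC : ν C = ∞
  · rw [hνC, lintegral_congr_ae (hN.law_top C hC hνC)]
    simp
  · have h1 : ∫⁻ w, N w C ∂P = ∫⁻ w, ENNReal.ofReal ((N w).real C) ∂P := by
      refine lintegral_congr_ae ?_
      filter_upwards [hN.ae_lt_top hC hνC] with w hw
      exact (ENNReal.ofReal_toReal hw.ne).symm
    rw [h1, ← ofReal_integral_eq_lintegral_ofReal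
      ((hN.memLp_two_real hC hνC).integrable (by norm_num))
      (ae_of_all _ fun w => measureReal_nonneg), hN.integral_real hC hνC]
    exact ENNReal.ofReal_toReal hνC

/-- Campbell's formula at the level of measures: means of integrals against N, and ν-null
exceptional sets, are all transferred through this identity. -/
theorem bind_eq (hN : IsPoissonRandomMeasure N ν P) [IsProbabilityMeasure P] : P.bind N = ν := by
  ext C hC
  rw [Measure.bind_apply hC hN.measurable.aemeasurable, hN.lintegral_apply hC]

theorem lintegral_lintegral (hN : IsPoissonRandomMeasure N ν P) [IsProbabilityMeasure P]
    {u : S → ℝ≥0∞} (hu : Measurable u) : ∫⁻ w, ∫⁻ p, u p ∂(N w) ∂P = ∫⁻ p, u p ∂ν := by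
  rw [← Measure.lintegral_bind hN.measurable.aemeasurable hu.aemeasurable, hN.bind_eq]

theorem measurable_lintegral (hN : IsPoissonRandomMeasure N ν P) {u : S → ℝ≥0∞}
    (hu : Measurable u) : Measurable fun w => ∫⁻ p, u p ∂(N w) :=
  (Measure.measurable_lintegral hu).comp hN.measurable

theorem ae_lintegral_lt_top (hN : IsPoissonRandomMeasure N ν P) [IsProbabilityMeasure P]
    {u : S → ℝ≥0∞} (hu : Measurable u) (h : ∫⁻ p, u p ∂ν < ∞) :
    ∀ᵐ w ∂P, ∫⁻ p, u p ∂(N w) < ∞ :=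
  MeasureTheory.ae_lt_top (hN.measurable_lintegral hu) (by rw [hN.lintegral_lintegral hu]; exact h.ne)

theorem ae_ae (hN : IsPoissonRandomMeasure N ν P) [IsProbabilityMeasure P] {p : S → Prop}
    (hp : ∀ᵐ x ∂ν, p x) : ∀ᵐ w ∂P, ∀ᵐ x ∂(N w), p x := by
  rw [← hN.bind_eq] at hp
  exact Measure.ae_ae_of_ae_bind hN.measurable.aemeasurable hp

/-- A count of finite mean is almost surely a natural number, so being nonzero means being at least
1, and Markov's inequality applies. -/
theorem measure_ne_zero_le (hN : IsPoissonRandomMeasure N ν P) [IsProbabilityMeasure P]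
    (hC : MeasurableSet C) : P {w | N w C ≠ 0} ≤ ν C := by
  by_cases hνC : ν C = ∞
  · simp [hνC]
  calc P {w | N w C ≠ 0} ≤ P {w | 1 ≤ N w C} := by
        refine measure_mono_ae ?_
        filter_upwards [hN.ae_eq_natCast hC hνC] with w ⟨n, hn⟩ hw
        change N w C ≠ 0 at hw
        change 1 ≤ N w C
        rw [← hn] at hw ⊢
        have h0 : n ≠ 0 := by simpa using hw
        simpa using Nat.one_le_iff_ne_zero.2 h0
    _ ≤ ∫⁻ w, N w C ∂P := by
        simpa using mul_meas_ge_le_lintegral (μ := P) (hN.measurable_apply hC) 1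
    _ = ν C := hN.lintegral_apply hC

/-- A finite function is almost surely summable over the finitely many points in a set of finite
intensity. -/
theorem ae_setLIntegral_lt_top (hN : IsPoissonRandomMeasure N ν P) [IsProbabilityMeasure P]
    {B : Set S} (hB : MeasurableSet B) (hνB : ν B ≠ ∞) {g : S → ℝ≥0∞} (hg : Measurable g)
    (hfin : ∀ᵐ p ∂ν, g p < ∞) : ∀ᵐ w ∂P, ∫⁻ p in B, g p ∂(N w) < ∞ := by
  -- As ν(D n) → 0, almost surely some D n carries no point; then g ≤ n on the points in B, of which
  -- there are finitely many.
  set D : ℕ → Set S := fun n => B ∩ {p | (n : ℝ≥0∞) < g p} with hD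
  have hDm : ∀ n, MeasurableSet (D n) := fun n => hB.inter (measurableSet_lt measurable_const hg)
  have hlim : Tendsto (fun n => ν (D n)) atTop (𝓝 0) := by
    have h0 : ν (⋂ n, D n) = 0 := by
      refine measure_mono_null ?_ (ae_iff.1 hfin)
      intro p hp
      simp only [hD, Set.mem_iInter, Set.mem_inter_iff, Set.mem_ofPred_eq] at hp ⊢
      intro hlt
      obtain ⟨n, hn⟩ := ENNReal.exists_nat_gt hlt.ne
      exact (lt_asymm hn (hp n).2)
    rw [← h0]
    refine tendsto_measure_iInter_atTop (fun n => (hDm n).nullMeasurableSet) ?_ ⟨0, ?_⟩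
    · intro m n hmn p hp
      have h2 : (n : ℝ≥0∞) < g p := hp.2
      exact ⟨hp.1, show (m : ℝ≥0∞) < g p from lt_of_le_of_lt (by exact_mod_cast hmn) h2⟩
    · exact ((measure_mono Set.inter_subset_left).trans_lt hνB.lt_top).ne
  have hnull : P {w | ∀ n, N w (D n) ≠ 0} = 0 := by
    refine le_antisymm (ge_of_tendsto' hlim fun n => ?_) bot_le
    exact (measure_mono fun w (hw : ∀ n, N w (D n) ≠ 0) => hw n).trans (hN.measure_ne_zero_le (hDm n))
  have hex : ∀ᵐ w ∂P, ∃ n, N w (D n) = 0 := by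
    rw [ae_iff]
    simpa using hnull
  filter_upwards [hex, hN.ae_lt_top hB hνB] with w ⟨n, hn⟩ hwB
  refine lt_of_le_of_lt (setLIntegral_mono_ae' (g := fun _ => (n : ℝ≥0∞)) hB ?_) ?_
  · have : ∀ᵐ p ∂(N w), p ∉ D n := measure_eq_zero_iff_ae_notMem.1 hn
    filter_upwards [this] with p hp hpB
    by_contra hlt
    exact hp ⟨hpB, not_le.1 hlt⟩
  · simpa using ENNReal.mul_lt_top (ENNReal.natCast_lt_top n) hwB

end IsPoissonRandomMeasure

/-! ### Independence of the restrictions to complementary sets -/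

section Restrict

variable {S : Type*} [MeasurableSpace S]

/-- This reduces independence of random measures to independence of their families of values on
measurable sets. -/
theorem measure_comap_eq_pi :
    (inferInstance : MeasurableSpace (Measure S)) =
      MeasurableSpace.comap (fun (μ : Measure S) (C : {C : Set S // MeasurableSet C}) => μ C.1)
        MeasurableSpace.pi := by
  refine le_antisymm ?_ ?_
  · refine iSup₂_le fun C hC => ?_
    rintro t ⟨u, hu, rfl⟩
    refine ⟨(fun x : {C : Set S // MeasurableSet C} → ℝ≥0∞ => x ⟨C, hC⟩) ⁻¹' u,
      measurable_pi_apply _ hu, rfl⟩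
  · exact (measurable_pi_lambda _ fun C => Measure.measurable_coe C.2).comap_le

/-- The cell of the partition of `B` generated by the sets `C i`. -/
def cell {ι : Type*} (C : ι → Set S) (B : Set S) (c : ι → Bool) : Set S :=
  B ∩ ⋂ i, if c i then C i else (C i)ᶜ

omit [MeasurableSpace S] in
theorem mem_cell {ι : Type*} {C : ι → Set S} {B : Set S} {c : ι → Bool} {p : S} :
    p ∈ cell C B c ↔ p ∈ B ∧ ∀ i, p ∈ C i ↔ c i = true := by
  simp only [cell, Set.mem_inter_iff, Set.mem_iInter]
  refine and_congr_right fun _ => forall_congr' fun i => ?_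
  cases c i <;> simp

theorem measurableSet_cell {ι : Type*} [Finite ι] {C : ι → Set S} {B : Set S} (hB : MeasurableSet B)
    (hC : ∀ i, MeasurableSet (C i)) (c : ι → Bool) : MeasurableSet (cell C B c) := by
  refine hB.inter (MeasurableSet.iInter fun i => ?_)
  split_ifs
  exacts [hC i, (hC i).compl]

omit [MeasurableSpace S] in
theorem disjoint_cell {ι : Type*} {C : ι → Set S} {B : Set S} {c c' : ι → Bool} (h : c ≠ c') :
    Disjoint (cell C B c) (cell C B c') := by
  refine Set.disjoint_left.2 fun p hp hp' => h ?_
  funext i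
  have h1 := (mem_cell.1 hp).2 i
  have h2 := (mem_cell.1 hp').2 i
  exact Bool.eq_iff_iff.2 (h1.symm.trans h2)

open Classical in
theorem measure_inter_eq_sum_cell {ι : Type*} [Finite ι] [Fintype (ι → Bool)] {C : ι → Set S}
    {B : Set S} (hB : MeasurableSet B) (hC : ∀ i, MeasurableSet (C i)) (μ : Measure S) (i : ι) :
    μ (C i ∩ B) = ∑ c : ι → Bool, if c i then μ (cell C B c) else 0 := by
  have hU : C i ∩ B = ⋃ c ∈ Finset.univ.filter (fun c : ι → Bool => c i = true), cell C B c := by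
    ext p
    simp only [Set.mem_inter_iff, Finset.mem_filter, Finset.mem_univ, true_and, Set.mem_iUnion,
      exists_prop]
    constructor
    · rintro ⟨hpC, hpB⟩
      exact ⟨fun j => decide (p ∈ C j), by simpa using hpC, mem_cell.2 ⟨hpB, by simp⟩⟩
    · rintro ⟨c, hc, hp⟩
      exact ⟨((mem_cell.1 hp).2 i).2 hc, (mem_cell.1 hp).1⟩
  rw [hU, measure_biUnion_finset (fun c _ c' _ h => disjoint_cell h)
    fun c _ => measurableSet_cell hB hC c, Finset.sum_filter]

end Restrict

namespace IsPoissonRandomMeasure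

variable {S : Type*} [MeasurableSpace S] {W : Type*} [MeasurableSpace W]
  {N : W → Measure S} {ν : Measure S} {P : Measure W}

theorem iIndepFun_of_fintype (hN : IsPoissonRandomMeasure N ν P) {κ : Type*} [Fintype κ]
    {D : κ → Set S} (hD : ∀ i, MeasurableSet (D i)) (hdisj : Pairwise (Function.onFun Disjoint D)) :
    iIndepFun (fun i w => N w (D i)) P := by
  have e := Fintype.equivFin κ
  have h := hN.indep (Fintype.card κ) (fun i => D (e.symm i)) (fun i => hD _)
    (fun i j hij => hdisj (e.symm.injective.ne hij))
  have := h.precomp e.injective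
  simpa [Function.comp_def] using this

/-- It suffices to treat finitely many sets on each side. Each value is then a sum of counts over
the cells of a finite partition, and all cells, inside `B` or inside `B'`, are pairwise disjoint, so
their counts are jointly independent. -/
theorem indepFun_restrict (hN : IsPoissonRandomMeasure N ν P) [IsProbabilityMeasure P]
    {B B' : Set S} (hB : MeasurableSet B) (hB' : MeasurableSet B') (hBB' : Disjoint B B') :
    IndepFun (fun w => (N w).restrict B) (fun w => (N w).restrict B') P := by
  classical
  have key : IndepFun
      (fun w (C : {C : Set S // MeasurableSet C}) => (N w).restrict B C.1)
      (fun w (C : {C : Set S // MeasurableSet C}) => (N w).restrict B' C.1) P := by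
    have hm : ∀ {B : Set S}, MeasurableSet B → ∀ C : {C : Set S // MeasurableSet C},
        Measurable fun w => (N w).restrict B C.1 := by
      intro B hB C
      simp_rw [Measure.restrict_apply C.2]
      exact hN.measurable_apply (C.2.inter hB)
    refine IndepFun.process_indepFun_process (hm hB) (hm hB') fun I J => ?_
    let CI : I → Set S := fun i => i.1.1
    let CJ : J → Set S := fun j => j.1.1
    have hCI : ∀ i, MeasurableSet (CI i) := fun i => i.1.2
    have hCJ : ∀ i, MeasurableSet (CJ i) := fun i => i.1.2
    let D : ((I → Bool) ⊕ (J → Bool)) → Set S := Sum.elim (cell CI B) (cell CJ B')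
    have hD : ∀ i, MeasurableSet (D i) := by
      rintro (c | c)
      exacts [measurableSet_cell hB hCI c, measurableSet_cell hB' hCJ c]
    have hdisj : Pairwise (Function.onFun Disjoint D) := by
      have hcr : ∀ c c', Disjoint (cell CI B c) (cell CJ B' c') := fun c c' =>
        hBB'.mono Set.inter_subset_left Set.inter_subset_left
      rintro (c | c) (c' | c') hne
      · exact disjoint_cell (by simpa using hne)
      · exact hcr c c'
      · exact (hcr c' c).symm
      · exact disjoint_cell (by simpa using hne)
    have hind := hN.iIndepFun_of_fintype hD hdisj
    let SI : Finset ((I → Bool) ⊕ (J → Bool)) := Finset.univ.image Sum.inl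
    let SJ : Finset ((I → Bool) ⊕ (J → Bool)) := Finset.univ.image Sum.inr
    have hS : Disjoint SI SJ := by
      rw [Finset.disjoint_left]
      simp [SI, SJ]
    have h2 := hind.indepFun_finset SI SJ hS fun i => hN.measurable_apply (hD i)
    have hinl : ∀ c : I → Bool, Sum.inl c ∈ SI := fun c => by simp [SI]
    have hinr : ∀ c : J → Bool, Sum.inr c ∈ SJ := fun c => by simp [SJ]
    have h3 := h2.comp
      (φ := fun (x : SI → ℝ≥0∞) (i : I) => ∑ c : I → Bool,
        if c i then x ⟨Sum.inl c, hinl c⟩ else 0)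
      (ψ := fun (x : SJ → ℝ≥0∞) (i : J) => ∑ c : J → Bool,
        if c i then x ⟨Sum.inr c, hinr c⟩ else 0)
      (by
        refine measurable_pi_lambda _ fun i => Finset.measurable_sum _ fun c _ => ?_
        split_ifs <;> fun_prop)
      (by
        refine measurable_pi_lambda _ fun i => Finset.measurable_sum _ fun c _ => ?_
        split_ifs <;> fun_prop)
    convert! h3 using 1
    · funext w i
      simp only [Function.comp_apply]
      rw [Measure.restrict_apply (hCI i)]
      exact measure_inter_eq_sum_cell hB hCI (N w) i
    · funext w i
      simp only [Function.comp_apply]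
      rw [Measure.restrict_apply (hCJ i)]
      exact measure_inter_eq_sum_cell hB' hCJ (N w) i
  rw [IndepFun_iff_Indep] at key ⊢
  have hc : ∀ B : Set S, MeasurableSpace.comap (fun w => (N w).restrict B) inferInstance =
      MeasurableSpace.comap
        (fun w (C : {C : Set S // MeasurableSet C}) => (N w).restrict B C.1)
        MeasurableSpace.pi := by
    intro B
    rw [measure_comap_eq_pi, MeasurableSpace.comap_comp]
    rfl
  have h1 := hc B
  have h2 := hc B'
  rw [← h1, ← h2] at key
  exact key

/-! ### Integrals against the compensated random measure -/

/-- The compensated sum `∫ u dμ - ∫ u dν`. -/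
def _root_.Lark.compInt (ν : Measure S) (u : S → ℝ) (μ : Measure S) : ℝ :=
  ∫ p, u p ∂μ - ∫ p, u p ∂ν

theorem ae_integrable (hN : IsPoissonRandomMeasure N ν P) [IsProbabilityMeasure P]
    {u : S → ℝ} (hu : Measurable u) (hi : Integrable u ν) : ∀ᵐ w ∂P, Integrable u (N w) := by
  filter_upwards [hN.ae_lintegral_lt_top hu.enorm hi.2] with w hw
  exact ⟨hu.aestronglyMeasurable, hw⟩

/-- The Bochner integral is 0 for those μ that do not integrate `u`, so the difference of the
positive and negative parts is taken under an explicit integrability test, which is a measurable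
condition on μ. -/
theorem _root_.Lark.measurable_integral_measure {u : S → ℝ} (hu : Measurable u) :
    Measurable fun μ : Measure S => ∫ p, u p ∂μ := by
  classical
  have h : (fun μ : Measure S => ∫ p, u p ∂μ) = fun μ : Measure S =>
      if ∫⁻ p, ‖u p‖ₑ ∂μ < ∞ then (∫⁻ p, ENNReal.ofReal (u p) ∂μ).toReal -
        (∫⁻ p, ENNReal.ofReal (-u p) ∂μ).toReal else 0 := by
    funext μ
    split_ifs with hlt
    · exact integral_eq_lintegral_pos_part_sub_lintegral_neg_part ⟨hu.aestronglyMeasurable, hlt⟩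
    · exact integral_undef fun hi => hlt hi.2
  rw [h]
  refine Measurable.ite (measurableSet_lt (Measure.measurable_lintegral hu.enorm) measurable_const)
    ?_ measurable_const
  exact (Measure.measurable_lintegral hu.ennreal_ofReal).ennreal_toReal.sub
    (Measure.measurable_lintegral hu.neg.ennreal_ofReal).ennreal_toReal

theorem _root_.Lark.measurable_compInt {u : S → ℝ} (hu : Measurable u) :
    Measurable (compInt ν u) :=
  (measurable_integral_measure hu).sub_const _

theorem integrable_integral (hN : IsPoissonRandomMeasure N ν P) [IsProbabilityMeasure P]
    {u : S → ℝ} (hu : Measurable u) (hi : Integrable u ν) :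
    Integrable (fun w => ∫ p, u p ∂(N w)) P := by
  refine ⟨((measurable_integral_measure hu).comp hN.measurable).aestronglyMeasurable, ?_⟩
  refine lt_of_le_of_lt (lintegral_mono fun w => enorm_integral_le_lintegral_enorm _) ?_
  rw [hN.lintegral_lintegral hu.enorm]
  exact hi.2

theorem integral_integral (hN : IsPoissonRandomMeasure N ν P) [IsProbabilityMeasure P]
    {u : S → ℝ} (hu : Measurable u) (hi : Integrable u ν) :
    ∫ w, ∫ p, u p ∂(N w) ∂P = ∫ p, u p ∂ν := by
  have hp : ∫⁻ p, ENNReal.ofReal (u p) ∂ν < ∞ := hi.lintegral_lt_top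
  have hn : ∫⁻ p, ENNReal.ofReal (-u p) ∂ν < ∞ := hi.neg.lintegral_lt_top
  have hnu : Measurable fun p => -u p := hu.neg
  have hpm := hN.measurable_lintegral hu.ennreal_ofReal
  have hnm := hN.measurable_lintegral hnu.ennreal_ofReal
  have hp' := hN.ae_lintegral_lt_top hu.ennreal_ofReal hp
  have hn' := hN.ae_lintegral_lt_top hnu.ennreal_ofReal hn
  have h1 : ∫ w, ∫ p, u p ∂(N w) ∂P = ∫ w, ((∫⁻ p, ENNReal.ofReal (u p) ∂(N w)).toReal -
      (∫⁻ p, ENNReal.ofReal (-u p) ∂(N w)).toReal) ∂P := by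
    refine integral_congr_ae ?_
    filter_upwards [hN.ae_integrable hu hi] with w hw
    exact integral_eq_lintegral_pos_part_sub_lintegral_neg_part hw
  rw [h1, integral_sub, integral_toReal hpm.aemeasurable hp', integral_toReal hnm.aemeasurable hn',
    hN.lintegral_lintegral hu.ennreal_ofReal, hN.lintegral_lintegral hnu.ennreal_ofReal,
    integral_eq_lintegral_pos_part_sub_lintegral_neg_part hi]
  · exact integrable_toReal_of_lintegral_ne_top hpm.aemeasurable
      (by rw [hN.lintegral_lintegral hu.ennreal_ofReal]; exact hp.ne)
  · exact integrable_toReal_of_lintegral_ne_top hnm.aemeasurable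
      (by rw [hN.lintegral_lintegral hnu.ennreal_ofReal]; exact hn.ne)

theorem integral_compInt (hN : IsPoissonRandomMeasure N ν P) [IsProbabilityMeasure P]
    {u : S → ℝ} (hu : Measurable u) (hi : Integrable u ν) :
    ∫ w, compInt ν u (N w) ∂P = 0 := by
  simp only [compInt]
  rw [integral_sub (hN.integrable_integral hu hi) (integrable_const _),
    hN.integral_integral hu hi]
  simp

/-- The fibres of `u` over its nonzero values are disjoint with finite intensity, so their counts
are independent Poisson variables and variances add to ∑ y² ν(u = y). The value 0 is left out
because its fibre may have infinite intensity. -/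
theorem lintegral_compInt_sq_simpleFunc (hN : IsPoissonRandomMeasure N ν P)
    [IsProbabilityMeasure P] (u : SimpleFunc S ℝ) (hi : Integrable u ν) :
    ∫⁻ w, ‖compInt ν u (N w)‖ₑ ^ 2 ∂P = ∫⁻ p, ‖u p‖ₑ ^ 2 ∂ν := by
  classical
  have hfin : ∀ y ∈ u.range.filter (· ≠ 0), ν (u ⁻¹' {y}) ≠ ∞ := fun y hy =>
    (SimpleFunc.measure_preimage_lt_top_of_integrable u hi (Finset.mem_filter.1 hy).2).ne
  have hms : ∀ y : ℝ, MeasurableSet (u ⁻¹' {y}) := fun y => u.measurableSet_fiber y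
  let R := u.range.filter (· ≠ 0)
  let X : ℝ → W → ℝ := fun y w => (N w).real (u ⁻¹' {y}) * y
  have hint : ∀ μ : Measure S, Integrable u μ →
      ∫ p, u p ∂μ = ∑ y ∈ R, μ.real (u ⁻¹' {y}) * y := by
    intro μ hμ
    rw [← u.integral_eq_integral hμ, u.integral_eq_sum_of_subset (s := R)]
    · rfl
    · exact subset_rfl
  have hX2 : ∀ y ∈ R, MemLp (X y) 2 P := fun y hy =>
    (hN.memLp_two_real (hms y) (hfin y hy)).mul_const y
  have hind : Set.Pairwise (R : Set ℝ) fun y y' => IndepFun (X y) (X y') P := by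
    intro y hy y' hy' hne
    have h := hN.iIndepFun_of_fintype (κ := Bool) (D := fun b => u ⁻¹' {if b then y else y'})
      (fun b => hms _) (by
        intro b b' hb
        refine Disjoint.preimage _ ?_
        rw [Set.disjoint_singleton]
        cases b <;> cases b' <;> simp_all [eq_comm])
    have h2 := h.indepFun (i := true) (j := false) (by simp)
    have h3 := h2.comp (φ := fun x => x.toReal * y) (ψ := fun x => x.toReal * y')
      (by fun_prop) (by fun_prop)
    exact h3
  have hmem : MemLp (∑ y ∈ R, X y) 2 P := memLp_finsetSum' _ hX2
  have hcongr : ∀ᵐ w ∂P, compInt ν u (N w) = (∑ y ∈ R, X y) w - ∫ w, (∑ y ∈ R, X y) w ∂P := by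
    have hmean : ∫ w, (∑ y ∈ R, X y) w ∂P = ∫ p, u p ∂ν := by
      rw [hint ν hi]
      simp only [Finset.sum_apply]
      rw [integral_finsetSum]
      · refine Finset.sum_congr rfl fun y hy => ?_
        simp only [X]
        rw [integral_mul_const, hN.integral_real (hms y) (hfin y hy)]
      · exact fun y hy => (hX2 y hy).integrable (by norm_num)
    filter_upwards [hN.ae_integrable u.measurable hi] with w hw
    rw [hmean, compInt, hint _ hw]
    simp [X]
  have hvar : Var[∑ y ∈ R, X y; P] = ∑ y ∈ R, y ^ 2 * ν.real (u ⁻¹' {y}) := by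
    rw [IndepFun.variance_sum hX2 hind]
    refine Finset.sum_congr rfl fun y hy => ?_
    simp only [X]
    rw [variance_mul_const, hN.variance_real (hms y) (hfin y hy)]
    ring
  calc ∫⁻ w, ‖compInt ν u (N w)‖ₑ ^ 2 ∂P = eVar[∑ y ∈ R, X y; P] := by
        rw [evariance]
        refine lintegral_congr_ae ?_
        filter_upwards [hcongr] with w hw
        rw [hw]
    _ = ENNReal.ofReal (∑ y ∈ R, y ^ 2 * ν.real (u ⁻¹' {y})) := by
        rw [← hvar, hmem.ofReal_variance_eq]
    _ = ∑ y ∈ R, ‖y‖ₑ ^ 2 * ν (u ⁻¹' {y}) := by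
        rw [ENNReal.ofReal_sum_of_nonneg fun y _ => by positivity]
        refine Finset.sum_congr rfl fun y hy => ?_
        rw [ENNReal.ofReal_mul (sq_nonneg _), Measure.real, ENNReal.ofReal_toReal (hfin y hy),
          ← sq_abs, ENNReal.ofReal_pow (abs_nonneg _), ← Real.norm_eq_abs, ofReal_norm]
    _ = ∑ y ∈ u.range, ‖y‖ₑ ^ 2 * ν (u ⁻¹' {y}) := by
        refine Finset.sum_subset (Finset.filter_subset _ _) fun y hy hy' => ?_
        have : y = 0 := by simpa [R, Finset.mem_filter, hy] using hy'
        simp [this]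
    _ = ∫⁻ p, ‖u p‖ₑ ^ 2 ∂ν := by
        have h := (u.map fun y => ‖y‖ₑ ^ 2).lintegral_eq_lintegral ν
        rw [SimpleFunc.map_lintegral] at h
        rw [← h]
        rfl

/-- The second moment of a compensated integral is at most a multiple of the squared `L²` norm. -/
theorem lintegral_compInt_sq_le (hN : IsPoissonRandomMeasure N ν P) [IsProbabilityMeasure P]
    {u : S → ℝ} (hu : Measurable u) (hi : Integrable u ν) :
    ∫⁻ w, ‖compInt ν u (N w)‖ₑ ^ 2 ∂P ≤ 4 * ∫⁻ p, ‖u p‖ₑ ^ 2 ∂ν := by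
  let v : ℕ → SimpleFunc S ℝ := fun n => SimpleFunc.approxOn u hu Set.univ 0 (Set.mem_univ _) n
  -- This bound loses a factor 2 in norm, whence the 4 after squaring. The rest is Fatou's lemma;
  -- the constant is immaterial later.
  have hvle : ∀ n p, ‖v n p‖ ≤ ‖u p‖ + ‖u p‖ := fun n p =>
    SimpleFunc.norm_approxOn_zero_le hu (Set.mem_univ _) p n
  have hvlim : ∀ p, Tendsto (fun n => v n p) atTop (𝓝 (u p)) := fun p =>
    SimpleFunc.tendsto_approxOn hu (Set.mem_univ _) (by simp)
  have hint : ∀ μ : Measure S, Integrable u μ →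
      Tendsto (fun n => ∫ p, v n p ∂μ) atTop (𝓝 (∫ p, u p ∂μ)) := fun μ hμ =>
    tendsto_integral_of_dominated_convergence (fun p => ‖u p‖ + ‖u p‖)
      (fun n => (v n).aestronglyMeasurable) (hμ.norm.add hμ.norm)
      (fun n => ae_of_all _ (hvle n)) (ae_of_all _ hvlim)
  have hvi : ∀ n, Integrable (v n) ν := fun n =>
    (hi.norm.add hi.norm).mono' (v n).aestronglyMeasurable (ae_of_all _ (hvle n))
  have hb : ∀ n, ∫⁻ w, ‖compInt ν (v n) (N w)‖ₑ ^ 2 ∂P ≤ 4 * ∫⁻ p, ‖u p‖ₑ ^ 2 ∂ν := by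
    intro n
    rw [hN.lintegral_compInt_sq_simpleFunc (v n) (hvi n), ← lintegral_const_mul' _ _ (by norm_num)]
    refine lintegral_mono fun p => ?_
    have h1 : ‖v n p‖ₑ ≤ 2 * ‖u p‖ₑ := by
      rw [two_mul, ← ofReal_norm, ← ofReal_norm, ← ENNReal.ofReal_add (norm_nonneg _) (norm_nonneg _)]
      exact ENNReal.ofReal_le_ofReal (hvle n p)
    calc ‖v n p‖ₑ ^ 2 ≤ (2 * ‖u p‖ₑ) ^ 2 := by gcongr
      _ = 4 * ‖u p‖ₑ ^ 2 := by rw [mul_pow]; norm_num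
  have hlim : ∀ᵐ w ∂P, Tendsto (fun n => ‖compInt ν (v n) (N w)‖ₑ ^ 2) atTop
      (𝓝 (‖compInt ν u (N w)‖ₑ ^ 2)) := by
    filter_upwards [hN.ae_integrable hu hi] with w hw
    have := (hint _ hw).sub (hint ν hi)
    exact ((ENNReal.continuous_pow 2).tendsto _).comp this.enorm
  calc ∫⁻ w, ‖compInt ν u (N w)‖ₑ ^ 2 ∂P
      = ∫⁻ w, liminf (fun n => ‖compInt ν (v n) (N w)‖ₑ ^ 2) atTop ∂P := by
        refine lintegral_congr_ae ?_
        filter_upwards [hlim] with w hw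
        exact hw.liminf_eq.symm
    _ ≤ liminf (fun n => ∫⁻ w, ‖compInt ν (v n) (N w)‖ₑ ^ 2 ∂P) atTop :=
        lintegral_liminf_le fun n =>
          ((measurable_compInt (v n).measurable).comp hN.measurable).enorm.pow_const 2
    _ ≤ _ := liminf_le_of_le (by isBoundedDefault) fun b hb' => by
        obtain ⟨n, hn⟩ := hb'.exists
        exact hn.trans (hb n)

end IsPoissonRandomMeasure

/-! ### Regularization of random measures -/

section Kernel

variable {S : Type*} [MeasurableSpace S]

/-- The normalization of the restriction of a measure to `A`, as a kernel. -/
def normalizedKernel (A : Set S) (hA : MeasurableSet A) : Kernel (Measure S) S where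
  toFun μ := (μ A)⁻¹ • μ.restrict A
  measurable' := by
    refine Measure.measurable_of_measurable_coe _ fun C hC => ?_
    simp only [Measure.smul_apply, smul_eq_mul, Measure.restrict_apply hC]
    exact (Measure.measurable_coe hA).inv.mul (Measure.measurable_coe (hC.inter hA))

instance (A : Set S) (hA : MeasurableSet A) : IsFiniteKernel (normalizedKernel A hA) := by
  refine ⟨⟨1, ENNReal.one_lt_top, fun μ => ?_⟩⟩
  change ((μ A)⁻¹ • μ.restrict A) Set.univ ≤ 1
  simp only [Measure.smul_apply, smul_eq_mul, Measure.restrict_apply MeasurableSet.univ,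
    Set.univ_inter]
  exact ENNReal.inv_mul_le_one _

/-- The identity μ ↦ μ need not be an s-finite kernel on the space of all measures, yet (x, μ) ↦ ∫ u
x dμ has to be jointly measurable. Normalizing on each cell gives a finite kernel, a density
restores the mass, and the sum reproduces every measure that is finite on all cells. -/
theorem exists_isSFiniteKernel_eq_self {A : ℕ → Set S} (hA : ∀ n, MeasurableSet (A n))
    (hdisj : Pairwise (Function.onFun Disjoint A)) (hU : ⋃ n, A n = Set.univ) :
    ∃ U : Kernel (Measure S) S, IsSFiniteKernel U ∧
      ∀ μ : Measure S, (∀ n, μ (A n) ≠ ∞) → U μ = μ := by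
  -- The density takes values in ℝ≥0 so that each summand stays s-finite; an infinite mass is sent
  -- to 0, which does no harm as such μ are excluded.
  let c : ℕ → Measure S → S → ℝ≥0 := fun n μ _ => (μ (A n)).toNNReal
  have hc : ∀ n, Measurable (Function.uncurry fun μ p => (c n μ p : ℝ≥0∞)) := fun n =>
    (((Measure.measurable_coe (hA n)).ennreal_toNNReal).coe_nnreal_ennreal).comp measurable_fst
  refine ⟨Kernel.sum fun n => Kernel.withDensity (normalizedKernel (A n) (hA n))
    fun μ p => (c n μ p : ℝ≥0∞), inferInstance, fun μ hμ => ?_⟩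
  have h1 : ∀ n, Kernel.withDensity (normalizedKernel (A n) (hA n))
      (fun μ p => (c n μ p : ℝ≥0∞)) μ = μ.restrict (A n) := by
    intro n
    rw [Kernel.withDensity_apply _ (hc n)]
    change ((μ (A n))⁻¹ • μ.restrict (A n)).withDensity (fun _ => ((μ (A n)).toNNReal : ℝ≥0∞)) = _
    rw [withDensity_const, ENNReal.coe_toNNReal (hμ n), smul_smul]
    by_cases h0 : μ (A n) = 0
    · rw [Measure.restrict_eq_zero.2 h0, smul_zero]
    · rw [ENNReal.mul_inv_cancel h0 (hμ n), one_smul]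
  rw [Kernel.sum_apply]
  simp_rw [h1]
  rw [← Measure.restrict_iUnion hdisj hA, hU, Measure.restrict_univ]

variable {W : Type*} [MeasurableSpace W] {N : W → Measure S} {ν : Measure S} {P : Measure W}

/-- Almost surely N is finite on each of countably many cells of finite intensity. All μ ≤ N w are
included because restrictions of N w enter the maximal inequality. -/
theorem IsPoissonRandomMeasure.exists_isSFiniteKernel (hN : IsPoissonRandomMeasure N ν P)
    [SigmaFinite ν] :
    ∃ U : Kernel (Measure S) S, IsSFiniteKernel U ∧ ∀ᵐ w ∂P, ∀ μ ≤ N w, U μ = μ := by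
  let A : ℕ → Set S := disjointed (spanningSets ν)
  have hA : ∀ n, MeasurableSet (A n) := MeasurableSet.disjointed (measurableSet_spanningSets ν)
  have hAfin : ∀ n, ν (A n) ≠ ∞ := fun n =>
    ((measure_mono (disjointed_subset _ _)).trans_lt (measure_spanningSets_lt_top ν n)).ne
  obtain ⟨U, hUs, hU⟩ := exists_isSFiniteKernel_eq_self hA (disjoint_disjointed _)
    (by rw [iUnion_disjointed, iUnion_spanningSets])
  refine ⟨U, hUs, ?_⟩
  have : ∀ᵐ w ∂P, ∀ n, N w (A n) < ∞ := ae_all_iff.2 fun n => hN.ae_lt_top (hA n) (hAfin n)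
  filter_upwards [this] with w hw μ hμ
  exact hU μ fun n => ((hμ _).trans_lt (hw n)).ne

end Kernel

/-! ### Minkowski's integral inequality in `L²` -/

section Minkowski

variable {E S : Type*} [MeasurableSpace E] [MeasurableSpace S]

theorem eLpNorm_two_sq {F : Type*} [NormedAddCommGroup F] (f : E → F) (m : Measure E) :
    eLpNorm f 2 m ^ 2 = ∫⁻ x, ‖f x‖ₑ ^ 2 ∂m := by
  have h := eLpNorm_nnreal_pow_eq_lintegral (p := 2) (f := f) (μ := m) two_ne_zero
  simpa using h

theorem eLpNorm_two_eq {F : Type*} [NormedAddCommGroup F] (f : E → F) (m : Measure E) :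
    eLpNorm f 2 m = (∫⁻ x, ‖f x‖ₑ ^ 2 ∂m) ^ (1 / 2 : ℝ) := by
  rw [← eLpNorm_two_sq, ← ENNReal.rpow_natCast, ← ENNReal.rpow_mul]
  norm_num

theorem lintegral_mul_le_sqrt {f g : E → ℝ≥0∞} {m : Measure E} (hf : AEMeasurable f m)
    (hg : AEMeasurable g m) :
    ∫⁻ x, f x * g x ∂m ≤ (∫⁻ x, f x ^ 2 ∂m) ^ (1 / 2 : ℝ) * (∫⁻ x, g x ^ 2 ∂m) ^ (1 / 2 : ℝ) := by
  simpa using ENNReal.lintegral_mul_le_Lp_mul_Lq m Real.HolderConjugate.two_two hf hg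

/-- Write the square as a double integral over μ × μ, exchange with the integral in x, and apply
Cauchy–Schwarz in x. -/
theorem lintegral_lintegral_sq_le {m : Measure E} {μ : Measure S} [SFinite m] [SFinite μ]
    {K : E → S → ℝ≥0∞} (hK : Measurable (Function.uncurry K)) :
    ∫⁻ x, (∫⁻ p, K x p ∂μ) ^ 2 ∂m ≤ (∫⁻ p, (∫⁻ x, K x p ^ 2 ∂m) ^ (1 / 2 : ℝ) ∂μ) ^ 2 := by
  have hKx : ∀ x, Measurable (K x) := fun x => hK.of_uncurry_left
  have hKp : ∀ p, Measurable fun x => K x p := fun p => hK.of_uncurry_right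
  set n : S → ℝ≥0∞ := fun p => (∫⁻ x, K x p ^ 2 ∂m) ^ (1 / 2 : ℝ) with hn
  have hnm : Measurable n := (Measurable.lintegral_prod_left (hK.pow_const 2)).pow_const _
  calc ∫⁻ x, (∫⁻ p, K x p ∂μ) ^ 2 ∂m
      = ∫⁻ x, ∫⁻ z, K x z.1 * K x z.2 ∂(μ.prod μ) ∂m := by
        refine lintegral_congr fun x => ?_
        rw [sq, lintegral_prod_mul (hKx x).aemeasurable (hKx x).aemeasurable]
    _ = ∫⁻ z, ∫⁻ x, K x z.1 * K x z.2 ∂m ∂(μ.prod μ) := by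
        refine lintegral_lintegral_swap (Measurable.aemeasurable ?_)
        exact (hK.comp (measurable_fst.prodMk (measurable_fst.comp measurable_snd))).mul
          (hK.comp (measurable_fst.prodMk (measurable_snd.comp measurable_snd)))
    _ ≤ ∫⁻ z, n z.1 * n z.2 ∂(μ.prod μ) := lintegral_mono fun z =>
        lintegral_mul_le_sqrt (hKp _).aemeasurable (hKp _).aemeasurable
    _ = (∫⁻ p, n p ∂μ) ^ 2 := by
        rw [lintegral_prod_mul hnm.aemeasurable hnm.aemeasurable, sq]

theorem eLpNorm_lintegral_enorm_le {F : Type*} [NormedAddCommGroup F] [MeasurableSpace F]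
    [BorelSpace F] {m : Measure E} {μ : Measure S} [SFinite m] [SFinite μ]
    {K : E → S → F} (hK : Measurable (Function.uncurry K)) :
    (∫⁻ x, (∫⁻ p, ‖K x p‖ₑ ∂μ) ^ 2 ∂m) ^ (1 / 2 : ℝ) ≤
      ∫⁻ p, eLpNorm (fun x => K x p) 2 m ∂μ := by
  have h := lintegral_lintegral_sq_le (m := m) (μ := μ) (K := fun x p => ‖K x p‖ₑ) hK.enorm
  have h2 := ENNReal.rpow_le_rpow h (z := 1 / 2) (by norm_num)
  refine h2.trans (le_of_eq ?_)
  rw [← ENNReal.rpow_natCast, ← ENNReal.rpow_mul]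
  simp only [eLpNorm_two_eq]
  norm_num

/-- Minkowski's integral inequality. -/
theorem eLpNorm_integral_le {F : Type*} [NormedAddCommGroup F] [NormedSpace ℝ F]
    [MeasurableSpace F] [BorelSpace F] {m : Measure E} {μ : Measure S} [SFinite m] [SFinite μ]
    {K : E → S → F} (hK : Measurable (Function.uncurry K)) :
    eLpNorm (fun x => ∫ p, K x p ∂μ) 2 m ≤ ∫⁻ p, eLpNorm (fun x => K x p) 2 m ∂μ := by
  refine le_trans ?_ (eLpNorm_lintegral_enorm_le hK)
  rw [eLpNorm_two_eq]
  gcongr with x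
  exact enorm_integral_le_lintegral_enorm _

theorem ae_lintegral_enorm_lt_top {F : Type*} [NormedAddCommGroup F] [MeasurableSpace F]
    [BorelSpace F] {m : Measure E} {μ : Measure S} [SFinite m] [SFinite μ]
    {K : E → S → F} (hK : Measurable (Function.uncurry K))
    (h : ∫⁻ p, eLpNorm (fun x => K x p) 2 m ∂μ < ∞) :
    ∀ᵐ x ∂m, ∫⁻ p, ‖K x p‖ₑ ∂μ < ∞ := by
  have h1 := (eLpNorm_lintegral_enorm_le (m := m) (μ := μ) hK).trans_lt h
  have h2 : ∫⁻ x, (∫⁻ p, ‖K x p‖ₑ ∂μ) ^ 2 ∂m ≠ ∞ := by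
    intro h3
    rw [h3] at h1
    simp at h1
  have hm : Measurable fun x => (∫⁻ p, ‖K x p‖ₑ ∂μ) ^ 2 :=
    (Measurable.lintegral_prod_right hK.enorm).pow_const 2
  filter_upwards [ae_lt_top hm h2] with x hx
  by_contra h3
  simp [not_lt_top_iff.1 h3] at hx

end Minkowski

/-! ### A maximal inequality for compensated integrals -/

section Maximal

variable {E S W : Type*} [MeasurableSpace E] [MeasurableSpace S] [MeasurableSpace W]
  {N : W → Measure S} {ν : Measure S} {P : Measure W} {m : Measure E}

theorem measurable_measure_restrict {B : Set S} (hB : MeasurableSet B) :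
    Measurable fun μ : Measure S => μ.restrict B := by
  refine Measure.measurable_of_measurable_coe _ fun C hC => ?_
  simp only [Measure.restrict_apply hC]
  exact Measure.measurable_coe (hC.inter hB)

/-- Restriction affects only the integral against μ and not the one against ν. Sums over `B'` are
thus functions of the configuration in `B`, hence independent of the points outside `B`. -/
theorem compInt_indicator_restrict {B B' : Set S} (hB' : MeasurableSet B') (h : B' ⊆ B)
    (v : S → ℝ) (μ : Measure S) :
    compInt ν (B'.indicator v) (μ.restrict B) = compInt ν (B'.indicator v) μ := by
  simp only [compInt]
  rw [integral_indicator hB', integral_indicator hB', integral_indicator hB', Measure.restrict_restrict hB',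
    Set.inter_eq_left.2 h]

theorem compInt_add {u v : S → ℝ} {μ : Measure S} (hu : Integrable u ν) (hv : Integrable v ν)
    (hu' : Integrable u μ) (hv' : Integrable v μ) :
    compInt ν (u + v) μ = compInt ν u μ + compInt ν v μ := by
  simp only [compInt]
  rw [integral_add' hu hv, integral_add' hu' hv']
  ring

namespace IsPoissonRandomMeasure

theorem memLp_compInt (hN : IsPoissonRandomMeasure N ν P) [IsProbabilityMeasure P]
    {u : S → ℝ} (hu : Measurable u) (hi : Integrable u ν) (h2 : ∫⁻ p, ‖u p‖ₑ ^ 2 ∂ν < ∞) :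
    MemLp (fun w => compInt ν u (N w)) 2 P := by
  refine ⟨((measurable_compInt hu).comp hN.measurable).aestronglyMeasurable, ?_⟩
  have h := (hN.lintegral_compInt_sq_le hu hi).trans_lt (ENNReal.mul_lt_top (by norm_num) h2)
  rw [← eLpNorm_two_sq] at h
  by_contra h3
  simp [not_lt_top_iff.1 h3] at h

/-- Compensated sums over complementary sets are orthogonal, also on events that only depend on the
first set. -/
theorem setLIntegral_compInt_sq_le (hN : IsPoissonRandomMeasure N ν P) [IsProbabilityMeasure P]
    {B B' : Set S} (hB : MeasurableSet B) (hB' : MeasurableSet B') (hBB' : B ⊆ B')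
    {u : S → ℝ} (hu : Measurable u) (hi : IntegrableOn u B' ν)
    (h2 : ∫⁻ p, ‖u p‖ₑ ^ 2 ∂ν < ∞) {A : Set (Measure S)} (hA : MeasurableSet A) :
    ∫⁻ w in {w | (N w).restrict B ∈ A}, ‖compInt ν (B.indicator u) (N w)‖ₑ ^ 2 ∂P ≤
      ∫⁻ w in {w | (N w).restrict B ∈ A}, ‖compInt ν (B'.indicator u) (N w)‖ₑ ^ 2 ∂P := by
  have hind2 : ∀ D : Set S, ∫⁻ p, ‖D.indicator u p‖ₑ ^ 2 ∂ν < ∞ := fun D =>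
    lt_of_le_of_lt (lintegral_mono fun p => by
      gcongr
      exact enorm_indicator_le_enorm_self _ _) h2
  have hD : MeasurableSet (B' \ B) := hB'.diff hB
  have hi1 : Integrable (B.indicator u) ν := (hi.mono_set hBB').integrable_indicator hB
  have hi2 : Integrable ((B' \ B).indicator u) ν :=
    (hi.mono_set Set.sdiff_subset).integrable_indicator hD
  have hm1 : Measurable (B.indicator u) := hu.indicator hB
  have hm2 : Measurable ((B' \ B).indicator u) := hu.indicator hD
  set X : W → ℝ := fun w => compInt ν (B.indicator u) (N w) with hX
  set Y : W → ℝ := fun w => compInt ν ((B' \ B).indicator u) (N w) with hY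
  have hX2 : MemLp X 2 P := hN.memLp_compInt hm1 hi1 (hind2 _)
  have hY2 : MemLp Y 2 P := hN.memLp_compInt hm2 hi2 (hind2 _)
  have hNB : Measurable fun w => (N w).restrict B :=
    (measurable_measure_restrict hB).comp hN.measurable
  have hAm : MeasurableSet {w | (N w).restrict B ∈ A} := hNB hA
  set A' := {w | (N w).restrict B ∈ A} with hA'
  have hadd : ∀ᵐ w ∂P, compInt ν (B'.indicator u) (N w) = X w + Y w := by
    filter_upwards [hN.ae_integrable hm1 hi1, hN.ae_integrable hm2 hi2] with w hw1 hw2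
    rw [hX, hY]
    simp only
    rw [← compInt_add hi1 hi2 hw1 hw2]
    congr 1
    funext p
    by_cases hp : p ∈ B
    · simp [hp, hBB' hp]
    · by_cases hp' : p ∈ B' <;> simp [hp, hp']
  -- The factor X restricted to `A'` depends only on N in `B`, while Y depends only on N in `B' \ B`
  -- and has mean 0.
  have hcross : ∫ w in A', X w * Y w ∂P = 0 := by
    have hind := hN.indepFun_restrict hB hD Set.disjoint_sdiff_right
    have h3 := hind.comp
      (φ := A.indicator (compInt ν (B.indicator u))) (ψ := compInt ν ((B' \ B).indicator u))
      ((measurable_compInt hm1).indicator hA) (measurable_compInt hm2)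
    have h4 : A.indicator (compInt ν (B.indicator u)) ∘ (fun w => (N w).restrict B) =
        A'.indicator X := by
      funext w
      by_cases hw : (N w).restrict B ∈ A
      · have hw' : w ∈ A' := hw
        simp only [Function.comp_apply, Set.indicator_of_mem hw, Set.indicator_of_mem hw']
        exact compInt_indicator_restrict hB subset_rfl _ _
      · have hw' : w ∉ A' := hw
        simp only [Function.comp_apply, Set.indicator_of_notMem hw, Set.indicator_of_notMem hw']
    have h5 : compInt ν ((B' \ B).indicator u) ∘ (fun w => (N w).restrict (B' \ B)) = Y := by
      funext w
      exact compInt_indicator_restrict hD subset_rfl _ _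
    rw [h4, h5] at h3
    have h6 := h3.integral_mul_eq_mul_integral
      (hX2.aestronglyMeasurable.indicator hAm) hY2.aestronglyMeasurable
    rw [← integral_indicator hAm]
    have h7 : (A'.indicator fun w => X w * Y w) = A'.indicator X * Y := by
      funext w
      by_cases hw : w ∈ A' <;> simp [hw]
    rw [h7, h6, hY, hN.integral_compInt hm2 hi2, mul_zero]
  have hconv : ∀ Z : W → ℝ, MemLp Z 2 P →
      ∫⁻ w in A', ‖Z w‖ₑ ^ 2 ∂P = ENNReal.ofReal (∫ w in A', Z w ^ 2 ∂P) := by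
    intro Z hZ
    rw [ofReal_integral_eq_lintegral_ofReal (hZ.integrable_sq.integrableOn)
      (ae_of_all _ fun w => sq_nonneg _)]
    refine lintegral_congr fun w => ?_
    rw [← sq_abs, ENNReal.ofReal_pow (abs_nonneg _), ← Real.norm_eq_abs, ofReal_norm]
  have hXY : ∫⁻ w in A', ‖compInt ν (B'.indicator u) (N w)‖ₑ ^ 2 ∂P =
      ∫⁻ w in A', ‖(X + Y) w‖ₑ ^ 2 ∂P := by
    refine setLIntegral_congr_fun_ae hAm ?_
    filter_upwards [hadd] with w hw _
    rw [hw, Pi.add_apply]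
  rw [hXY, hconv X hX2, hconv _ (hX2.add hY2)]
  refine ENNReal.ofReal_le_ofReal ?_
  have hsplit : ∫ w in A', (X + Y) w ^ 2 ∂P =
      ∫ w in A', X w ^ 2 ∂P + 2 * ∫ w in A', X w * Y w ∂P + ∫ w in A', Y w ^ 2 ∂P := by
    have hXi := hX2.integrable_sq.integrableOn (s := A')
    have hYi := hY2.integrable_sq.integrableOn (s := A')
    have hXYi : IntegrableOn (fun w => 2 * (X w * Y w)) A' P :=
      ((hX2.integrable_mul hY2).const_mul 2).integrableOn
    have hsum : IntegrableOn (fun w => X w ^ 2 + 2 * (X w * Y w)) A' P := hXi.add hXYi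
    rw [← integral_const_mul, ← integral_add hXi hXYi, ← integral_add hsum hYi]
    refine integral_congr_ae (ae_of_all _ fun w => ?_)
    simp only [Pi.add_apply]
    ring
  rw [hsplit, hcross]
  have : 0 ≤ ∫ w in A', Y w ^ 2 ∂P := integral_nonneg fun w => sq_nonneg _
  linarith

end IsPoissonRandomMeasure

theorem measurable_compInt_kernel {U : Kernel (Measure S) S} [IsSFiniteKernel U] [SFinite ν]
    {u : E → S → ℝ} (hu : Measurable (Function.uncurry u)) :
    Measurable fun z : E × Measure S => compInt ν (u z.1) (U z.2) := by
  have h1 : StronglyMeasurable fun z : E × Measure S => ∫ p, u z.1 p ∂(U z.2) := by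
    have h := StronglyMeasurable.integral_kernel_prod_right'
      (κ := U.comap (Prod.snd : E × Measure S → Measure S) measurable_snd)
      (f := fun q : (E × Measure S) × S => u q.1.1 q.2)
      (hu.comp ((measurable_fst.comp measurable_fst).prodMk measurable_snd)).stronglyMeasurable
    simpa [Kernel.comap_apply] using h
  have h2 : StronglyMeasurable fun x : E => ∫ p, u x p ∂ν :=
    StronglyMeasurable.integral_prod_right hu.stronglyMeasurable
  exact h1.measurable.sub (h2.measurable.comp measurable_fst)

theorem integrableOn_of_lintegral_sq_lt_top {u : S → ℝ} (hu : Measurable u)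
    (h2 : ∫⁻ p, ‖u p‖ₑ ^ 2 ∂ν < ∞) {B : Set S} (hB : ν B ≠ ∞) : IntegrableOn u B ν := by
  have h : MemLp u 2 (ν.restrict B) := by
    refine ⟨hu.aestronglyMeasurable, ?_⟩
    have h3 : eLpNorm u 2 (ν.restrict B) ^ 2 < ∞ := by
      rw [eLpNorm_two_sq]
      exact (setLIntegral_le_lintegral _ _).trans_lt h2
    by_contra h4
    simp [not_lt_top_iff.1 h4] at h3
  have : IsFiniteMeasure (ν.restrict B) := ⟨by simpa using hB.lt_top⟩
  exact h.integrable (by norm_num)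

namespace IsPoissonRandomMeasure

variable {l : S → ℝ} {u : E → S → ℝ}

theorem measurable_uncurry_indicator {B : Set S} (hB : MeasurableSet B)
    (hu : Measurable (Function.uncurry u)) :
    Measurable (Function.uncurry fun x => B.indicator (u x)) := by
  have : (Function.uncurry fun x => B.indicator (u x)) =
      (Prod.snd ⁻¹' B).indicator (Function.uncurry u) := by
    funext z
    rfl
  rw [this]
  exact hu.indicator (measurable_snd hB)

/-- Kolmogorov's maximal inequality, for the partial compensated sums over the sets `{ε < l}`. -/
theorem mul_measure_exists_finset_le (hN : IsPoissonRandomMeasure N ν P) [IsProbabilityMeasure P]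
    [SigmaFinite ν] [SFinite m] (hl : Measurable l) (hlν : ∀ ε > 0, ν {p | ε < l p} ≠ ∞)
    (hu : Measurable (Function.uncurry u)) (h2 : ∫⁻ x, ∫⁻ p, ‖u x p‖ₑ ^ 2 ∂ν ∂m < ∞)
    (T : Finset ℝ) (hT : ∀ ε ∈ T, 0 < ε) (c : ℝ≥0∞) :
    c * P {w | ∃ ε ∈ T, c < ∫⁻ x, ‖compInt ν ({p | ε < l p}.indicator (u x)) (N w)‖ₑ ^ 2 ∂m} ≤
      4 * ∫⁻ x, ∫⁻ p, ‖u x p‖ₑ ^ 2 ∂ν ∂m := by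
  classical
  obtain ⟨U, hUs, hU⟩ := hN.exists_isSFiniteKernel
  rcases T.eq_empty_or_nonempty with rfl | hTne
  · simp
  let B : ℝ → Set S := fun ε => {p | ε < l p}
  have hB : ∀ ε, MeasurableSet (B ε) := fun ε => measurableSet_lt measurable_const hl
  have hBanti : ∀ {ε ε' : ℝ}, ε ≤ ε' → B ε' ⊆ B ε := fun h p (hp : _ < l p) =>
    show _ < l p from h.trans_lt hp
  -- The smallest level is the terminal time of the martingale: {e < l} contains all the other sets.
  let e := T.min' hTne
  have he : 0 < e := hT e (T.min'_mem hTne)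
  have hub : ∀ ε, Measurable (Function.uncurry fun x => (B ε).indicator (u x)) := fun ε =>
    measurable_uncurry_indicator (hB ε) hu
  let D : ℝ → E × Measure S → ℝ≥0∞ := fun ε z =>
    ‖compInt ν ((B ε).indicator (u z.1)) (U z.2)‖ₑ ^ 2
  have hDm : ∀ ε, Measurable (D ε) := fun ε =>
    (measurable_compInt_kernel (hub ε)).enorm.pow_const 2
  let Y : ℝ → Measure S → ℝ≥0∞ := fun ε μ => ∫⁻ x, D ε (x, μ) ∂m
  have hYm : ∀ ε, Measurable (Y ε) := fun ε => (hDm ε).lintegral_prod_left'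
  -- First passage, with levels running downwards: ε is the largest level of T at which the
  -- threshold is exceeded. The condition involves only levels ≥ ε, so it can be read off from N
  -- restricted to {ε < l}.
  let A : ℝ → Set (Measure S) := fun ε =>
    {μ | c < Y ε μ} ∩ ⋂ ε' ∈ T.filter (ε < ·), {μ | Y ε' μ ≤ c}
  have hA : ∀ ε, MeasurableSet (A ε) := fun ε =>
    (measurableSet_lt measurable_const (hYm ε)).inter
      (Finset.measurableSet_biInter _ fun ε' _ => measurableSet_le (hYm ε') measurable_const)
  let A' : ℝ → Set W := fun ε => {w | (N w).restrict (B ε) ∈ A ε}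
  have hNB : ∀ ε, Measurable fun w => (N w).restrict (B ε) := fun ε =>
    (measurable_measure_restrict (hB ε)).comp hN.measurable
  have hA' : ∀ ε, MeasurableSet (A' ε) := fun ε => hNB ε (hA ε)
  have hYr : ∀ᵐ w ∂P, ∀ ε ε', ε ≤ ε' → Y ε' ((N w).restrict (B ε)) = Y ε' (N w) := by
    filter_upwards [hU] with w hw ε ε' hle
    simp only [Y, D]
    rw [hw _ Measure.restrict_le_self, hw _ le_rfl]
    refine lintegral_congr fun x => ?_
    rw [compInt_indicator_restrict (hB ε') (hBanti hle)]
  have hYN : ∀ᵐ w ∂P, ∀ ε, Y ε (N w) =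
      ∫⁻ x, ‖compInt ν ((B ε).indicator (u x)) (N w)‖ₑ ^ 2 ∂m := by
    filter_upwards [hU] with w hw ε
    simp only [Y, D]
    rw [hw _ le_rfl]
  have hcov : P {w | ∃ ε ∈ T, c < ∫⁻ x, ‖compInt ν ((B ε).indicator (u x)) (N w)‖ₑ ^ 2 ∂m} ≤
      P (⋃ ε ∈ T, A' ε) := by
    refine measure_mono_ae ?_
    filter_upwards [hYr, hYN] with w h1 h3 hw
    obtain ⟨ε₀, hε₀, hc₀⟩ : ∃ ε ∈ T, c < ∫⁻ x, ‖compInt ν ((B ε).indicator (u x)) (N w)‖ₑ ^ 2 ∂m :=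
      hw
    let Q := T.filter fun ε => c < Y ε (N w)
    have hQ : Q.Nonempty := ⟨ε₀, Finset.mem_filter.2 ⟨hε₀, by rw [h3]; exact hc₀⟩⟩
    have hmax := Finset.mem_filter.1 (Q.max'_mem hQ)
    refine Set.mem_biUnion hmax.1 ?_
    change (N w).restrict (B (Q.max' hQ)) ∈ A (Q.max' hQ)
    refine ⟨?_, Set.mem_iInter₂.2 fun ε' hε' => ?_⟩
    · change c < Y _ _
      rw [h1 _ _ le_rfl]
      exact hmax.2
    · change Y _ _ ≤ c
      rw [Finset.mem_filter] at hε'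
      rw [h1 _ _ hε'.2.le]
      by_contra hlt
      exact absurd (Q.le_max' ε' (Finset.mem_filter.2 ⟨hε'.1, not_le.1 hlt⟩)) (not_le.2 hε'.2)
  have hdisj : Set.Pairwise (T : Set ℝ) (Function.onFun (AEDisjoint P) A') := by
    have hlt : ∀ ε ε', ε' ∈ T → ε < ε' → AEDisjoint P (A' ε) (A' ε') := by
      intro ε ε' hε' hlt
      change P (A' ε ∩ A' ε') = 0
      refine measure_eq_zero_iff_ae_notMem.2 ?_
      filter_upwards [hYr] with w h1 hw
      have hw1 : (N w).restrict (B ε) ∈ A ε := hw.1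
      have hw2 : (N w).restrict (B ε') ∈ A ε' := hw.2
      have h4 : Y ε' ((N w).restrict (B ε)) ≤ c :=
        Set.mem_iInter₂.1 hw1.2 ε' (Finset.mem_filter.2 ⟨hε', hlt⟩)
      have h5 : c < Y ε' ((N w).restrict (B ε')) := hw2.1
      rw [h1 _ _ hlt.le] at h4
      rw [h1 _ _ le_rfl] at h5
      exact absurd h4 (not_le.2 h5)
    intro ε hε ε' hε' hne
    rcases lt_or_gt_of_ne hne with h | h
    · exact hlt ε ε' hε' h
    · exact (hlt ε' ε hε h).symm
  have hone : ∀ ε ∈ T, c * P (A' ε) ≤ ∫⁻ w in A' ε, Y e (N w) ∂P := by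
    intro ε hε
    have hee : e ≤ ε := T.min'_le ε hε
    have hswap : ∀ ε', ∫⁻ w in A' ε, Y ε' (N w) ∂P =
        ∫⁻ x, ∫⁻ w in A' ε, ‖compInt ν ((B ε').indicator (u x)) (N w)‖ₑ ^ 2 ∂P ∂m := by
      intro ε'
      simp only [Y]
      rw [lintegral_lintegral_swap]
      · refine lintegral_congr fun x => setLIntegral_congr_fun_ae (hA' ε) ?_
        filter_upwards [hU] with w hw _
        simp only [D]
        rw [hw _ le_rfl]
      · exact ((hDm ε').comp
          (measurable_snd.prodMk (hN.measurable.comp measurable_fst))).aemeasurable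
    calc c * P (A' ε) = ∫⁻ _ in A' ε, c ∂P := by simp
      _ ≤ ∫⁻ w in A' ε, Y ε (N w) ∂P := by
          refine setLIntegral_mono_ae' (hA' ε) ?_
          filter_upwards [hYr] with w h1 hw
          have hw1 : (N w).restrict (B ε) ∈ A ε := hw
          have h5 : c < Y ε ((N w).restrict (B ε)) := hw1.1
          rw [h1 _ _ le_rfl] at h5
          exact h5.le
      -- Orthogonality is used for each fixed x after Tonelli, the event being the same for all x.
      _ ≤ ∫⁻ w in A' ε, Y e (N w) ∂P := by
          rw [hswap, hswap]
          refine lintegral_mono_ae ?_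
          have hm2 : Measurable fun x => ∫⁻ p, ‖u x p‖ₑ ^ 2 ∂ν :=
            Measurable.lintegral_prod_right (hu.enorm.pow_const 2)
          filter_upwards [MeasureTheory.ae_lt_top hm2 h2.ne] with x hx
          have hux : Measurable (u x) := hu.of_uncurry_left
          exact hN.setLIntegral_compInt_sq_le (hB ε) (hB e) (hBanti hee) hux
            (integrableOn_of_lintegral_sq_lt_top hux hx (hlν e he)) hx (hA ε)
  calc c * P _ ≤ c * P (⋃ ε ∈ T, A' ε) := by gcongr
    _ ≤ c * ∑ ε ∈ T, P (A' ε) := by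
        gcongr
        exact measure_biUnion_finset_le _ _
    _ = ∑ ε ∈ T, c * P (A' ε) := Finset.mul_sum _ _ _
    _ ≤ ∑ ε ∈ T, ∫⁻ w in A' ε, Y e (N w) ∂P := Finset.sum_le_sum hone
    _ = ∫⁻ w in ⋃ ε ∈ T, A' ε, Y e (N w) ∂P :=
        (lintegral_biUnion_finset₀ hdisj (fun ε _ => (hA' ε).nullMeasurableSet) _).symm
    _ ≤ ∫⁻ w, Y e (N w) ∂P := setLIntegral_le_lintegral _ _
    _ = ∫⁻ x, ∫⁻ w, ‖compInt ν ((B e).indicator (u x)) (N w)‖ₑ ^ 2 ∂P ∂m := by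
        simp only [Y]
        rw [lintegral_lintegral_swap]
        · refine lintegral_congr fun x => lintegral_congr_ae ?_
          filter_upwards [hU] with w hw
          simp only [D]
          rw [hw _ le_rfl]
        · exact ((hDm e).comp
            (measurable_snd.prodMk (hN.measurable.comp measurable_fst))).aemeasurable
    _ ≤ ∫⁻ x, 4 * ∫⁻ p, ‖u x p‖ₑ ^ 2 ∂ν ∂m := by
        refine lintegral_mono_ae ?_
        have hm2 : Measurable fun x => ∫⁻ p, ‖u x p‖ₑ ^ 2 ∂ν :=
          Measurable.lintegral_prod_right (hu.enorm.pow_const 2)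
        filter_upwards [MeasureTheory.ae_lt_top hm2 h2.ne] with x hx
        have hux : Measurable (u x) := hu.of_uncurry_left
        refine (hN.lintegral_compInt_sq_le (hux.indicator (hB e))
          ((integrableOn_of_lintegral_sq_lt_top hux hx (hlν e he)).integrable_indicator
            (hB e))).trans ?_
        gcongr with p
        exact enorm_indicator_le_enorm_self _ _
    _ = 4 * ∫⁻ x, ∫⁻ p, ‖u x p‖ₑ ^ 2 ∂ν ∂m :=
        lintegral_const_mul' _ _ (by norm_num)

end IsPoissonRandomMeasure
end Maximal

/-! ### The maximal inequality over all levels, and uniform smallness of the small jumps. -/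

section Small

variable {E S W : Type*} [MeasurableSpace E] [MeasurableSpace S] [MeasurableSpace W]
  {N : W → Measure S} {ν : Measure S} {P : Measure W} {m : Measure E} {l : S → ℝ} {u : E → S → ℝ}

/-- The sets {l ≤ δ₀/(n+1)} decrease to {l ≤ 0}, which is null, so the measure g dμ, finite on the
first of them, tends to 0 along them. -/
theorem exists_setLIntegral_le_of_measure_eq_zero {μ : Measure S} (hl : Measurable l)
    {g : S → ℝ≥0∞} {δ₀ : ℝ} (hδ₀ : 0 < δ₀)
    (hfin : ∫⁻ p in {p | l p ≤ δ₀}, g p ∂μ < ∞) (h0 : μ {p | l p ≤ 0} = 0) {η : ℝ≥0∞}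
    (hη : 0 < η) : ∃ δ, 0 < δ ∧ δ ≤ δ₀ ∧ ∫⁻ p in {p | l p ≤ δ}, g p ∂μ ≤ η := by
  let D : ℕ → Set S := fun n => {p | l p ≤ δ₀ / (n + 1)}
  have hD : ∀ n, MeasurableSet (D n) := fun n => measurableSet_le hl measurable_const
  have hpos : ∀ n : ℕ, 0 < δ₀ / (n + 1 : ℝ) := fun n => by positivity
  have hle : ∀ n : ℕ, δ₀ / (n + 1 : ℝ) ≤ δ₀ := fun n =>
    div_le_self hδ₀.le (by linarith [n.cast_nonneg (α := ℝ)])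
  have hanti : Antitone D := by
    intro a b hab p hp
    have hp' : l p ≤ δ₀ / (b + 1) := hp
    have hab' : (a : ℝ) ≤ b := by exact_mod_cast hab
    exact show l p ≤ δ₀ / (a + 1) from hp'.trans (by gcongr)
  have hinter : ⋂ n, D n ⊆ {p | l p ≤ 0} := by
    intro p hp
    have hlim : Tendsto (fun n : ℕ => δ₀ / (n + 1 : ℝ)) atTop (𝓝 0) := by
      simpa [div_eq_mul_inv] using
        (tendsto_one_div_add_atTop_nhds_zero_nat (𝕜 := ℝ)).const_mul δ₀
    exact ge_of_tendsto' hlim fun n => show l p ≤ δ₀ / (n + 1 : ℝ) from Set.mem_iInter.1 hp n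
  have hlim : Tendsto (fun n => (μ.withDensity g) (D n)) atTop (𝓝 0) := by
    have hz : (μ.withDensity g) (⋂ n, D n) = 0 :=
      withDensity_absolutelyContinuous μ g (measure_mono_null hinter h0)
    rw [← hz]
    refine tendsto_measure_iInter_atTop (fun n => (hD n).nullMeasurableSet) hanti ⟨0, ?_⟩
    rw [withDensity_apply _ (hD 0)]
    have : D 0 = {p | l p ≤ δ₀} := by simp [D]
    rw [this]
    exact hfin.ne
  obtain ⟨n, hn⟩ := (hlim.eventually (gt_mem_nhds hη)).exists
  refine ⟨δ₀ / (n + 1), hpos n, hle n, ?_⟩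
  rw [withDensity_apply _ (hD n)] at hn
  exact hn.le

/-- Sums over the sets `{ε < l}` are right-continuous in `ε`. -/
theorem tendsto_integral_indicator_lt {μ : Measure S} (hl : Measurable l) {v : S → ℝ} {ε : ℝ}
    (hv : IntegrableOn v {p | ε < l p} μ) {e : ℕ → ℝ} (he : ∀ n, ε < e n)
    (hlim : Tendsto e atTop (𝓝 ε)) :
    Tendsto (fun n => ∫ p, ({p | e n < l p}.indicator v) p ∂μ) atTop
      (𝓝 (∫ p, ({p | ε < l p}.indicator v) p ∂μ)) := by
  have hB : ∀ a, MeasurableSet {p | a < l p} := fun a => measurableSet_lt measurable_const hl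
  refine tendsto_integral_of_dominated_convergence
    (fun p => ‖({p | ε < l p}.indicator v) p‖) (fun n => ?_) ?_ (fun n => ?_) ?_
  · have hsub : {p | e n < l p} ⊆ {p | ε < l p} := fun p (hp : _ < l p) =>
      show _ < l p from (he n).trans hp
    exact ((hv.mono_set hsub).integrable_indicator (hB _)).aestronglyMeasurable
  · exact (hv.integrable_indicator (hB ε)).norm
  · refine ae_of_all _ fun p => ?_
    by_cases hp : e n < l p
    · have hp' : ε < l p := (he n).trans hp
      simp [Set.indicator, hp, hp']
    · simp [Set.indicator, hp]
  · refine ae_of_all _ fun p => ?_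
    by_cases hp : ε < l p
    · refine tendsto_const_nhds.congr' ?_
      filter_upwards [hlim.eventually (gt_mem_nhds hp)] with n hn
      simp [Set.indicator, hp, hn]
    · have : ∀ n, ¬ e n < l p := fun n hn => hp ((he n).trans hn)
      simp [Set.indicator, hp, this]

theorem measurable_eLpNorm_two [SFinite m] (hu : Measurable (Function.uncurry u)) :
    Measurable fun p => eLpNorm (fun x => u x p) 2 m := by
  simp only [eLpNorm_two_eq]
  exact (Measurable.lintegral_prod_left (hu.enorm.pow_const 2)).pow_const _

theorem lintegral_eLpNorm_two_sq [SFinite m] [SFinite ν] (hu : Measurable (Function.uncurry u)) :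
    ∫⁻ p, eLpNorm (fun x => u x p) 2 m ^ 2 ∂ν = ∫⁻ x, ∫⁻ p, ‖u x p‖ₑ ^ 2 ∂ν ∂m := by
  simp only [eLpNorm_two_sq]
  rw [lintegral_lintegral_swap]
  exact ((hu.comp measurable_swap).enorm.pow_const 2).aemeasurable

theorem setLIntegral_lt_top_of_lintegral_sq {g : S → ℝ≥0∞} (hg : Measurable g)
    (h : ∫⁻ p, g p ^ 2 ∂ν < ∞) {B : Set S} (hB : ν B ≠ ∞) : ∫⁻ p in B, g p ∂ν < ∞ := by
  have h1 := lintegral_mul_le_sqrt (m := ν.restrict B) hg.aemeasurable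
    (aemeasurable_const (b := (1 : ℝ≥0∞)))
  simp only [mul_one, one_pow, lintegral_one, Measure.restrict_apply_univ] at h1
  refine h1.trans_lt (ENNReal.mul_lt_top ?_ ?_)
  · exact ENNReal.rpow_lt_top_of_nonneg (by norm_num)
      ((setLIntegral_le_lintegral _ _).trans_lt h).ne
  · exact ENNReal.rpow_lt_top_of_nonneg (by norm_num) hB

namespace IsPoissonRandomMeasure

theorem ae_forall_pos_setLIntegral_lt_top (hN : IsPoissonRandomMeasure N ν P)
    [IsProbabilityMeasure P] (hl : Measurable l) (hlν : ∀ ε > 0, ν {p | ε < l p} ≠ ∞)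
    {g : S → ℝ≥0∞} (hg : Measurable g) (hfin : ∀ᵐ p ∂ν, g p < ∞) :
    ∀ᵐ w ∂P, ∀ ε > 0, ∫⁻ p in {p | ε < l p}, g p ∂(N w) < ∞ := by
  have h : ∀ᵐ w ∂P, ∀ n : ℕ, ∫⁻ p in {p | 1 / (n + 1 : ℝ) < l p}, g p ∂(N w) < ∞ :=
    ae_all_iff.2 fun n => hN.ae_setLIntegral_lt_top (measurableSet_lt measurable_const hl)
      (hlν _ (by positivity)) hg hfin
  filter_upwards [h] with w hw ε hε
  obtain ⟨n, hn⟩ := exists_nat_one_div_lt hε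
  refine (lintegral_mono_set ?_).trans_lt (hw n)
  exact fun p (hp : ε < l p) => show _ < l p from hn.trans hp

theorem ae_forall_pos_measure_lt_top (hN : IsPoissonRandomMeasure N ν P)
    [IsProbabilityMeasure P] (hl : Measurable l) (hlν : ∀ ε > 0, ν {p | ε < l p} ≠ ∞) :
    ∀ᵐ w ∂P, ∀ ε > 0, N w {p | ε < l p} < ∞ := by
  filter_upwards [hN.ae_forall_pos_setLIntegral_lt_top hl hlν (g := fun _ => 1) measurable_const
    (ae_of_all _ fun _ => ENNReal.one_lt_top)] with w hw ε hε
  simpa using hw ε hε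

/-- Finite sets of positive rational levels increase to all of them. For real ε, rational levels
decreasing to ε give compensated sums that converge for almost every x, so by Fatou the threshold is
exceeded at ε only if it is exceeded at some rational level. -/
theorem mul_measure_exists_pos_le (hN : IsPoissonRandomMeasure N ν P) [IsProbabilityMeasure P]
    [SigmaFinite ν] [SFinite m] (hl : Measurable l) (hlν : ∀ ε > 0, ν {p | ε < l p} ≠ ∞)
    (hu : Measurable (Function.uncurry u)) (h2 : ∫⁻ x, ∫⁻ p, ‖u x p‖ₑ ^ 2 ∂ν ∂m < ∞)
    (c : ℝ≥0∞) :
    c * P {w | ∃ ε > 0, c < ∫⁻ x, ‖compInt ν ({p | ε < l p}.indicator (u x)) (N w)‖ₑ ^ 2 ∂m} ≤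
      4 * ∫⁻ x, ∫⁻ p, ‖u x p‖ₑ ^ 2 ∂ν ∂m := by
  classical
  obtain ⟨U, hUs, hU⟩ := hN.exists_isSFiniteKernel
  let Y : ℝ → W → ℝ≥0∞ := fun ε w =>
    ∫⁻ x, ‖compInt ν ({p | ε < l p}.indicator (u x)) (N w)‖ₑ ^ 2 ∂m
  have hB : ∀ a, MeasurableSet {p | a < l p} := fun a => measurableSet_lt measurable_const hl
  -- The default 1 fills the indices that code no rational; it is one more positive level and does
  -- no harm.
  let q : ℕ → ℝ := fun n => (((Encodable.decode (α := ℚ) n).getD 1 : ℚ) : ℝ)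
  have hq : ∀ r : ℚ, ∃ n, q n = r := fun r => ⟨Encodable.encode r, by simp [q]⟩
  let T : ℕ → Finset ℝ := fun n => ((Finset.range n).image q).filter (0 < ·)
  have hTmono : Monotone T := by
    intro a b hab
    refine Finset.filter_subset_filter _ (Finset.image_subset_image ?_)
    exact Finset.range_mono hab
  let F : ℕ → Set W := fun n => {w | ∃ ε ∈ T n, c < Y ε w}
  have hFmono : Monotone F := fun a b hab w ⟨ε, hε, h⟩ => ⟨ε, hTmono hab hε, h⟩
  have hFle : ∀ n, c * P (F n) ≤ 4 * ∫⁻ x, ∫⁻ p, ‖u x p‖ₑ ^ 2 ∂ν ∂m := fun n =>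
    hN.mul_measure_exists_finset_le hl hlν hu h2 (T n)
      (fun ε hε => (Finset.mem_filter.1 hε).2) c
  have hVm := measurable_eLpNorm_two (m := m) hu
  have hV2 : ∫⁻ p, eLpNorm (fun x => u x p) 2 m ^ 2 ∂ν < ∞ := by
    rwa [lintegral_eLpNorm_two_sq hu]
  have hVfin : ∀ᵐ p ∂ν, eLpNorm (fun x => u x p) 2 m < ∞ := by
    filter_upwards [MeasureTheory.ae_lt_top (hVm.pow_const 2) hV2.ne] with p hp
    by_contra h
    simp [not_lt_top_iff.1 h] at hp
  have hcov : P {w | ∃ ε > 0, c < Y ε w} ≤ P (⋃ n, F n) := by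
    refine measure_mono_ae ?_
    filter_upwards [hU, hN.ae_forall_pos_setLIntegral_lt_top hl hlν hVm hVfin,
      hN.ae_forall_pos_measure_lt_top hl hlν] with w hUw hNw hNf hw
    obtain ⟨ε, hε, hc⟩ : ∃ ε > 0, c < Y ε w := hw
    have hrat : ∀ n : ℕ, ∃ r : ℚ, ε < r ∧ (r : ℝ) < ε + 1 / (n + 1) := fun n =>
      exists_rat_btwn (by linarith [show (0 : ℝ) < 1 / (n + 1) by positivity])
    choose r hr1 hr2 using hrat
    have hrlim : Tendsto (fun n => (r n : ℝ)) atTop (𝓝 ε) := by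
      refine tendsto_of_tendsto_of_tendsto_of_le_of_le tendsto_const_nhds ?_
        (fun n => (hr1 n).le) (fun n => (hr2 n).le)
      simpa using tendsto_const_nhds.add (tendsto_one_div_add_atTop_nhds_zero_nat (𝕜 := ℝ))
    suffices h : ∃ n, c < Y (r n) w by
      obtain ⟨n, hn⟩ := h
      obtain ⟨k, hk⟩ := hq (r n)
      refine Set.mem_iUnion.2 ⟨k + 1, show ∃ ε ∈ T (k + 1), c < Y ε w from ⟨r n, ?_, hn⟩⟩
      refine Finset.mem_filter.2 ⟨Finset.mem_image.2 ⟨k, by simp, hk⟩, hε.trans (hr1 n)⟩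
    by_contra hno
    push Not at hno
    refine absurd hc (not_lt.2 ?_)
    -- Used for both N w and ν: by Minkowski's inequality, integrability of the norms in L²(m) gives
    -- integrability for almost every x, the domination behind right-continuity in the level.
    have hintx : ∀ μ : Measure S, μ {p | ε < l p} < ∞ →
        ∫⁻ p in {p | ε < l p}, eLpNorm (fun x => u x p) 2 m ∂μ < ∞ →
        ∀ᵐ x ∂m, IntegrableOn (u x) {p | ε < l p} μ := by
      intro μ hμ hμ2
      have : IsFiniteMeasure (μ.restrict {p | ε < l p}) := ⟨by simpa using hμ⟩
      filter_upwards [ae_lintegral_enorm_lt_top (m := m) hu hμ2] with x hx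
      exact ⟨(hu.of_uncurry_left).aestronglyMeasurable, hx⟩
    have hx1 := hintx (N w) (hNf ε hε) (hNw ε hε)
    have hx2 := hintx ν (hlν ε hε).lt_top (setLIntegral_lt_top_of_lintegral_sq hVm hV2 (hlν ε hε))
    have hlimx : ∀ᵐ x ∂m, Tendsto
        (fun n => ‖compInt ν ({p | (r n : ℝ) < l p}.indicator (u x)) (N w)‖ₑ ^ 2) atTop
        (𝓝 (‖compInt ν ({p | ε < l p}.indicator (u x)) (N w)‖ₑ ^ 2)) := by
      filter_upwards [hx1, hx2] with x h1 h2
      have := (tendsto_integral_indicator_lt hl h1 hr1 hrlim).sub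
        (tendsto_integral_indicator_lt hl h2 hr1 hrlim)
      exact ((ENNReal.continuous_pow 2).tendsto _).comp this.enorm
    have hmeas : ∀ n, Measurable fun x =>
        ‖compInt ν ({p | (r n : ℝ) < l p}.indicator (u x)) (N w)‖ₑ ^ 2 := by
      intro n
      have h := (measurable_compInt_kernel (U := U) (ν := ν)
        (measurable_uncurry_indicator (hB (r n)) hu)).comp
        (measurable_id.prodMk (measurable_const (a := N w)))
      simp only [Function.comp_def, id, hUw _ le_rfl] at h
      exact h.enorm.pow_const 2
    calc Y ε w = ∫⁻ x, liminf (fun n =>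
          ‖compInt ν ({p | (r n : ℝ) < l p}.indicator (u x)) (N w)‖ₑ ^ 2) atTop ∂m := by
          refine lintegral_congr_ae ?_
          filter_upwards [hlimx] with x hx
          exact hx.liminf_eq.symm
      _ ≤ liminf (fun n => Y (r n) w) atTop := lintegral_liminf_le hmeas
      _ ≤ c := liminf_le_of_le (by isBoundedDefault) fun b hb => by
          obtain ⟨n, hn⟩ := hb.exists
          exact hn.trans (hno n)
  calc c * P {w | ∃ ε > 0, c < Y ε w} ≤ c * P (⋃ n, F n) := by gcongr
    _ = ⨆ n, c * P (F n) := by rw [hFmono.measure_iUnion, ENNReal.mul_iSup]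
    _ ≤ _ := iSup_le hFle

/-- Almost surely, the compensated sums over `{ε < l ≤ δ}` are small in `L²`, uniformly in `ε`. -/
theorem ae_exists_lintegral_compInt_le (hN : IsPoissonRandomMeasure N ν P) [IsProbabilityMeasure P]
    [SigmaFinite ν] [SFinite m] (hl : Measurable l) (hlν : ∀ ε > 0, ν {p | ε < l p} ≠ ∞)
    (hl0 : ν {p | l p ≤ 0} = 0)
    (hu : Measurable (Function.uncurry u)) (h2 : ∫⁻ x, ∫⁻ p, ‖u x p‖ₑ ^ 2 ∂ν ∂m < ∞) :
    ∀ᵐ w ∂P, ∀ η > 0, ∀ δ₀ > 0, ∃ δ, 0 < δ ∧ δ ≤ δ₀ ∧ ∀ ε > 0,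
      ∫⁻ x, ‖compInt ν ({p | ε < l p ∧ l p ≤ δ}.indicator (u x)) (N w)‖ₑ ^ 2 ∂m ≤ η := by
  have hVm := measurable_eLpNorm_two (m := m) hu
  have hV2 : ∫⁻ p, eLpNorm (fun x => u x p) 2 m ^ 2 ∂ν < ∞ := by
    rwa [lintegral_eLpNorm_two_sq hu]
  have hle : ∀ δ, MeasurableSet {p | l p ≤ δ} := fun δ => measurableSet_le hl measurable_const
  have key : ∀ η : ℝ≥0∞, 0 < η → η ≠ ∞ → ∀ δ₀ : ℝ, 0 < δ₀ →
      ∀ᵐ w ∂P, ∃ δ, 0 < δ ∧ δ ≤ δ₀ ∧ ∀ ε > 0,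
      ∫⁻ x, ‖compInt ν ({p | ε < l p ∧ l p ≤ δ}.indicator (u x)) (N w)‖ₑ ^ 2 ∂m ≤ η := by
    intro η hη hη' δ₀ hδ₀
    rw [ae_iff]
    -- The exceptional event does not depend on κ. For each κ the maximal inequality is applied to
    -- `u` cut off at a level δ below which its second moment is at most κ; letting κ → 0 shows that
    -- the event is null.
    have hb : ∀ κ : ℝ≥0∞, 0 < κ → κ < ∞ → η * P {w | ¬ ∃ δ, 0 < δ ∧ δ ≤ δ₀ ∧ ∀ ε > 0,
        ∫⁻ x, ‖compInt ν ({p | ε < l p ∧ l p ≤ δ}.indicator (u x)) (N w)‖ₑ ^ 2 ∂m ≤ η} ≤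
        4 * κ := by
      intro κ hκ hκ'
      obtain ⟨δ, hδ, hδle, hδκ⟩ := exists_setLIntegral_le_of_measure_eq_zero hl
        hδ₀ ((setLIntegral_le_lintegral _ _).trans_lt hV2) hl0 hκ
      have hum := measurable_uncurry_indicator (hle δ) hu
      have hu2 : ∫⁻ x, ∫⁻ p, ‖{p | l p ≤ δ}.indicator (u x) p‖ₑ ^ 2 ∂ν ∂m ≤ κ := by
        refine le_trans (le_of_eq ?_) hδκ
        rw [← lintegral_eLpNorm_two_sq hum, ← lintegral_indicator (hle δ)]
        refine lintegral_congr fun p => ?_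
        by_cases hp : l p ≤ δ <;> simp [Set.indicator, hp]
      have h := hN.mul_measure_exists_pos_le hl hlν hum
        (hu2.trans_lt hκ') η
      refine le_trans ?_ (h.trans (by gcongr))
      refine mul_le_mul_right (measure_mono fun w hw => ?_) η
      have hw' : ¬ ∃ δ, 0 < δ ∧ δ ≤ δ₀ ∧ ∀ ε > 0,
        ∫⁻ x, ‖compInt ν ({p | ε < l p ∧ l p ≤ δ}.indicator (u x)) (N w)‖ₑ ^ 2 ∂m ≤ η := hw
      by_contra hno
      refine hw' ⟨δ, hδ, hδle, fun ε hε => not_lt.1 fun hlt => hno ⟨ε, hε, ?_⟩⟩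
      simp only [Set.indicator_indicator]
      exact hlt
    have h0 : η * P {w | ¬ ∃ δ, 0 < δ ∧ δ ≤ δ₀ ∧ ∀ ε > 0,
        ∫⁻ x, ‖compInt ν ({p | ε < l p ∧ l p ≤ δ}.indicator (u x)) (N w)‖ₑ ^ 2 ∂m ≤ η} ≤ 0 := by
      refine ENNReal.le_of_forall_pos_le_add fun ε hε _ => ?_
      rw [zero_add]
      refine (hb (ε / 4) (by simp [hε.ne']) (by simp [ENNReal.div_lt_top])).trans (le_of_eq ?_)
      exact ENNReal.mul_div_cancel (by norm_num) (by norm_num)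
    exact (mul_eq_zero.1 (nonpos_iff_eq_zero.1 h0)).resolve_left hη.ne'
  -- Countably many pairs (η, δ₀) suffice, as the conclusion is monotone in both.
  have hall : ∀ᵐ w ∂P, ∀ k j : ℕ, ∃ δ, 0 < δ ∧ δ ≤ 1 / (j + 1 : ℝ) ∧ ∀ ε > 0,
      ∫⁻ x, ‖compInt ν ({p | ε < l p ∧ l p ≤ δ}.indicator (u x)) (N w)‖ₑ ^ 2 ∂m ≤
        ((k : ℝ≥0∞) + 1)⁻¹ :=
    ae_all_iff.2 fun k => ae_all_iff.2 fun j =>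
      key _ (by simp) (by simp) _ (by positivity)
  filter_upwards [hall] with w hw η hη δ₀ hδ₀
  obtain ⟨k, hk⟩ := ENNReal.exists_inv_nat_lt hη.ne'
  obtain ⟨j, hj⟩ := exists_nat_one_div_lt hδ₀
  obtain ⟨δ, h1, h2, h3⟩ := hw k j
  refine ⟨δ, h1, h2.trans hj.le, fun ε hε => (h3 ε hε).trans (le_trans ?_ hk.le)⟩
  exact ENNReal.inv_le_inv.2 (by simp)

end IsPoissonRandomMeasure
end Small

/-! ### Truncated Lévy fields in `L²` -/

section Field

variable {Θ W : Type*} [MeasurableSpace Θ] [MeasurableSpace W] {d : ℕ}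
  {νβ : Measure ℝ} {π : Measure Θ} {h : ℝ → ℝ} {φ : Rd d → Θ → ℝ} {m : Measure (Rd d)}
  {μ ν : Measure (ℝ × Θ)} {V : Θ → ℝ≥0∞}

/-- The integrability properties of the jump intensity and the compensator that control the jumps
of either size. -/
structure AdmissibleCompensator (νβ : Measure ℝ) (h : ℝ → ℝ) : Prop where
  measurable : Measurable h
  sq : ∫⁻ β, ‖h β‖ₑ ^ 2 ∂νβ < ∞
  residual : ∫⁻ β in {β | |β| ≤ 1}, ‖β - h β‖ₑ ∂νβ < ∞
  fin : ∀ ε > 0, νβ {β | ε < |β|} ≠ ∞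
  zero : νβ {0} = 0

/-- A realization of the jumps for which the sums weighted by `V` converge. -/
structure GoodJumps (μ : Measure (ℝ × Θ)) (h : ℝ → ℝ) (V : Θ → ℝ≥0∞) : Prop where
  fin : ∀ ε > 0, μ (bigJumps Θ ε) < ∞
  zero : μ {p | |p.1| ≤ 0} = 0
  big : ∀ ε > 0, ∫⁻ p in bigJumps Θ ε, ‖p.1 - h p.1‖ₑ * V p.2 ∂μ < ∞
  big_compensator : ∀ ε > 0, ∫⁻ p in bigJumps Θ ε, ‖h p.1‖ₑ * V p.2 ∂μ < ∞
  small : ∫⁻ p in {p | |p.1| ≤ 1}, ‖p.1 - h p.1‖ₑ * V p.2 ∂μ < ∞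

theorem measurable_abs_fst : Measurable fun p : ℝ × Θ => |p.1| :=
  continuous_abs.measurable.comp measurable_fst

theorem measurableSet_bigJumps (ε : ℝ) : MeasurableSet (bigJumps Θ ε) :=
  measurableSet_lt measurable_const measurable_abs_fst

namespace AdmissibleCompensator

variable (H : AdmissibleCompensator νβ h)
include H

theorem prod_bigJumps_ne_top [IsProbabilityMeasure π] {ε : ℝ} (hε : 0 < ε) :
    (νβ.prod π) (bigJumps Θ ε) ≠ ∞ := by
  have h1 : bigJumps Θ ε = {β | ε < |β|} ×ˢ Set.univ := by
    ext p
    simp [bigJumps]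
  rw [h1, Measure.prod_prod, measure_univ, mul_one]
  exact H.fin ε hε

theorem prod_zero [IsProbabilityMeasure π] : (νβ.prod π) {p | |p.1| ≤ 0} = 0 := by
  have h1 : {p : ℝ × Θ | |p.1| ≤ 0} = {0} ×ˢ Set.univ := by
    ext p
    simp
  rw [h1, Measure.prod_prod, H.zero, zero_mul]

theorem lintegral_prod_sq [SFinite νβ] [SFinite π] (hV : Measurable V) :
    ∫⁻ p, (‖h p.1‖ₑ * V p.2) ^ 2 ∂(νβ.prod π) = (∫⁻ β, ‖h β‖ₑ ^ 2 ∂νβ) * ∫⁻ ω, V ω ^ 2 ∂π := by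
  simp only [mul_pow]
  exact lintegral_prod_mul (H.measurable.enorm.pow_const 2).aemeasurable
    (hV.pow_const 2).aemeasurable

theorem lintegral_prod_sq_lt_top [SFinite νβ] [SFinite π] (hV : Measurable V)
    (hV2 : ∫⁻ ω, V ω ^ 2 ∂π < ∞) : ∫⁻ p, (‖h p.1‖ₑ * V p.2) ^ 2 ∂(νβ.prod π) < ∞ := by
  rw [H.lintegral_prod_sq hV]
  exact ENNReal.mul_lt_top H.sq hV2

theorem setLIntegral_bigJumps_lt_top [SFinite νβ] [IsProbabilityMeasure π] (hV : Measurable V)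
    (hV2 : ∫⁻ ω, V ω ^ 2 ∂π < ∞) {ε : ℝ} (hε : 0 < ε) :
    ∫⁻ p in bigJumps Θ ε, ‖h p.1‖ₑ * V p.2 ∂(νβ.prod π) < ∞ :=
  setLIntegral_lt_top_of_lintegral_sq
    (((H.measurable.comp measurable_fst).enorm).mul (hV.comp measurable_snd))
    (H.lintegral_prod_sq_lt_top hV hV2) (H.prod_bigJumps_ne_top hε)

/-- Large jumps are almost surely finite in number, so any finite weight is summable over them. The
residual sum over small jumps has finite mean, a product of the `residual` integral with ∫ V dπ; the
latter is finite since V is square integrable for a probability measure. -/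
theorem ae_goodJumps [SigmaFinite νβ] [IsProbabilityMeasure π] {N : W → Measure (ℝ × Θ)}
    {P : Measure W} [IsProbabilityMeasure P] (hN : IsPoissonRandomMeasure N (νβ.prod π) P)
    (hV : Measurable V) (hV2 : ∫⁻ ω, V ω ^ 2 ∂π < ∞) : ∀ᵐ w ∂P, GoodJumps (N w) h V := by
  have hVfin : ∀ᵐ ω ∂π, V ω < ∞ := by
    filter_upwards [ae_lt_top (hV.pow_const 2) hV2.ne] with ω hω
    by_contra hc
    simp [not_lt_top_iff.1 hc] at hω
  have hVfin' : ∀ᵐ p ∂(νβ.prod π), V p.2 < ∞ :=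
    Measure.quasiMeasurePreserving_snd.ae hVfin
  have hm1 : Measurable fun p : ℝ × Θ => ‖p.1 - h p.1‖ₑ * V p.2 :=
    ((measurable_fst.sub (H.measurable.comp measurable_fst)).enorm).mul (hV.comp measurable_snd)
  have hm2 : Measurable fun p : ℝ × Θ => ‖h p.1‖ₑ * V p.2 :=
    ((H.measurable.comp measurable_fst).enorm).mul (hV.comp measurable_snd)
  have hb : ∀ ε > 0, (νβ.prod π) {p | ε < |p.1|} ≠ ∞ := fun ε hε => H.prod_bigJumps_ne_top hε
  have hV1 : ∫⁻ ω, V ω ∂π < ∞ := by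
    have := setLIntegral_lt_top_of_lintegral_sq hV hV2 (B := Set.univ) (by simp)
    simpa using this
  have hs : ∫⁻ p in {p | |p.1| ≤ 1}, ‖p.1 - h p.1‖ₑ * V p.2 ∂(νβ.prod π) < ∞ := by
    have h1 : {p : ℝ × Θ | |p.1| ≤ 1} = {β | |β| ≤ 1} ×ˢ Set.univ := by
      ext p
      simp
    rw [h1, ← Measure.prod_restrict, Measure.restrict_univ,
      lintegral_prod_mul (f := fun β => ‖β - h β‖ₑ)
        (measurable_id.sub H.measurable).enorm.aemeasurable hV.aemeasurable]
    exact ENNReal.mul_lt_top H.residual hV1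
  have hs' : ∫⁻ p, ({p : ℝ × Θ | |p.1| ≤ 1}.indicator fun p => ‖p.1 - h p.1‖ₑ * V p.2) p
      ∂(νβ.prod π) < ∞ := by
    rwa [lintegral_indicator (measurableSet_le measurable_abs_fst measurable_const)]
  have h0 := hN.ae_ae (measure_eq_zero_iff_ae_notMem.1 (H.prod_zero (π := π)))
  filter_upwards [hN.ae_forall_pos_measure_lt_top measurable_abs_fst hb,
    hN.ae_forall_pos_setLIntegral_lt_top measurable_abs_fst hb hm1
      (hVfin'.mono fun p hp => ENNReal.mul_lt_top enorm_lt_top hp),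
    hN.ae_forall_pos_setLIntegral_lt_top measurable_abs_fst hb hm2
      (hVfin'.mono fun p hp => ENNReal.mul_lt_top enorm_lt_top hp), h0,
    hN.ae_lintegral_lt_top (hm1.indicator (measurableSet_le measurable_abs_fst measurable_const))
      hs'] with w h1 h2 h3 h4 h5
  refine ⟨h1, measure_eq_zero_iff_ae_notMem.2 h4, h2, h3, ?_⟩
  rwa [lintegral_indicator (measurableSet_le measurable_abs_fst measurable_const)] at h5

end AdmissibleCompensator

theorem eLpNorm_mul_const' {E : Type*} [MeasurableSpace E] (f : E → ℝ) (c : ℝ) (m : Measure E) :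
    eLpNorm (fun x => f x * c) 2 m = ‖c‖ₑ * eLpNorm f 2 m := by
  rw [← eLpNorm_const_smul]
  congr 1
  funext x
  simp [mul_comm]

theorem measurable_uncurry_mul (hφ : Measurable (Function.uncurry φ)) {g : ℝ → ℝ}
    (hg : Measurable g) :
    Measurable (Function.uncurry fun x (p : ℝ × Θ) => φ x p.2 * g p.1) :=
  (hφ.comp (measurable_fst.prodMk (measurable_snd.comp measurable_snd))).mul
    (hg.comp (measurable_fst.comp measurable_snd))

theorem ae_integrableOn_mul [SFinite m] (hφ : Measurable (Function.uncurry φ)) {g : ℝ → ℝ}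
    (hg : Measurable g) {B : Set (ℝ × Θ)} [SFinite (μ.restrict B)]
    (hfin : ∫⁻ p in B, ‖g p.1‖ₑ * eLpNorm (fun x => φ x p.2) 2 m ∂μ < ∞) :
    ∀ᵐ x ∂m, IntegrableOn (fun p : ℝ × Θ => φ x p.2 * g p.1) B μ := by
  have hm := measurable_uncurry_mul hφ hg
  have := ae_lintegral_enorm_lt_top (m := m) (μ := μ.restrict B) hm
    (by simpa only [eLpNorm_mul_const'] using hfin)
  filter_upwards [this] with x hx
  exact ⟨hm.of_uncurry_left.aestronglyMeasurable, hx⟩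

theorem GoodJumps.isFiniteMeasure (hμ : GoodJumps μ h V) {ε : ℝ} (hε : 0 < ε) :
    IsFiniteMeasure (μ.restrict (bigJumps Θ ε)) :=
  ⟨by simpa using hμ.fin ε hε⟩

theorem GoodJumps.mono {V' : Θ → ℝ≥0∞} (hμ : GoodJumps μ h V) (hV : ∀ ω, V' ω ≤ V ω) :
    GoodJumps μ h V' where
  fin := hμ.fin
  zero := hμ.zero
  big ε hε := (lintegral_mono fun p => by gcongr; exact hV _).trans_lt (hμ.big ε hε)
  big_compensator ε hε :=
    (lintegral_mono fun p => by gcongr; exact hV _).trans_lt (hμ.big_compensator ε hε)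
  small := (lintegral_mono fun p => by gcongr; exact hV _).trans_lt hμ.small

theorem GoodJumps.ae_truncConverges [SFinite m] [SFinite ν] (hφ : Measurable (Function.uncurry φ))
    (hh : Measurable h) (hμ : GoodJumps μ h fun ω => eLpNorm (fun x => φ x ω) 2 m) {ε : ℝ}
    (hε : 0 < ε)
    (hν : ∫⁻ p in bigJumps Θ ε, ‖h p.1‖ₑ * eLpNorm (fun x => φ x p.2) 2 m ∂ν < ∞) :
    ∀ᵐ x ∂m, TruncConverges μ ν h φ ε x := by
  have := hμ.isFiniteMeasure hε
  filter_upwards [ae_integrableOn_mul (g := fun β => β - h β) hφ (measurable_id.sub hh)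
    (hμ.big ε hε), ae_integrableOn_mul hφ hh (hμ.big_compensator ε hε),
    ae_integrableOn_mul hφ hh hν] with x h1 h2 h3
  exact ⟨h1, h2, h3⟩

/-- The jumps with sizes in `(ε, δ]`. -/
def midJumps (Θ : Type*) (ε δ : ℝ) : Set (ℝ × Θ) := {p | ε < |p.1| ∧ |p.1| ≤ δ}

theorem measurableSet_midJumps (ε δ : ℝ) : MeasurableSet (midJumps Θ ε δ) :=
  (measurableSet_lt measurable_const measurable_abs_fst).inter
    (measurableSet_le measurable_abs_fst measurable_const)

theorem setIntegral_bigJumps_sub {v : ℝ × Θ → ℝ} {ε δ : ℝ} (hεδ : ε ≤ δ)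
    (hv : IntegrableOn v (bigJumps Θ ε) μ) :
    ∫ p in bigJumps Θ ε, v p ∂μ - ∫ p in bigJumps Θ δ, v p ∂μ =
      ∫ p in midJumps Θ ε δ, v p ∂μ := by
  have hU : bigJumps Θ ε = midJumps Θ ε δ ∪ bigJumps Θ δ := by
    ext p
    change ε < |p.1| ↔ (ε < |p.1| ∧ |p.1| ≤ δ) ∨ δ < |p.1|
    constructor
    · intro hp
      rcases le_or_gt |p.1| δ with h1 | h1
      exacts [Or.inl ⟨hp, h1⟩, Or.inr h1]
    · rintro (hp | hp)
      exacts [hp.1, hεδ.trans_lt hp]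
  have hd : Disjoint (midJumps Θ ε δ) (bigJumps Θ δ) :=
    Set.disjoint_left.2 fun p hp hp' => absurd hp.2 (not_le.2 hp')
  rw [hU] at hv ⊢
  rw [setIntegral_union hd (measurableSet_bigJumps δ) hv.left_of_union hv.right_of_union]
  ring

theorem truncField_sub {ε δ : ℝ} (hεδ : ε ≤ δ) {x : Rd d} (hx : TruncConverges μ ν h φ ε x) :
    truncField μ ν h φ ε x - truncField μ ν h φ δ x =
      ∫ p in midJumps Θ ε δ, φ x p.2 * (p.1 - h p.1) ∂μ +
        compInt ν ((midJumps Θ ε δ).indicator fun p => φ x p.2 * h p.1) μ := by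
  rw [compInt, integral_indicator (measurableSet_midJumps ε δ),
    integral_indicator (measurableSet_midJumps ε δ),
    ← setIntegral_bigJumps_sub hεδ hx.1, ← setIntegral_bigJumps_sub hεδ hx.2.1,
    ← setIntegral_bigJumps_sub hεδ hx.2.2, truncField, truncField]
  ring

theorem measurable_setIntegral_mul {B : Set (ℝ × Θ)} [SFinite (μ.restrict B)]
    (hφ : Measurable (Function.uncurry φ)) {g : ℝ → ℝ} (hg : Measurable g) :
    Measurable fun x => ∫ p in B, φ x p.2 * g p.1 ∂μ :=
  (StronglyMeasurable.integral_prod_right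
    (measurable_uncurry_mul hφ hg).stronglyMeasurable).measurable

theorem GoodJumps.measurable_truncField [SFinite ν] (hφ : Measurable (Function.uncurry φ))
    (hh : Measurable h) (hμ : GoodJumps μ h V) {ε : ℝ} (hε : 0 < ε) :
    Measurable (truncField μ ν h φ ε) := by
  have := hμ.isFiniteMeasure hε
  exact (measurable_setIntegral_mul (g := fun β => β - h β) hφ (measurable_id.sub hh)).add
    ((measurable_setIntegral_mul hφ hh).sub (measurable_setIntegral_mul hφ hh))

/-- The almost sure Cauchy property behind all convergence statements: residual jumps are handled
pathwise by Minkowski's inequality, compensated ones by the maximal inequality, which covers every ε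
≤ δ on a single event. -/
theorem AdmissibleCompensator.ae_forall_exists_eLpNorm_truncField_sub_le
    (H : AdmissibleCompensator νβ h) [SigmaFinite νβ] [IsProbabilityMeasure π] [SFinite m]
    {N : W → Measure (ℝ × Θ)} {P : Measure W} [IsProbabilityMeasure P]
    (hN : IsPoissonRandomMeasure N (νβ.prod π) P) (hφ : Measurable (Function.uncurry φ))
    (h2 : ∫⁻ ω, eLpNorm (fun x => φ x ω) 2 m ^ 2 ∂π < ∞) :
    ∀ᵐ w ∂P, ∀ η > 0, ∃ δ > 0, ∀ ε, 0 < ε → ε ≤ δ →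
      eLpNorm (fun x => truncField (N w) (νβ.prod π) h φ ε x -
        truncField (N w) (νβ.prod π) h φ δ x) 2 m ≤ η := by
  have hV := measurable_eLpNorm_two (m := m) hφ
  have hu := measurable_uncurry_mul hφ H.measurable
  have hu2 : ∫⁻ x, ∫⁻ p, ‖φ x p.2 * h p.1‖ₑ ^ 2 ∂(νβ.prod π) ∂m < ∞ := by
    rw [← lintegral_eLpNorm_two_sq hu]
    simp only [eLpNorm_mul_const']
    exact H.lintegral_prod_sq_lt_top hV h2
  have hb : ∀ ε > 0, (νβ.prod π) {p | ε < |p.1|} ≠ ∞ := fun ε hε => H.prod_bigJumps_ne_top hε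
  have hres : Measurable fun β => β - h β := measurable_id.sub H.measurable
  filter_upwards [H.ae_goodJumps hN hV h2, hN.ae_exists_lintegral_compInt_le measurable_abs_fst hb
    H.prod_zero hu hu2] with w hw hc η hη
  obtain ⟨δ₁, hδ₁, -, hle⟩ := exists_setLIntegral_le_of_measure_eq_zero measurable_abs_fst
    one_pos hw.small hw.zero (ENNReal.half_pos hη.ne')
  -- The compensated bound holds only at the δ that is returned, not at all smaller ones. The
  -- residual level δ₁ is therefore fixed first; its bound persists at any δ ≤ δ₁.
  obtain ⟨δ, hδ, hδle, hcomp⟩ := hc ((η / 2) ^ 2)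
    (pos_iff_ne_zero.2 (pow_ne_zero 2 (ENNReal.half_pos hη.ne').ne')) δ₁ hδ₁
  refine ⟨δ, hδ, fun ε hε hεδ => ?_⟩
  have hfin : IsFiniteMeasure ((N w).restrict (midJumps Θ ε δ)) :=
    ⟨by
      rw [Measure.restrict_apply_univ]
      exact (measure_mono fun p hp => hp.1).trans_lt (hw.fin ε hε)⟩
  have hm1 : Measurable fun x => ∫ p in midJumps Θ ε δ, φ x p.2 * (p.1 - h p.1) ∂(N w) :=
    measurable_setIntegral_mul hφ hres
  have hm2 : Measurable fun x => compInt (νβ.prod π)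
      ((midJumps Θ ε δ).indicator fun p => φ x p.2 * h p.1) (N w) := by
    simp only [compInt, integral_indicator (measurableSet_midJumps ε δ)]
    exact (measurable_setIntegral_mul hφ H.measurable).sub
      (measurable_setIntegral_mul hφ H.measurable)
  have hae : (fun x => truncField (N w) (νβ.prod π) h φ ε x -
      truncField (N w) (νβ.prod π) h φ δ x) =ᵐ[m]
      (fun x => ∫ p in midJumps Θ ε δ, φ x p.2 * (p.1 - h p.1) ∂(N w)) +
        fun x => compInt (νβ.prod π)
          ((midJumps Θ ε δ).indicator fun p => φ x p.2 * h p.1) (N w) := by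
    filter_upwards [hw.ae_truncConverges hφ H.measurable hε
      (H.setLIntegral_bigJumps_lt_top hV h2 hε)] with x hx
    exact truncField_sub hεδ hx
  rw [eLpNorm_congr_ae hae]
  refine (eLpNorm_add_le hm1.aestronglyMeasurable hm2.aestronglyMeasurable (by norm_num)).trans ?_
  rw [← ENNReal.add_halves η]
  refine add_le_add ?_ ?_
  · refine (eLpNorm_integral_le (measurable_uncurry_mul hφ hres)).trans (le_trans ?_ hle)
    simp only [eLpNorm_mul_const']
    refine lintegral_mono_set fun p hp => ?_
    exact show |p.1| ≤ δ₁ from hp.2.trans hδle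
  · have h3 := hcomp ε hε
    rw [← eLpNorm_two_sq] at h3
    exact (ENNReal.pow_le_pow_left_iff two_ne_zero).1 h3

end Field

/-! ### The full Lévy field and its truncations -/

section Full

variable {Θ W : Type*} [MeasurableSpace Θ] [MeasurableSpace W] {d : ℕ}
  {νβ : Measure ℝ} {π : Measure Θ} {h : ℝ → ℝ} {φ : Rd d → Θ → ℝ} {m : Measure (Rd d)}
  {μ ν : Measure (ℝ × Θ)} {V : Θ → ℝ≥0∞}

/-- Deterministic levels whose mean square tails are at most 4⁻ⁿ. Summability gives almost sure
convergence along this very sequence. -/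
theorem AdmissibleCompensator.exists_seq (H : AdmissibleCompensator νβ h) [SFinite νβ]
    [IsProbabilityMeasure π] (hV : Measurable V) (hV2 : ∫⁻ ω, V ω ^ 2 ∂π < ∞) :
    ∃ e : ℕ → ℝ, (∀ n, 0 < e n) ∧ Tendsto e atTop (𝓝 0) ∧
      ∀ n, ∀ δ ≤ e n, ∫⁻ p in {p | |p.1| ≤ δ}, (‖h p.1‖ₑ * V p.2) ^ 2 ∂(νβ.prod π) ≤
        ((2 : ℝ≥0∞)⁻¹ ^ n) ^ 2 := by
  have hex : ∀ n : ℕ, ∃ δ, 0 < δ ∧ δ ≤ 1 / (n + 1 : ℝ) ∧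
      ∫⁻ p in {p | |p.1| ≤ δ}, (‖h p.1‖ₑ * V p.2) ^ 2 ∂(νβ.prod π) ≤
        ((2 : ℝ≥0∞)⁻¹ ^ n) ^ 2 := fun n =>
    exists_setLIntegral_le_of_measure_eq_zero measurable_abs_fst (by positivity)
      ((setLIntegral_le_lintegral _ _).trans_lt (H.lintegral_prod_sq_lt_top hV hV2)) H.prod_zero
      (pos_iff_ne_zero.2 (by simp))
  choose e he0 he1 he2 using hex
  refine ⟨e, he0, ?_, fun n δ hδ => (lintegral_mono_set fun p hp => ?_).trans (he2 n)⟩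
  · exact tendsto_of_tendsto_of_tendsto_of_le_of_le tendsto_const_nhds
      (tendsto_one_div_add_atTop_nhds_zero_nat (𝕜 := ℝ)) (fun n => (he0 n).le) he1
  · exact show |p.1| ≤ e n from le_trans hp hδ

theorem GoodJumps.ae_integrable [SFinite m] [SFinite μ] (hφ : Measurable (Function.uncurry φ))
    (hh : Measurable h) (hμ : GoodJumps μ h fun ω => eLpNorm (fun x => φ x ω) 2 m) :
    ∀ᵐ x ∂m, Integrable (fun p : ℝ × Θ => φ x p.2 * (p.1 - h p.1)) μ := by
  have hU : {p : ℝ × Θ | |p.1| ≤ 1}ᶜ = bigJumps Θ 1 := by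
    ext p
    exact not_le (a := |p.1|) (b := 1)
  filter_upwards [ae_integrableOn_mul (μ := μ) (g := fun β => β - h β) hφ (measurable_id.sub hh)
    hμ.small, ae_integrableOn_mul (μ := μ) (g := fun β => β - h β) hφ (measurable_id.sub hh)
    (hμ.big 1 one_pos)] with x h1 h2
  rw [← hU] at h2
  rw [← integrableOn_univ, ← Set.union_compl_self {p : ℝ × Θ | |p.1| ≤ 1}]
  exact h1.union h2

theorem GoodJumps.tendsto_setIntegral_bigJumps (hμ : GoodJumps μ h V) {v : ℝ × Θ → ℝ}
    (hv : Integrable v μ) {e : ℕ → ℝ} (he : ∀ n, 0 < e n) (hlim : Tendsto e atTop (𝓝 0)) :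
    Tendsto (fun n => ∫ p in bigJumps Θ (e n), v p ∂μ) atTop (𝓝 (∫ p, v p ∂μ)) := by
  have h1 := tendsto_integral_indicator_lt (μ := μ) measurable_abs_fst
    (hv.integrableOn (s := {p : ℝ × Θ | 0 < |p.1|})) he hlim
  have h2 : ∫ p, ({p : ℝ × Θ | 0 < |p.1|}.indicator v) p ∂μ = ∫ p, v p ∂μ := by
    refine integral_congr_ae ?_
    filter_upwards [measure_eq_zero_iff_ae_notMem.1 hμ.zero] with p hp
    exact Set.indicator_of_mem (show p ∈ {p : ℝ × Θ | 0 < |p.1|} from not_le.1 hp) v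
  rw [h2] at h1
  refine h1.congr fun n => ?_
  exact integral_indicator (measurableSet_bigJumps (e n))

/-- Truncated and untruncated kernels differ by the small jumps. -/
theorem lintegral_lintegral_indicator_sub_sq [SFinite m] [SFinite ν]
    (hφ : Measurable (Function.uncurry φ)) (hh : Measurable h) (ε : ℝ) :
    ∫⁻ x, ∫⁻ p, ‖(bigJumps Θ ε).indicator (fun p => φ x p.2 * h p.1) p - φ x p.2 * h p.1‖ₑ ^ 2
      ∂ν ∂m = ∫⁻ p in {p | |p.1| ≤ ε},
        (‖h p.1‖ₑ * eLpNorm (fun x => φ x p.2) 2 m) ^ 2 ∂ν := by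
  simp only [← eLpNorm_mul_const']
  rw [lintegral_eLpNorm_two_sq (measurable_uncurry_mul hφ hh)]
  refine lintegral_congr fun x => ?_
  rw [← lintegral_indicator (measurableSet_le measurable_abs_fst measurable_const)]
  refine lintegral_congr fun p => ?_
  by_cases hp : |p.1| ≤ ε
  · simp [Set.indicator, bigJumps, hp, not_lt.2 hp]
  · simp [Set.indicator, bigJumps, hp, not_le.1 hp]

theorem AdmissibleCompensator.ae_memLp_two (H : AdmissibleCompensator νβ h) [SFinite νβ]
    [IsProbabilityMeasure π] [SFinite m] (hφ : Measurable (Function.uncurry φ))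
    (h2 : ∫⁻ ω, eLpNorm (fun x => φ x ω) 2 m ^ 2 ∂π < ∞) :
    ∀ᵐ x ∂m, ∫⁻ p, ‖φ x p.2 * h p.1‖ₑ ^ 2 ∂(νβ.prod π) < ∞ := by
  have hu := measurable_uncurry_mul hφ H.measurable
  have hu2 : ∫⁻ x, ∫⁻ p, ‖φ x p.2 * h p.1‖ₑ ^ 2 ∂(νβ.prod π) ∂m < ∞ := by
    rw [← lintegral_eLpNorm_two_sq hu]
    simp only [eLpNorm_mul_const']
    exact H.lintegral_prod_sq_lt_top (measurable_eLpNorm_two hφ) h2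
  exact ae_lt_top (Measurable.lintegral_prod_right (hu.enorm.pow_const 2)) hu2.ne

variable {S : Type*} [MeasurableSpace S] {N : W → Measure S} {ρ : Measure S} {P : Measure W}

/-- By linearity this is the second-moment bound for u − v; the 2 is the square root of the 4 there.
-/
theorem IsPoissonRandomMeasure.eLpNorm_compInt_sub_le (hN : IsPoissonRandomMeasure N ρ P)
    [IsProbabilityMeasure P] {u v : S → ℝ} (hu : Measurable u) (hv : Measurable v)
    (hui : Integrable u ρ) (hvi : Integrable v ρ) :
    eLpNorm (fun w => compInt ρ u (N w) - compInt ρ v (N w)) 2 P ≤ 2 * eLpNorm (u - v) 2 ρ := by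
  have h1 : (fun w => compInt ρ u (N w) - compInt ρ v (N w)) =ᵐ[P]
      fun w => compInt ρ (u - v) (N w) := by
    filter_upwards [hN.ae_integrable hu hui, hN.ae_integrable hv hvi] with w h1 h2
    simp only [compInt]
    rw [integral_sub' h1 h2, integral_sub' hui hvi]
    ring
  rw [eLpNorm_congr_ae h1, ← ENNReal.pow_le_pow_left_iff two_ne_zero, mul_pow, eLpNorm_two_sq,
    eLpNorm_two_sq]
  refine (hN.lintegral_compInt_sq_le (hu.sub hv) (hui.sub hvi)).trans (le_of_eq ?_)
  norm_num

/-- A compensated integral is approximated by the compensated sums over truncations. -/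
theorem IsCompensatedIntegral.eLpNorm_compInt_sub_le {ψ : S → ℝ} {Z : W → ℝ}
    (hZ : IsCompensatedIntegral N ρ P ψ Z) (hN : IsPoissonRandomMeasure N ρ P)
    [IsProbabilityMeasure P] {v : S → ℝ} (hv : Measurable v) (hvi : Integrable v ρ) :
    eLpNorm (fun w => compInt ρ v (N w) - Z w) 2 P ≤ 2 * eLpNorm (v - ψ) 2 ρ := by
  obtain ⟨hψ, hZ2, u, hu, hu1, hu2⟩ := hZ
  have hb : ∀ n, eLpNorm (fun w => compInt ρ v (N w) - Z w) 2 P ≤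
      2 * (eLpNorm (v - ψ) 2 ρ + eLpNorm (u n - ψ) 2 ρ) +
        eLpNorm (fun w => (∫ p, u n p ∂(N w) - ∫ p, u n p ∂ρ) - Z w) 2 P := by
    intro n
    have hvm : Measurable fun w => compInt ρ v (N w) := (measurable_compInt hv).comp hN.measurable
    have hum : Measurable fun w => compInt ρ (u n) (N w) :=
      (measurable_compInt (hu n).1).comp hN.measurable
    have h1 : (fun w => compInt ρ v (N w) - Z w) =
        (fun w => compInt ρ v (N w) - compInt ρ (u n) (N w)) +
          fun w => compInt ρ (u n) (N w) - Z w := by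
      funext w
      simp
    rw [h1]
    refine (eLpNorm_add_le (hvm.sub hum).aestronglyMeasurable
      (hum.aestronglyMeasurable.sub hZ2.1) (by norm_num)).trans ?_
    refine add_le_add ((hN.eLpNorm_compInt_sub_le hv (hu n).1 hvi (hu n).2.1).trans ?_) le_rfl
    gcongr
    have h3 : v - u n = (v - ψ) - (u n - ψ) := by
      funext p
      simp
    rw [h3]
    exact eLpNorm_sub_le (hv.aestronglyMeasurable.sub hψ.1)
      ((hu n).1.aestronglyMeasurable.sub hψ.1) (by norm_num)
  refine ge_of_tendsto' (x := atTop) ?_ hb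
  have h4 := (ENNReal.Tendsto.const_mul (a := 2) ((tendsto_const_nhds (x := eLpNorm (v - ψ) 2 ρ)).add hu1)
    (Or.inr (by norm_num))).add hu2
  simpa using h4

end Full

/-! ### Jointly measurable versions of the field, and pointwise convergence of truncations to them.
-/

section Versions

variable {Θ W : Type*} [MeasurableSpace Θ] [MeasurableSpace W] {d : ℕ}
  {νβ : Measure ℝ} {π : Measure Θ} {h : ℝ → ℝ} {φ : Rd d → Θ → ℝ}
  {N : W → Measure (ℝ × Θ)} {P : Measure W}

theorem measurable_integral_kernel_comp {S : Type*} [MeasurableSpace S] {M : W → Measure S}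
    {E : Type*} [MeasurableSpace E] (hM : Measurable M) (U : Kernel (Measure S) S)
    [IsSFiniteKernel U] {u : E → S → ℝ} (hu : Measurable (Function.uncurry u)) :
    Measurable fun z : E × W => ∫ p, u z.1 p ∂(U (M z.2)) := by
  have h := measurable_compInt_kernel (U := U) (ν := 0) hu
  simp only [compInt, integral_zero_measure, sub_zero] at h
  exact h.comp (measurable_fst.prodMk (hM.comp measurable_snd))

theorem measurable_indicator_mul (hφ : Measurable (Function.uncurry φ)) (hh : Measurable h)
    (ε : ℝ) : Measurable (Function.uncurry fun x =>
      (bigJumps Θ ε).indicator fun p : ℝ × Θ => φ x p.2 * h p.1) :=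
  IsPoissonRandomMeasure.measurable_uncurry_indicator (measurableSet_bigJumps ε)
    (measurable_uncurry_mul hφ hh)

theorem AdmissibleCompensator.integrable_indicator (H : AdmissibleCompensator νβ h)
    [IsProbabilityMeasure π] (hφ : Measurable (Function.uncurry φ)) {x : Rd d}
    (hx : ∫⁻ p, ‖φ x p.2 * h p.1‖ₑ ^ 2 ∂(νβ.prod π) < ∞) {ε : ℝ} (hε : 0 < ε) :
    Integrable ((bigJumps Θ ε).indicator fun p : ℝ × Θ => φ x p.2 * h p.1) (νβ.prod π) :=
  (integrableOn_of_lintegral_sq_lt_top (measurable_uncurry_mul hφ H.measurable).of_uncurry_left hx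
    (H.prod_bigJumps_ne_top hε)).integrable_indicator (measurableSet_bigJumps ε)

theorem tsum_sq_half_pow_lt_top (c : ℝ≥0∞) (hc : c ≠ ∞) :
    ∑' n : ℕ, c * ((2 : ℝ≥0∞)⁻¹ ^ n) ^ 2 < ∞ := by
  rw [ENNReal.tsum_mul_left]
  refine ENNReal.mul_lt_top hc.lt_top ?_
  refine lt_of_le_of_lt (ENNReal.tsum_le_tsum (g := fun n => (2 : ℝ≥0∞)⁻¹ ^ n) fun n => ?_) ?_
  · rw [sq]
    exact mul_le_of_le_one_left' (pow_le_one₀ bot_le (by simp))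
  · rw [ENNReal.tsum_geometric]
    simp

theorem sq_lt_top_iff {a : ℝ≥0∞} : a ^ 2 < ∞ ↔ a < ∞ := by
  simp [ENNReal.pow_lt_top_iff]

theorem ennreal_add_sq_le (a b : ℝ≥0∞) : (a + b) ^ 2 ≤ 2 * (a ^ 2 + b ^ 2) := by
  have h := ENNReal.rpow_add_le_mul_rpow_add_rpow a b (p := 2) (by norm_num)
  norm_num at h
  exact h

theorem tendsto_zero_of_tendsto_sq_zero {a : ℕ → ℝ≥0∞}
    (ha : Tendsto (fun n => a n ^ 2) atTop (𝓝 0)) : Tendsto a atTop (𝓝 0) := by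
  have h := (ENNReal.continuous_rpow_const (y := 1 / 2)).tendsto 0 |>.comp ha
  rw [ENNReal.zero_rpow_of_pos (by norm_num)] at h
  refine h.congr fun n => ?_
  simp only [Function.comp_apply]
  rw [← ENNReal.rpow_natCast, ← ENNReal.rpow_mul]
  norm_num

/-- Along a suitable sequence of levels, the truncated fields converge pointwise to the field. -/
theorem AdmissibleCompensator.ae_exists_tendsto_truncField (H : AdmissibleCompensator νβ h)
    [SigmaFinite νβ] [IsProbabilityMeasure π] [IsProbabilityMeasure P]
    (hN : IsPoissonRandomMeasure N (νβ.prod π) P) (hφ : Measurable (Function.uncurry φ))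
    (h2 : ∫⁻ ω, eLpNorm (fun x => φ x ω) 2 volume ^ 2 ∂π < ∞) {f : Rd d → W → ℝ}
    (hf : IsKernelIntegral N (νβ.prod π) P h φ f) :
    ∀ᵐ w ∂P, ∃ e : ℕ → ℝ, (∀ n, 0 < e n) ∧ Tendsto e atTop (𝓝 0) ∧
      ∀ᵐ x : Rd d, Tendsto (fun n => truncField (N w) (νβ.prod π) h φ (e n) x) atTop
        (𝓝 (f x w)) := by
  obtain ⟨U, hUs, hU⟩ := hN.exists_isSFiniteKernel
  have hV := measurable_eLpNorm_two (m := (volume : Measure (Rd d))) hφ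
  have hres : Measurable fun β => β - h β := measurable_id.sub H.measurable
  obtain ⟨e, he0, helim, heb⟩ := H.exists_seq hV h2
  -- `R` is the residual part and `G n` the compensated sum over jumps larger than `e n`; `U (N w)`
  -- stands for N w to make both jointly measurable.
  let R : Rd d × W → ℝ := fun z => ∫ p, φ z.1 p.2 * (p.1 - h p.1) ∂(U (N z.2))
  have hR : Measurable R := measurable_integral_kernel_comp hN.measurable U
    (measurable_uncurry_mul hφ hres)
  let G : ℕ → Rd d × W → ℝ := fun n z => compInt (νβ.prod π)
    ((bigJumps Θ (e n)).indicator fun p => φ z.1 p.2 * h p.1) (U (N z.2))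
  have hG : ∀ n, Measurable (G n) := fun n =>
    (measurable_compInt_kernel (measurable_indicator_mul hφ H.measurable (e n))).comp
      (measurable_fst.prodMk (hN.measurable.comp measurable_snd))
  let D : ℕ → Rd d → W → ℝ≥0∞ := fun n x w => ‖G n (x, w) - (f x w - R (x, w))‖ₑ ^ 2
  have hD : ∀ n, Measurable (Function.uncurry (D n)) := fun n =>
    ((hG n).sub (hf.1.sub hR)).enorm.pow_const 2
  -- For almost every x, f − R is a version of the compensated integral of φ h, and `G n` is the
  -- compensated sum of its truncation, so the mean square error is that of the omitted small jumps.
  have hbound : ∀ n, ∫⁻ x, ∫⁻ w, D n x w ∂P ≤ 4 * ((2 : ℝ≥0∞)⁻¹ ^ n) ^ 2 := by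
    intro n
    refine le_trans ?_ (mul_le_mul_right (heb n (e n) le_rfl) 4)
    rw [← lintegral_lintegral_indicator_sub_sq hφ H.measurable,
      ← lintegral_const_mul' _ _ (by norm_num)]
    refine lintegral_mono_ae ?_
    filter_upwards [hf.2, H.ae_memLp_two hφ h2] with x ⟨_, Z, hZ, hfZ⟩ hx
    have h3 := hZ.eLpNorm_compInt_sub_le hN
      (measurable_indicator_mul hφ H.measurable (e n)).of_uncurry_left
      (H.integrable_indicator hφ hx (he0 n))
    have h4 : ∫⁻ w, D n x w ∂P = ∫⁻ w, ‖compInt (νβ.prod π)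
        ((bigJumps Θ (e n)).indicator fun p => φ x p.2 * h p.1) (N w) - Z w‖ₑ ^ 2 ∂P := by
      refine lintegral_congr_ae ?_
      filter_upwards [hU, hfZ] with w hw hfw
      simp only [D, G, R]
      rw [hw _ le_rfl, hfw, add_sub_cancel_left]
    rw [h4, ← eLpNorm_two_sq]
    refine (ENNReal.pow_le_pow_left_iff two_ne_zero |>.2 h3).trans (le_of_eq ?_)
    rw [mul_pow, eLpNorm_two_sq]
    norm_num
  have hDsum : Measurable (Function.uncurry fun x w => ∑' n, D n x w) :=
    Measurable.tsum hD
  -- The errors are summable in mean, so D n → 0 for almost every (x, w) without passing to a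
  -- subsequence.
  have hsum : ∫⁻ w, (∫⁻ x, ∑' n, D n x w) ∂P < ∞ := by
    rw [← lintegral_lintegral_swap hDsum.aemeasurable]
    simp only [lintegral_tsum fun n => (hD n).of_uncurry_left.aemeasurable]
    rw [lintegral_tsum fun n => (Measurable.lintegral_prod_right (hD n)).aemeasurable]
    exact (ENNReal.tsum_le_tsum hbound).trans_lt (tsum_sq_half_pow_lt_top 4 (by norm_num))
  have hsum' : ∀ᵐ w ∂P, ∫⁻ x, ∑' n, D n x w < ∞ :=
    ae_lt_top (Measurable.lintegral_prod_left hDsum) hsum.ne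
  filter_upwards [hU, hsum', H.ae_goodJumps hN hV h2] with w hw hs hgood
  refine ⟨e, he0, helim, ?_⟩
  have hsf : SFinite (N w) := by
    rw [← hw _ le_rfl]
    infer_instance
  filter_upwards [ae_lt_top hDsum.of_uncurry_right hs.ne, hgood.ae_integrable hφ H.measurable]
    with x hx hxi
  have hDlim := ENNReal.tendsto_atTop_zero_of_tsum_ne_top hx.ne
  have hGlim : Tendsto (fun n => G n (x, w)) atTop (𝓝 (f x w - R (x, w))) := by
    rw [tendsto_iff_edist_tendsto_0]
    refine tendsto_zero_of_tendsto_sq_zero ?_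
    simpa only [edist_eq_enorm_sub] using hDlim
  have h6 := (hgood.tendsto_setIntegral_bigJumps hxi he0 helim).add hGlim
  have h7 : ∫ p, φ x p.2 * (p.1 - h p.1) ∂(N w) + (f x w - R (x, w)) = f x w := by
    simp only [R]
    rw [hw _ le_rfl]
    ring
  rw [h7] at h6
  refine h6.congr fun n => ?_
  simp only [G, truncField, compInt]
  rw [hw _ le_rfl, integral_indicator (measurableSet_bigJumps _),
    integral_indicator (measurableSet_bigJumps _)]

/-- The Lévy field has a jointly measurable version. -/
theorem AdmissibleCompensator.exists_isKernelIntegral (H : AdmissibleCompensator νβ h)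
    [SigmaFinite νβ] [IsProbabilityMeasure π] [IsProbabilityMeasure P]
    (hN : IsPoissonRandomMeasure N (νβ.prod π) P) (hφ : Measurable (Function.uncurry φ))
    (h2 : ∫⁻ ω, eLpNorm (fun x => φ x ω) 2 volume ^ 2 ∂π < ∞) :
    ∃ f : Rd d → W → ℝ, IsKernelIntegral N (νβ.prod π) P h φ f := by
  obtain ⟨U, hUs, hU⟩ := hN.exists_isSFiniteKernel
  have hV := measurable_eLpNorm_two (m := (volume : Measure (Rd d))) hφ
  have hres : Measurable fun β => β - h β := measurable_id.sub H.measurable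
  have hum := measurable_uncurry_mul hφ hres
  have humh := measurable_uncurry_mul hφ H.measurable
  obtain ⟨e, he0, helim, heb⟩ := H.exists_seq hV h2
  let R : Rd d × W → ℝ := fun z => ∫ p, φ z.1 p.2 * (p.1 - h p.1) ∂(U (N z.2))
  have hR : Measurable R := measurable_integral_kernel_comp hN.measurable U hum
  let T : ℕ → Rd d → ℝ × Θ → ℝ := fun n x =>
    (bigJumps Θ (e n)).indicator fun p => φ x p.2 * h p.1
  have hT : ∀ n, Measurable (Function.uncurry (T n)) := fun n =>
    measurable_indicator_mul hφ H.measurable (e n)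
  let G : ℕ → Rd d × W → ℝ := fun n z => compInt (νβ.prod π) (T n z.1) (U (N z.2))
  have hG : ∀ n, Measurable (G n) := fun n =>
    (measurable_compInt_kernel (hT n)).comp
      (measurable_fst.prodMk (hN.measurable.comp measurable_snd))
  have hTi : ∀ᵐ x : Rd d, ∀ n, Integrable (T n x) (νβ.prod π) := by
    filter_upwards [H.ae_memLp_two hφ h2] with x hx n
    exact H.integrable_indicator hφ hx (he0 n)
  have hGae : ∀ n, ∀ x, (fun w => G n (x, w)) =ᵐ[P] fun w => compInt (νβ.prod π) (T n x) (N w) := by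
    intro n x
    filter_upwards [hU] with w hw
    simp only [G]
    rw [hw _ le_rfl]
  have hprod : ∀ F : Rd d × W → ℝ, AEStronglyMeasurable F ((volume : Measure (Rd d)).prod P) →
      eLpNorm F 2 (volume.prod P) ^ 2 = ∫⁻ x, eLpNorm (fun w => F (x, w)) 2 P ^ 2 := by
    intro F hF
    simp only [eLpNorm_two_sq]
    exact lintegral_prod _ (hF.enorm.pow_const 2)
  have hTb : ∀ n, ∫⁻ x, eLpNorm (T n x - fun p => φ x p.2 * h p.1) 2 (νβ.prod π) ^ 2 ≤
      ((2 : ℝ≥0∞)⁻¹ ^ n) ^ 2 := by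
    intro n
    refine le_trans (le_of_eq ?_) (heb n (e n) le_rfl)
    rw [← lintegral_lintegral_indicator_sub_sq hφ H.measurable]
    simp only [eLpNorm_two_sq]
    rfl
  have hTm : ∀ n, Measurable fun x =>
      eLpNorm (T n x - fun p => φ x p.2 * h p.1) 2 (νβ.prod π) ^ 2 := by
    intro n
    simp only [eLpNorm_two_sq]
    exact Measurable.lintegral_prod_right (f := fun x p => ‖T n x p - φ x p.2 * h p.1‖ₑ ^ 2)
      (((hT n).sub humh).enorm.pow_const 2)
  -- The 8 is 2² · 2, from the constant 2 of the compensated bound and (a + b)² ≤ 2(a² + b²).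
  have hcau : ∀ n k, eLpNorm (G n - G k) 2 ((volume : Measure (Rd d)).prod P) ^ 2 ≤
      8 * (((2 : ℝ≥0∞)⁻¹ ^ n) ^ 2 + ((2 : ℝ≥0∞)⁻¹ ^ k) ^ 2) := by
    intro n k
    rw [hprod _ ((hG n).sub (hG k)).aestronglyMeasurable]
    calc ∫⁻ x, eLpNorm (fun w => (G n - G k) (x, w)) 2 P ^ 2
        ≤ ∫⁻ x, 8 * (eLpNorm (T n x - fun p => φ x p.2 * h p.1) 2 (νβ.prod π) ^ 2 +
            eLpNorm (T k x - fun p => φ x p.2 * h p.1) 2 (νβ.prod π) ^ 2) := by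
          refine lintegral_mono_ae ?_
          filter_upwards [hTi] with x hx
          have hTx : ∀ n, Measurable (T n x) := fun n => (hT n).of_uncurry_left
          have hψx : Measurable fun p : ℝ × Θ => φ x p.2 * h p.1 := humh.of_uncurry_left
          have h3 : (fun w => (G n - G k) (x, w)) =ᵐ[P] fun w =>
              compInt (νβ.prod π) (T n x) (N w) - compInt (νβ.prod π) (T k x) (N w) :=
            (hGae n x).sub (hGae k x)
          have h4 : T n x - T k x = (T n x - fun p => φ x p.2 * h p.1) -
              (T k x - fun p => φ x p.2 * h p.1) := by
            funext p
            simp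
          have h5 := hN.eLpNorm_compInt_sub_le (hTx n) (hTx k) (hx n) (hx k)
          rw [h4] at h5
          have h6 := h5.trans (mul_le_mul_right (eLpNorm_sub_le (p := 2)
            ((hTx n).sub hψx).aestronglyMeasurable ((hTx k).sub hψx).aestronglyMeasurable
            (by norm_num)) 2)
          rw [eLpNorm_congr_ae h3]
          refine (ENNReal.pow_le_pow_left_iff two_ne_zero |>.2 h6).trans ?_
          rw [mul_pow]
          calc (2 : ℝ≥0∞) ^ 2 * _ ^ 2 ≤ 2 ^ 2 * (2 * (_ ^ 2 + _ ^ 2)) :=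
                mul_le_mul_right (ennreal_add_sq_le _ _) _
            _ = _ := by
                rw [← mul_assoc]
                norm_num
      _ = 8 * ((∫⁻ x, eLpNorm (T n x - fun p => φ x p.2 * h p.1) 2 (νβ.prod π) ^ 2) +
            ∫⁻ x, eLpNorm (T k x - fun p => φ x p.2 * h p.1) 2 (νβ.prod π) ^ 2) := by
          rw [lintegral_const_mul' _ _ (by norm_num), lintegral_add_left (hTm n)]
      _ ≤ _ := by
          gcongr
          exacts [hTb n, hTb k]
  have hGmem : ∀ n, MemLp (G n) 2 ((volume : Measure (Rd d)).prod P) := by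
    intro n
    refine ⟨(hG n).aestronglyMeasurable, ?_⟩
    rw [← sq_lt_top_iff, hprod _ (hG n).aestronglyMeasurable]
    have h3 : ∀ᵐ x : Rd d, eLpNorm (fun w => G n (x, w)) 2 P ^ 2 ≤
        4 * ∫⁻ p, ‖φ x p.2 * h p.1‖ₑ ^ 2 ∂(νβ.prod π) := by
      filter_upwards [hTi] with x hx
      rw [eLpNorm_congr_ae (hGae n x), eLpNorm_two_sq]
      refine (hN.lintegral_compInt_sq_le (hT n).of_uncurry_left (hx n)).trans ?_
      gcongr with p
      exact enorm_indicator_le_enorm_self _ _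
    refine (lintegral_mono_ae h3).trans_lt ?_
    rw [lintegral_const_mul' _ _ (by norm_num), ← lintegral_eLpNorm_two_sq humh]
    simp only [eLpNorm_mul_const']
    exact ENNReal.mul_lt_top (by norm_num) (H.lintegral_prod_sq_lt_top hV h2)
  -- The previous bound gives 4 · 2⁻ᴹ; the completeness criterion wants a strict inequality, hence
  -- the 5.
  obtain ⟨g₀, hg₀, hg₀lim⟩ := MeasureTheory.Lp.cauchy_complete_eLpNorm (p := 2) (by norm_num) hGmem
    (B := fun n => 5 * (2 : ℝ≥0∞)⁻¹ ^ n)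
    (by rw [ENNReal.tsum_mul_left, ENNReal.tsum_geometric]; norm_num [ENNReal.mul_eq_top])
    (by
      intro M n k hn hk
      have hpow : ∀ n, M ≤ n → (2 : ℝ≥0∞)⁻¹ ^ n ≤ (2 : ℝ≥0∞)⁻¹ ^ M := fun n hn =>
        pow_le_pow_of_le_one bot_le (by simp) hn
      have h3 : eLpNorm (G n - G k) 2 ((volume : Measure (Rd d)).prod P) ≤
          4 * (2 : ℝ≥0∞)⁻¹ ^ M := by
        rw [← ENNReal.pow_le_pow_left_iff two_ne_zero]
        calc _ ≤ 8 * (((2 : ℝ≥0∞)⁻¹ ^ n) ^ 2 + ((2 : ℝ≥0∞)⁻¹ ^ k) ^ 2) := hcau n k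
          _ ≤ 8 * (((2 : ℝ≥0∞)⁻¹ ^ M) ^ 2 + ((2 : ℝ≥0∞)⁻¹ ^ M) ^ 2) := by
              gcongr 8 * (?_ ^ 2 + ?_ ^ 2)
              exacts [hpow n hn, hpow k hk]
          _ = (4 * (2 : ℝ≥0∞)⁻¹ ^ M) ^ 2 := by ring
      refine h3.trans_lt ?_
      refine ENNReal.mul_lt_mul_left (by simp) (by simp) (by norm_num))
  obtain ⟨g, hgm, hgae⟩ := hg₀.1
  have hglim : Tendsto (fun n => eLpNorm (G n - g) 2 ((volume : Measure (Rd d)).prod P)) atTop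
      (𝓝 0) := by
    refine hg₀lim.congr fun n => eLpNorm_congr_ae ?_
    filter_upwards [hgae] with z hz
    simp [hz]
  -- Geometric rates make the squared errors summable over x, so that for almost every x the slices
  -- converge in L²(P), as the definition of a compensated integral requires.
  have hsub : ∀ k : ℕ, ∃ n ≥ k, eLpNorm (G n - g) 2 ((volume : Measure (Rd d)).prod P) ≤
      (2 : ℝ≥0∞)⁻¹ ^ k := fun k => by
    have h3 := (hglim.eventually_le_const (u := (2 : ℝ≥0∞)⁻¹ ^ k)
      (pos_iff_ne_zero.2 (by simp))).and (eventually_ge_atTop k)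
    obtain ⟨n, h4, h5⟩ := h3.exists
    exact ⟨n, h5, h4⟩
  choose n hnk hnb using hsub
  have hgmm : Measurable g := hgm.measurable
  have hsq : ∀ F : Rd d × W → ℝ, Measurable F →
      Measurable fun x => eLpNorm (fun w => F (x, w)) 2 P ^ 2 := by
    intro F hF
    simp only [eLpNorm_two_sq]
    exact Measurable.lintegral_prod_right' (hF.enorm.pow_const 2)
  have hZlim : ∀ᵐ x : Rd d,
      Tendsto (fun k => eLpNorm (fun w => (G (n k) - g) (x, w)) 2 P) atTop (𝓝 0) := by
    have h3 : ∫⁻ x, ∑' k, eLpNorm (fun w => (G (n k) - g) (x, w)) 2 P ^ 2 ≠ ∞ := by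
      rw [lintegral_tsum fun k => (hsq _ ((hG (n k)).sub hgmm)).aemeasurable]
      refine ((ENNReal.tsum_le_tsum fun k => ?_).trans_lt
        (tsum_sq_half_pow_lt_top 1 (by norm_num))).ne
      rw [← hprod _ ((hG (n k)).sub hgmm).aestronglyMeasurable, one_mul]
      exact ENNReal.pow_le_pow_left_iff two_ne_zero |>.2 (hnb k)
    filter_upwards [ae_lt_top (Measurable.tsum fun k => hsq _ ((hG (n k)).sub hgmm)) h3] with x hx
    exact tendsto_zero_of_tendsto_sq_zero (ENNReal.tendsto_atTop_zero_of_tsum_ne_top hx.ne)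
  have hTlim : ∀ᵐ x : Rd d, Tendsto (fun k => eLpNorm
      (T (n k) x - fun p => φ x p.2 * h p.1) 2 (νβ.prod π)) atTop (𝓝 0) := by
    have h3 : ∫⁻ x, ∑' k, eLpNorm (T (n k) x - fun p => φ x p.2 * h p.1) 2 (νβ.prod π) ^ 2 ≠ ∞ := by
      rw [lintegral_tsum fun k => (hTm (n k)).aemeasurable]
      refine ((ENNReal.tsum_le_tsum fun k => ?_).trans_lt
        (tsum_sq_half_pow_lt_top 1 (by norm_num))).ne
      rw [one_mul]
      refine (hTb (n k)).trans (ENNReal.pow_le_pow_left_iff two_ne_zero |>.2 ?_)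
      exact pow_le_pow_of_le_one bot_le (by simp) (hnk k)
    filter_upwards [ae_lt_top (Measurable.tsum fun k => hTm (n k)) h3] with x hx
    exact tendsto_zero_of_tendsto_sq_zero (ENNReal.tendsto_atTop_zero_of_tsum_ne_top hx.ne)
  have hgmem : ∀ᵐ x : Rd d, eLpNorm (fun w => g (x, w)) 2 P ^ 2 < ∞ := by
    refine ae_lt_top (hsq g hgmm) ?_
    rw [← hprod g hgmm.aestronglyMeasurable, ← eLpNorm_congr_ae hgae]
    exact ENNReal.pow_ne_top hg₀.2.ne
  -- Integrability is known for almost every w and then almost every x. Exchanging the quantifiers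
  -- needs a jointly measurable condition, which `U` supplies.
  have hint : ∀ᵐ x : Rd d, ∀ᵐ w ∂P,
      Integrable (fun p : ℝ × Θ => φ x p.2 * (p.1 - h p.1)) (U (N w)) := by
    have hset := measurableSet_kernel_integrable
      (κ := U.comap (fun z : Rd d × W => N z.2) (hN.measurable.comp measurable_snd))
      (f := fun z p => φ z.1 p.2 * (p.1 - h p.1))
      (hum.comp ((measurable_fst.comp measurable_fst).prodMk measurable_snd)).stronglyMeasurable
    simp only [Kernel.comap_apply] at hset
    refine (Measure.ae_ae_comm hset).2 ?_
    filter_upwards [hU, H.ae_goodJumps hN hV h2] with w hw hgood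
    have hsf : SFinite (N w) := by
      rw [← hw _ le_rfl]
      infer_instance
    rw [hw _ le_rfl]
    exact hgood.ae_integrable hφ H.measurable
  refine ⟨fun x w => R (x, w) + g (x, w), hR.add hgmm, ?_⟩
  filter_upwards [hZlim, hTlim, hgmem, hint, hTi, H.ae_memLp_two hφ h2]
    with x hx1 hx2 hx3 hx4 hx5 hx6
  have hψm : Measurable fun p : ℝ × Θ => φ x p.2 * h p.1 := humh.of_uncurry_left
  refine ⟨?_, fun w => g (x, w), ⟨⟨hψm.aestronglyMeasurable, ?_⟩,
    ⟨(hgmm.comp measurable_prodMk_left).aestronglyMeasurable, ?_⟩, fun k => T (n k) x,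
    fun k => ⟨(hT (n k)).of_uncurry_left, hx5 _, (hT (n k)).of_uncurry_left.aestronglyMeasurable,
      ?_⟩, hx2, ?_⟩, ?_⟩
  · filter_upwards [hU, hx4] with w hw hw2
    rwa [hw _ le_rfl] at hw2
  · rw [← sq_lt_top_iff, eLpNorm_two_sq]
    exact hx6
  · exact (sq_lt_top_iff).1 hx3
  · rw [← sq_lt_top_iff, eLpNorm_two_sq]
    refine lt_of_le_of_lt (lintegral_mono fun p => ?_) hx6
    gcongr
    exact enorm_indicator_le_enorm_self _ _
  · refine hx1.congr fun k => eLpNorm_congr_ae ?_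
    filter_upwards [hGae (n k) x] with w hw
    rw [Pi.sub_apply, hw]
    rfl
  · filter_upwards [hU] with w hw
    simp only [R]
    rw [hw _ le_rfl]

end Versions

/-! ### Fourier transforms of square integrable functions by duality -/

section FourierPair

open scoped SchwartzMap

variable {d : ℕ}

/-- `F` is the Fourier transform of `f` in the sense of tempered distributions. -/
def IsFourierPair (f F : Rd d → ℂ) : Prop :=
  ∀ θ : 𝓢(Rd d, ℂ), ∫ x, 𝓕 θ x * f x = ∫ ξ, θ ξ * F ξ

theorem isFourierPair_fourier (f : Lp (α := Rd d) ℂ 2 volume) :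
    IsFourierPair f (𝓕 f : Lp (α := Rd d) ℂ 2 volume) := by
  intro θ
  have h1 := congrArg (fun T => T θ) (Lp.fourier_toTemperedDistribution_eq f)
  simpa [Lp.toTemperedDistribution_apply, TemperedDistribution.fourier_apply] using h1

/-- An L² function is determined by its pairings with Schwartz functions, so the dual
characterization recovers the L² transform. -/
theorem IsFourierPair.ae_eq {f F : Rd d → ℂ} (h : IsFourierPair f F) (hf : MemLp f 2 volume)
    (hF : MemLp F 2 volume) : (𝓕 hf.toLp : Lp (α := Rd d) ℂ 2 volume) =ᵐ[volume] F := by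
  have h1 : 𝓕 hf.toLp = hF.toLp := by
    have h2 : (Lp.toTemperedDistributionCLM ℂ volume 2) (𝓕 hf.toLp)
        = (Lp.toTemperedDistributionCLM ℂ volume 2) hF.toLp := by
      ext θ
      have h3 := isFourierPair_fourier hf.toLp θ
      have h4 : ∫ x, 𝓕 θ x * (hf.toLp : Rd d → ℂ) x = ∫ x, 𝓕 θ x * f x := by
        refine integral_congr_ae ?_
        filter_upwards [hf.coeFn_toLp] with x hx
        rw [hx]
      have h5 : ∫ x, θ x * (hF.toLp : Rd d → ℂ) x = ∫ x, θ x * F x := by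
        refine integral_congr_ae ?_
        filter_upwards [hF.coeFn_toLp] with x hx
        rw [hx]
      simp only [Lp.toTemperedDistributionCLM_apply, Lp.toTemperedDistribution_apply, smul_eq_mul]
      rw [← h3, h4, h5, h θ]
    exact LinearMap.ker_eq_bot.1 (Lp.ker_toTemperedDistributionCLM_eq_bot) h2
  rw [h1]
  exact hF.coeFn_toLp

end FourierPair

/-! ### Affine changes of variables -/

section Scale

variable {d : ℕ}

/-- The invertible linear map defined by a positive definite matrix. -/
def scaleEquiv (A : PosDefMatrix d) : Rd d ≃L[ℝ] Rd d :=
  (LinearEquiv.ofLinearMap (Matrix.toEuclideanLin A.1) (Matrix.toEuclideanLin A.1⁻¹)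
    (by
      have : IsUnit A.1.det := A.2.isUnit.map Matrix.detMonoidHom
      ext x : 1
      simp [Matrix.toLpLin_apply, Matrix.mul_nonsing_inv _ this])
    (by
      have : IsUnit A.1.det := A.2.isUnit.map Matrix.detMonoidHom
      ext x : 1
      simp [Matrix.toLpLin_apply, Matrix.nonsing_inv_mul _ this])).toContinuousLinearEquiv

theorem scaleEquiv_apply (A : PosDefMatrix d) (x : Rd d) :
    scaleEquiv A x = Matrix.toEuclideanLin A.1 x := rfl

theorem det_pos (A : PosDefMatrix d) : 0 < A.1.det := A.2.det_pos

theorem map_scaleEquiv (A : PosDefMatrix d) :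
    Measure.map (scaleEquiv A) volume = ENNReal.ofReal (A.1.det)⁻¹ • (volume : Measure (Rd d)) := by
  have h1 : LinearMap.det (Matrix.toEuclideanLin A.1) = A.1.det := by
    exact LinearMap.det_toLpLin _ _
  have h2 := Measure.map_linearMap_addHaar_eq_smul_addHaar (volume : Measure (Rd d))
    (f := Matrix.toEuclideanLin A.1) (by rw [h1]; exact (det_pos A).ne')
  rw [h1, abs_of_pos (inv_pos.2 (det_pos A))] at h2
  exact h2

theorem lintegral_comp_scaleEquiv (A : PosDefMatrix d) (g : Rd d → ℝ≥0∞) :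
    ∫⁻ x, g (scaleEquiv A x) = ENNReal.ofReal (A.1.det)⁻¹ * ∫⁻ y, g y := by
  have h1 := (scaleEquiv A).toHomeomorph.measurableEmbedding.lintegral_map (μ := volume) g
  refine h1.symm.trans ?_
  rw [show Measure.map (scaleEquiv A).toHomeomorph volume = _ from map_scaleEquiv A,
    lintegral_smul_measure, smul_eq_mul]

theorem integral_comp_scaleEquiv (A : PosDefMatrix d) (g : Rd d → ℂ) :
    ∫ x, g (scaleEquiv A x) = ((A.1.det)⁻¹ : ℝ) * ∫ y, g y := by
  have h1 := (scaleEquiv A).toHomeomorph.measurableEmbedding.integral_map (μ := volume) g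
  refine h1.symm.trans ?_
  rw [show Measure.map (scaleEquiv A).toHomeomorph volume = _ from map_scaleEquiv A,
    integral_smul_measure, ENNReal.toReal_ofReal (inv_nonneg.2 (det_pos A).le),
    Complex.real_smul]

theorem inner_scaleEquiv (A : PosDefMatrix d) (x y : Rd d) :
    inner ℝ (scaleEquiv A x) y = inner ℝ x (scaleEquiv A y) := by
  exact Matrix.isSymmetric_toEuclideanLin_iff.2 A.2.isHermitian x y

end Scale

/-! ### Fourier transforms of location-scale kernels. -/

section LocScaleFourier

open scoped SchwartzMap

variable {d : ℕ}

/-- The Fourier transform of `x ↦ g(Λ(x - χ))`, for `F` the Fourier transform of `g`. -/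
def locScaleTransform (F : Rd d → ℂ) (η : Rd d) (ω : LocScale d) : ℂ :=
  Complex.exp (↑(-2 * Real.pi * inner ℝ η ω.1) * Complex.I) * ((ω.2.1.det)⁻¹ : ℝ) *
    F ((scaleEquiv ω.2).symm η)

/-- Substitute y = Λ(x − χ) in the inversion integral: the Jacobian gives the determinant, symmetry
moves Λ to the frequency, and the shift by χ becomes the phase. -/
theorem fourierInv_comp_scaleEquiv_symm (A : PosDefMatrix d) (χ : Rd d) (θ τ : 𝓢(Rd d, ℂ))
    (hτ : ∀ y, τ y = 𝓕 θ ((scaleEquiv A).symm y + χ)) (ζ : Rd d) :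
    𝓕⁻ τ ζ = A.1.det *
      (Complex.exp (↑(-2 * Real.pi * inner ℝ (scaleEquiv A ζ) χ) * Complex.I) *
        θ (scaleEquiv A ζ)) := by
  have h1 : 𝓕⁻ τ ζ
      = ∫ y, Complex.exp (↑(2 * Real.pi * inner ℝ y ζ) * Complex.I) *
        𝓕 θ ((scaleEquiv A).symm y + χ) := by
    rw [SchwartzMap.fourierInv_coe, Real.fourierInv_eq']
    simp [hτ]
  have h2 : θ (scaleEquiv A ζ)
      = ∫ x, Complex.exp (↑(2 * Real.pi * inner ℝ x (scaleEquiv A ζ)) * Complex.I) * 𝓕 θ x := by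
    have : θ = 𝓕⁻ (𝓕 θ) := by simp
    conv_lhs => rw [this, SchwartzMap.fourierInv_coe, Real.fourierInv_eq']
    simp
  have h3 := integral_comp_scaleEquiv A
    (fun y => Complex.exp (↑(2 * Real.pi * inner ℝ y ζ) * Complex.I) *
        𝓕 θ ((scaleEquiv A).symm y + χ))
  have hdet : ((A.1.det : ℝ) : ℂ) ≠ 0 := by exact_mod_cast (det_pos A).ne'
  rw [← h1] at h3
  simp only [ContinuousLinearEquiv.symm_apply_apply] at h3
  rw [← integral_sub_right_eq_self _ χ] at h3
  simp only [sub_add_cancel] at h3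
  have h4 : ∀ x : Rd d, Complex.exp (↑(2 * Real.pi * inner ℝ (scaleEquiv A (x - χ)) ζ) * Complex.I)
      * 𝓕 θ x = Complex.exp (↑(-2 * Real.pi * inner ℝ (scaleEquiv A ζ) χ) * Complex.I) *
      (Complex.exp (↑(2 * Real.pi * inner ℝ x (scaleEquiv A ζ)) * Complex.I) * 𝓕 θ x) := by
    intro x
    rw [← mul_assoc, ← Complex.exp_add, inner_scaleEquiv, inner_sub_left,
      real_inner_comm (scaleEquiv A ζ) χ]
    congr 2
    push_cast
    ring
  simp only [h4] at h3
  rw [integral_const_mul, ← h2] at h3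
  rw [h3]
  push_cast
  field_simp

/-- The affine change of variables is moved onto the test function, where it is classical. The pair
(g, F) is tested with 𝓕⁻τ for τ(y) = 𝓕θ(Λ⁻¹y + χ), which is Schwartz. -/
theorem IsFourierPair.locScale {g F : Rd d → ℂ} (h : IsFourierPair g F) (ω : LocScale d) :
    IsFourierPair (fun x => g (scaleEquiv ω.2 (x - ω.1)))
      (fun η => locScaleTransform F η ω) := by
  intro θ
  obtain ⟨χ, A⟩ := ω
  have hg : (fun y : Rd d => (scaleEquiv A).symm y + χ).HasTemperateGrowth := by
    have := (scaleEquiv A).symm.toContinuousLinearMap.hasTemperateGrowth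
    exact this.add (Function.HasTemperateGrowth.const χ)
  have hl : AntilipschitzWith _ (fun y : Rd d => (scaleEquiv A).symm y + χ) := fun x y => by
    rw [edist_add_right]
    exact (scaleEquiv A).symm.antilipschitz x y
  let τ : 𝓢(Rd d, ℂ) := SchwartzMap.compCLMOfAntilipschitz ℂ hg hl (𝓕 θ)
  have hτ : ∀ y, τ y = 𝓕 θ ((scaleEquiv A).symm y + χ) := fun y => rfl
  have hdet : ((A.1.det : ℝ) : ℂ) ≠ 0 := by exact_mod_cast (det_pos A).ne'
  have h1 : ∫ x, 𝓕 θ x * g (scaleEquiv A (x - χ)) = ((A.1.det)⁻¹ : ℝ) * ∫ y, τ y * g y := by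
    rw [← integral_comp_scaleEquiv A]
    rw [← integral_sub_right_eq_self (fun x => τ (scaleEquiv A x) * g (scaleEquiv A x)) χ]
    simp [hτ]
  have h2 : ∫ y, τ y * g y = ∫ ζ, 𝓕⁻ τ ζ * F ζ := by
    have := h (𝓕⁻ τ)
    rwa [show 𝓕 (𝓕⁻ τ) = τ by simp] at this
  have h3 : ∫ ζ, 𝓕⁻ τ ζ * F ζ = ((A.1.det)⁻¹ : ℝ) * ∫ η, A.1.det *
      (Complex.exp (↑(-2 * Real.pi * inner ℝ η χ) * Complex.I) * θ η) *
        F ((scaleEquiv A).symm η) := by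
    rw [← integral_comp_scaleEquiv A]
    simp [fourierInv_comp_scaleEquiv_symm A χ θ τ hτ]
  show ∫ x, 𝓕 θ x * g (scaleEquiv A (x - χ)) = _
  rw [h1, h2, h3, ← mul_assoc, ← integral_const_mul]
  congr 1
  ext η
  simp only [locScaleTransform]
  push_cast
  field_simp

end LocScaleFourier

/-! ### Sobolev norms as weighted `L²` norms -/

section Weight

variable {d : ℕ} {s : ℝ}

/-- The Bessel weight `(1 + |2πη|²)^s`. -/
def sobolevWeight (s : ℝ) (η : Rd d) : ℝ≥0∞ :=
  ENNReal.ofReal ((1 + ‖(2 * Real.pi) • η‖ ^ 2) ^ s)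

/-- The measure with density the Bessel weight. -/
def sobolevMeasure (d : ℕ) (s : ℝ) : Measure (Rd d) :=
  volume.withDensity (sobolevWeight s)

instance : SFinite (sobolevMeasure d s) := by
  unfold sobolevMeasure
  infer_instance

theorem measurable_sobolevWeight : Measurable (sobolevWeight (d := d) s) := by
  unfold sobolevWeight
  fun_prop

theorem volume_le_sobolevMeasure (hs : 0 ≤ s) : volume ≤ sobolevMeasure d s := by
  have h1 : (volume : Measure (Rd d)) = volume.withDensity 1 := withDensity_one.symm
  conv_lhs => rw [h1]
  refine withDensity_mono (ae_of_all _ fun η => ?_)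
  rw [sobolevWeight, Pi.one_apply, ENNReal.one_le_ofReal]
  exact Real.one_le_rpow (by nlinarith [sq_nonneg ‖(2 * Real.pi) • η‖]) hs

theorem sobolevMeasure_absolutelyContinuous : sobolevMeasure d s ≪ volume :=
  withDensity_absolutelyContinuous _ _

theorem eLpNorm_sobolevMeasure_sq {F : Rd d → ℂ} :
    eLpNorm F 2 (sobolevMeasure d s) ^ 2 = ∫⁻ η, sobolevWeight s η * ‖F η‖ₑ ^ 2 := by
  rw [eLpNorm_two_sq, sobolevMeasure, lintegral_withDensity_eq_lintegral_mul_non_measurable _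
    measurable_sobolevWeight (ae_of_all _ fun η => ENNReal.ofReal_lt_top)]
  rfl

theorem lintegral_comp_smul' (c : ℝ) (hc : c ≠ 0) (g : Rd d → ℝ≥0∞) :
    ∫⁻ x, g (c • x) = ENNReal.ofReal |(c ^ d)⁻¹| * ∫⁻ x, g x := by
  have h1 := (Homeomorph.smulOfNeZero c hc).measurableEmbedding.lintegral_map
    (μ := (volume : Measure (Rd d))) g
  refine h1.symm.trans ?_
  have h2 := Measure.map_addHaar_smul (volume : Measure (Rd d)) hc
  rw [finrank_euclideanSpace_fin] at h2
  rw [show Measure.map (Homeomorph.smulOfNeZero c hc) (volume : Measure (Rd d)) = _ from h2,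
    lintegral_smul_measure, smul_eq_mul]

/-- The substitution η = −ξ/(2π) absorbs the factor (2π)^{-d}, and the weight is even. -/
theorem sobolevENorm_eq {f : Rd d → ℝ} (hf : MemLp (fun x => (f x : ℂ)) 2 volume) :
    sobolevENorm s f
      = eLpNorm (𝓕 hf.toLp : Lp (α := Rd d) ℂ 2 volume) 2 (sobolevMeasure d s) := by
  have hpi := Real.pi_pos
  have h1 : ∫⁻ ξ : Rd d, ENNReal.ofReal ((1 + ‖ξ‖ ^ 2) ^ s) * ‖fourierHat hf.toLp ξ‖ₑ ^ 2
      = ENNReal.ofReal ((2 * Real.pi) ^ d) *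
        eLpNorm (𝓕 hf.toLp : Lp (α := Rd d) ℂ 2 volume) 2 (sobolevMeasure d s) ^ 2 := by
    have h2 := lintegral_comp_smul' (-(2 * Real.pi)⁻¹) (by simp [hpi.ne'])
      (fun η : Rd d => sobolevWeight s η *
        ‖(𝓕 hf.toLp : Lp (α := Rd d) ℂ 2 volume) η‖ₑ ^ 2)
    have h3 : |((-(2 * Real.pi)⁻¹) ^ d)⁻¹| = (2 * Real.pi) ^ d := by
      rw [abs_inv, abs_pow, abs_neg, abs_of_pos (by positivity), inv_pow, inv_inv]
    rw [h3, ← eLpNorm_sobolevMeasure_sq] at h2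
    rw [← h2]
    refine lintegral_congr fun ξ => ?_
    have h4 : (2 * Real.pi) • (-(2 * Real.pi)⁻¹ • ξ) = -ξ := by
      rw [smul_smul]
      field_simp
      simp
    rw [sobolevWeight, h4, norm_neg, fourierHat, neg_smul]
  rw [sobolevENorm, dif_pos hf, h1, ← mul_assoc, ← ENNReal.ofReal_mul (by positivity),
    inv_mul_cancel₀ (by positivity), ENNReal.ofReal_one, one_mul, ← ENNReal.rpow_natCast,
    ← ENNReal.rpow_mul]
  norm_num

end Weight

/-! ### Bounds on location-scale kernels -/

section SpecRad

variable {d : ℕ} {s : ℝ}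

theorem nnnorm_eigenvalues_le (A : PosDefMatrix d) (i : Fin d) :
    (‖A.2.isHermitian.eigenvalues i‖₊ : ℝ≥0∞) ≤ spectralRadius ℝ A.1 :=
  le_iSup₂ (f := fun (k : ℝ) (_ : k ∈ spectrum ℝ A.1) => (‖k‖₊ : ℝ≥0∞)) _
    (A.2.isHermitian.eigenvalues_mem_spectrum_real i)

theorem spectralRadius_lt_top (A : PosDefMatrix d) : spectralRadius ℝ A.1 < ∞ := by
  have h1 : spectralRadius ℝ A.1 ≤ ∑ i, (‖A.2.isHermitian.eigenvalues i‖₊ : ℝ≥0∞) := by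
    refine iSup₂_le fun k hk => ?_
    rw [A.2.isHermitian.spectrum_real_eq_range_eigenvalues] at hk
    obtain ⟨i, rfl⟩ := hk
    exact Finset.single_le_sum (f := fun i => (‖A.2.isHermitian.eigenvalues i‖₊ : ℝ≥0∞))
      (fun _ _ => zero_le) (Finset.mem_univ i)
  exact h1.trans_lt (ENNReal.sum_lt_top.2 fun i _ => ENNReal.coe_lt_top)

theorem specRad_lt_top (ω : LocScale d) : specRad ω < ∞ := spectralRadius_lt_top ω.2

/-- Expand in an orthonormal eigenbasis: each coordinate is multiplied by an eigenvalue of modulus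
at most ρ(Λ). -/
theorem norm_scaleEquiv_le (A : PosDefMatrix d) (x : Rd d) :
    ‖scaleEquiv A x‖ ≤ (spectralRadius ℝ A.1).toReal * ‖x‖ := by
  set R := (spectralRadius ℝ A.1).toReal with hR
  have hR0 : 0 ≤ R := ENNReal.toReal_nonneg
  let b := A.2.isHermitian.eigenvectorBasis
  have hb : ∀ i, inner ℝ (b i) (scaleEquiv A x)
      = A.2.isHermitian.eigenvalues i * inner ℝ (b i) x := by
    intro i
    rw [← inner_scaleEquiv]
    have h1 : scaleEquiv A (b i) = A.2.isHermitian.eigenvalues i • b i := by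
      rw [scaleEquiv_apply, Matrix.toLpLin_apply, A.2.isHermitian.mulVec_eigenvectorBasis]
      rfl
    rw [h1, real_inner_smul_left]
  have hl : ∀ i, |A.2.isHermitian.eigenvalues i| ≤ R := by
    intro i
    have h1 := ENNReal.toReal_mono (spectralRadius_lt_top A).ne (nnnorm_eigenvalues_le A i)
    simpa using h1
  refine abs_le_of_sq_le_sq' ?_ (by positivity) |>.2
  rw [mul_pow, ← b.sum_sq_norm_inner_right, ← b.sum_sq_norm_inner_right x, Finset.mul_sum]
  refine Finset.sum_le_sum fun i _ => ?_
  rw [hb, norm_mul, mul_pow]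
  gcongr
  exact hl i

/-- This is 1 + ρ²|ζ|² ≤ (1 + ρ)²(1 + |ζ|²), raised to the power s ≥ 0. -/
theorem sobolevWeight_scaleEquiv_le (hs : 0 ≤ s) (ω : LocScale d) (ζ : Rd d) :
    sobolevWeight s (scaleEquiv ω.2 ζ) ≤ (1 + specRad ω) ^ (2 * s) * sobolevWeight s ζ := by
  set R := (specRad ω).toReal with hR
  have hR0 : 0 ≤ R := ENNReal.toReal_nonneg
  have hRe : (1 + specRad ω) ^ (2 * s) = ENNReal.ofReal ((1 + R) ^ (2 * s)) := by
    rw [← ENNReal.ofReal_rpow_of_nonneg (by positivity) (by positivity),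
      ENNReal.ofReal_add zero_le_one hR0, ENNReal.ofReal_one, hR,
      ENNReal.ofReal_toReal (specRad_lt_top ω).ne]
  rw [hRe, sobolevWeight, sobolevWeight, ← ENNReal.ofReal_mul (by positivity)]
  refine ENNReal.ofReal_le_ofReal ?_
  rw [Real.rpow_mul (by positivity), ← Real.mul_rpow (by positivity) (by positivity)]
  refine Real.rpow_le_rpow (by positivity) ?_ hs
  rw [← map_smul]
  set ζ' := (2 * Real.pi) • ζ
  have h1 := norm_scaleEquiv_le ω.2 ζ'
  have h2 : ‖scaleEquiv ω.2 ζ'‖ ^ 2 ≤ (R * ‖ζ'‖) ^ 2 := by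
    gcongr
    exact h1
  rw [Real.rpow_two]
  nlinarith [sq_nonneg ‖ζ'‖, mul_nonneg hR0 (sq_nonneg ‖ζ'‖)]

theorem one_le_one_add_specRad_rpow (hs : 0 ≤ s) (ω : LocScale d) :
    1 ≤ (1 + specRad ω) ^ (2 * s) :=
  (ENNReal.one_rpow _).symm.le.trans (ENNReal.rpow_le_rpow le_self_add (by positivity))

theorem eLpNorm_locScale_sq (g : Rd d → ℝ) (ω : LocScale d) :
    eLpNorm (fun x => locScaleKernel g x ω) 2 volume ^ 2
      = invDet ω * eLpNorm g 2 volume ^ 2 := by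
  rw [eLpNorm_two_sq, eLpNorm_two_sq, invDet, ← lintegral_comp_scaleEquiv]
  exact lintegral_sub_right_eq_self (fun y => ‖g (scaleEquiv ω.2 y)‖ₑ ^ 2) ω.1

/-- The squared transform carries |Λ|⁻²; substituting η = Λζ gives back one factor |Λ| and turns the
weight into its value at Λζ, at the cost (1 + ρ)^{2s}. -/
theorem eLpNorm_locScaleTransform_sq_le (hs : 0 ≤ s) (F : Rd d → ℂ) (ω : LocScale d) :
    eLpNorm (fun η => locScaleTransform F η ω) 2 (sobolevMeasure d s) ^ 2
      ≤ invDet ω * (1 + specRad ω) ^ (2 * s) * eLpNorm F 2 (sobolevMeasure d s) ^ 2 := by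
  have hD := det_pos ω.2
  rw [eLpNorm_sobolevMeasure_sq, eLpNorm_sobolevMeasure_sq]
  have h1 : ∀ η, sobolevWeight s η * ‖locScaleTransform F η ω‖ₑ ^ 2
      = invDet ω ^ 2 * (sobolevWeight s η * ‖F ((scaleEquiv ω.2).symm η)‖ₑ ^ 2) := by
    intro η
    have h2 : ‖(((ω.2.1.det)⁻¹ : ℝ) : ℂ)‖ₑ = invDet ω := by
      rw [← ofReal_norm, Complex.norm_real, Real.norm_of_nonneg (by positivity)]
      rfl
    have h3 : ‖Complex.exp (↑(-2 * Real.pi * inner ℝ η ω.1) * Complex.I)‖ₑ = 1 := by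
      rw [← ofReal_norm, Complex.norm_exp_ofReal_mul_I, ENNReal.ofReal_one]
    rw [locScaleTransform, enorm_mul, enorm_mul, h2, h3]
    ring
  simp only [h1]
  have h4 := lintegral_comp_scaleEquiv ω.2
    (fun η => sobolevWeight s η * ‖F ((scaleEquiv ω.2).symm η)‖ₑ ^ 2)
  simp only [ContinuousLinearEquiv.symm_apply_apply] at h4
  have hfin : invDet ω ≠ ∞ := ENNReal.ofReal_ne_top
  rw [lintegral_const_mul' _ _ (ENNReal.pow_ne_top hfin), sq, mul_assoc]
  rw [show invDet ω * _ = _ from h4.symm, mul_assoc]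
  gcongr
  rw [← lintegral_const_mul' _ _ (ENNReal.rpow_ne_top_of_nonneg (by positivity)
    (ENNReal.add_lt_top.2 ⟨ENNReal.one_lt_top, specRad_lt_top ω⟩).ne)]
  refine lintegral_mono fun ζ => ?_
  rw [← mul_assoc]
  gcongr
  exact sobolevWeight_scaleEquiv_le hs ω ζ

end SpecRad

/-! ### Measurability of location-scale kernels -/

section Meas

variable {d : ℕ}

theorem continuous_posDefMatrix_val : Continuous fun A : PosDefMatrix d => A.1 :=
  continuous_subtype_val

instance : SecondCountableTopology (Matrix (Fin d) (Fin d) ℝ) :=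
  inferInstanceAs (SecondCountableTopology (Fin d → Fin d → ℝ))

instance : SecondCountableTopology (PosDefMatrix d) :=
  TopologicalSpace.Subtype.secondCountableTopology {A : Matrix (Fin d) (Fin d) ℝ | A.PosDef}

theorem continuous_inv_posDefMatrix : Continuous fun A : PosDefMatrix d => (A.1)⁻¹ := by
  have h1 : Continuous fun A : PosDefMatrix d => (A.1.det)⁻¹ :=
    continuous_posDefMatrix_val.matrix_det.inv₀ fun A => (det_pos A).ne'
  simp only [Matrix.inv_def, Ring.inverse_eq_inv']
  exact h1.smul continuous_posDefMatrix_val.matrix_adjugate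

theorem continuous_toEuclideanLin {T : Type*} [TopologicalSpace T]
    {A : T → Matrix (Fin d) (Fin d) ℝ} {x : T → Rd d} (hA : Continuous A) (hx : Continuous x) :
    Continuous fun t => Matrix.toEuclideanLin (A t) (x t) := by
  simp only [Matrix.toLpLin_apply]
  exact (PiLp.continuous_toLp 2 _).comp
    (hA.matrix_mulVec ((PiLp.continuous_ofLp 2 _).comp hx))

theorem measurable_locScaleKernel {G : Rd d → ℝ} (hG : Measurable G) :
    Measurable (Function.uncurry (locScaleKernel G)) := by
  refine hG.comp (Continuous.measurable ?_)
  exact continuous_toEuclideanLin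
    (continuous_posDefMatrix_val.comp (continuous_snd.comp continuous_snd))
    (continuous_fst.sub (continuous_fst.comp continuous_snd))

theorem measurable_locScaleTransform {F : Rd d → ℂ} (hF : Measurable F) :
    Measurable (Function.uncurry (locScaleTransform F)) := by
  have h1 : Continuous fun p : Rd d × LocScale d =>
      Complex.exp (↑(-2 * Real.pi * inner ℝ p.1 p.2.1) * Complex.I) := by fun_prop
  have h2 : Continuous fun p : Rd d × LocScale d => (((p.2.2.1.det)⁻¹ : ℝ) : ℂ) :=
    Complex.continuous_ofReal.comp <|
      ((continuous_posDefMatrix_val.comp (continuous_snd.comp continuous_snd)).matrix_det).inv₀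
        fun p => (det_pos p.2.2).ne'
  have h3 : Continuous fun p : Rd d × LocScale d => (scaleEquiv p.2.2).symm p.1 :=
    continuous_toEuclideanLin
      (continuous_inv_posDefMatrix.comp (continuous_snd.comp continuous_snd)) continuous_fst
  exact (h1.measurable.mul h2.measurable).mul (hF.comp h3.measurable)

end Meas

/-! ### Fourier transforms of truncated fields -/

section FourierPairIntegral

open scoped SchwartzMap

variable {d : ℕ} {S : Type*} [MeasurableSpace S]

theorem integrable_schwartz_mul (θ : 𝓢(Rd d, ℂ)) {f : Rd d → ℂ} (hf : MemLp f 2 volume) :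
    Integrable fun x => θ x * f x :=
  (θ.memLp 2 volume).integrable_mul hf

theorem IsFourierPair.add {f f' F F' : Rd d → ℂ} (h : IsFourierPair f F)
    (h' : IsFourierPair f' F') (hf : MemLp f 2 volume) (hf' : MemLp f' 2 volume)
    (hF : MemLp F 2 volume) (hF' : MemLp F' 2 volume) :
    IsFourierPair (fun x => f x + f' x) (fun ξ => F ξ + F' ξ) := by
  intro θ
  simp only [mul_add]
  rw [integral_add (integrable_schwartz_mul _ hf) (integrable_schwartz_mul _ hf'),
    integral_add (integrable_schwartz_mul _ hF) (integrable_schwartz_mul _ hF'), h θ, h' θ]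

theorem IsFourierPair.sub {f f' F F' : Rd d → ℂ} (h : IsFourierPair f F)
    (h' : IsFourierPair f' F') (hf : MemLp f 2 volume) (hf' : MemLp f' 2 volume)
    (hF : MemLp F 2 volume) (hF' : MemLp F' 2 volume) :
    IsFourierPair (fun x => f x - f' x) (fun ξ => F ξ - F' ξ) := by
  intro θ
  simp only [mul_sub]
  rw [integral_sub (integrable_schwartz_mul _ hf) (integrable_schwartz_mul _ hf'),
    integral_sub (integrable_schwartz_mul _ hF) (integrable_schwartz_mul _ hF'), h θ, h' θ]

theorem IsFourierPair.congr {f f' F F' : Rd d → ℂ} (h : IsFourierPair f F)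
    (hf : f =ᵐ[volume] f') (hF : F =ᵐ[volume] F') : IsFourierPair f' F' := by
  intro θ
  have h1 : ∫ x, 𝓕 θ x * f' x = ∫ x, 𝓕 θ x * f x :=
    integral_congr_ae (hf.mono fun x hx => by simp only [hx])
  have h2 : ∫ x, θ x * F' x = ∫ x, θ x * F x :=
    integral_congr_ae (hF.mono fun x hx => by simp only [hx])
  rw [h1, h2, h θ]

theorem memLp_integral {m : Measure (Rd d)} {μ : Measure S} [SFinite m] [SFinite μ]
    {K : Rd d → S → ℂ} (hK : Measurable (Function.uncurry K))
    (h : ∫⁻ p, eLpNorm (fun x => K x p) 2 m ∂μ < ∞) :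
    MemLp (fun x => ∫ p, K x p ∂μ) 2 m :=
  ⟨(StronglyMeasurable.integral_prod_right hK.stronglyMeasurable).aestronglyMeasurable,
    (eLpNorm_integral_le hK).trans_lt h⟩

theorem integral_schwartz_mul_integral {μ : Measure S} [SFinite μ] {K : Rd d → S → ℂ}
    (hK : Measurable (Function.uncurry K))
    (h : ∫⁻ p, eLpNorm (fun x => K x p) 2 volume ∂μ < ∞) (θ : 𝓢(Rd d, ℂ)) :
    ∫ x, θ x * ∫ p, K x p ∂μ = ∫ p, (∫ x, θ x * K x p) ∂μ := by
  have hm : Measurable (Function.uncurry fun x p => θ x * K x p) :=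
    (θ.continuous.measurable.comp measurable_fst).mul hK
  have hi : Integrable (Function.uncurry fun x p => θ x * K x p) (volume.prod μ) := by
    refine ⟨hm.aestronglyMeasurable, ?_⟩
    rw [HasFiniteIntegral, lintegral_prod_symm _ hm.enorm.aemeasurable]
    have h1 : ∀ p, ∫⁻ x, ‖θ x * K x p‖ₑ
        ≤ eLpNorm θ 2 volume * eLpNorm (fun x => K x p) 2 volume := by
      intro p
      simp only [enorm_mul]
      rw [eLpNorm_two_eq, eLpNorm_two_eq]
      exact lintegral_mul_le_sqrt θ.continuous.measurable.enorm.aemeasurable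
        hK.of_uncurry_right.enorm.aemeasurable
    refine (lintegral_mono h1).trans_lt ?_
    rw [lintegral_const_mul' _ _ (θ.memLp 2 volume).2.ne]
    exact ENNReal.mul_lt_top (θ.memLp 2 volume).2 h
  rw [← integral_integral_swap hi]
  refine integral_congr_ae (ae_of_all _ fun x => ?_)
  exact (integral_const_mul _ _).symm

/-- After testing with a Schwartz function, Fubini reduces the claim to single parameters;
Cauchy–Schwarz against θ supplies the integrability. -/
theorem IsFourierPair.integral {μ : Measure S} [SFinite μ] {K L : Rd d → S → ℂ}
    (hK : Measurable (Function.uncurry K)) (hL : Measurable (Function.uncurry L))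
    (hKL : ∀ p, IsFourierPair (fun x => K x p) (fun ξ => L ξ p))
    (hK2 : ∫⁻ p, eLpNorm (fun x => K x p) 2 volume ∂μ < ∞)
    (hL2 : ∫⁻ p, eLpNorm (fun x => L x p) 2 volume ∂μ < ∞) :
    IsFourierPair (fun x => ∫ p, K x p ∂μ) (fun ξ => ∫ p, L ξ p ∂μ) := by
  intro θ
  rw [integral_schwartz_mul_integral hK hK2, integral_schwartz_mul_integral hL hL2]
  exact integral_congr_ae (ae_of_all _ fun p => hKL p θ)

end FourierPairIntegral

/-! ### Truncated fields and their transforms. -/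

section Trunc

open scoped SchwartzMap

variable {Θ : Type*} [MeasurableSpace Θ] {d : ℕ} {h : ℝ → ℝ} {φ : Rd d → Θ → ℝ}
  {Ψ : Rd d → Θ → ℂ} {m : Measure (Rd d)} {μ ν : Measure (ℝ × Θ)} {V : Θ → ℝ≥0∞}

theorem eLpNorm_mul_const_complex {E : Type*} [MeasurableSpace E] (f : E → ℂ) (c : ℝ)
    (m : Measure E) :
    eLpNorm (fun x => f x * (c : ℂ)) 2 m = ‖c‖ₑ * eLpNorm f 2 m := by
  have h1 : ‖(c : ℂ)‖ₑ = ‖c‖ₑ := by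
    rw [← ofReal_norm, Complex.norm_real, ofReal_norm]
  rw [← h1, ← eLpNorm_const_smul]
  congr 1
  funext x
  simp [mul_comm]

theorem eLpNorm_ofReal {E : Type*} [MeasurableSpace E] (f : E → ℝ) (m : Measure E) :
    eLpNorm (fun x => (f x : ℂ)) 2 m = eLpNorm f 2 m :=
  eLpNorm_congr_norm_ae (ae_of_all _ fun x => by simp)

theorem measurable_uncurry_mul_complex (hΨ : Measurable (Function.uncurry Ψ)) {g : ℝ → ℝ}
    (hg : Measurable g) :
    Measurable (Function.uncurry fun x (p : ℝ × Θ) => Ψ x p.2 * (g p.1 : ℂ)) :=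
  (hΨ.comp (measurable_fst.prodMk (measurable_snd.comp measurable_snd))).mul
    (Complex.measurable_ofReal.comp (hg.comp (measurable_fst.comp measurable_snd)))

theorem isFourierPair_setIntegral (hφ : Measurable (Function.uncurry φ))
    (hΨ : Measurable (Function.uncurry Ψ))
    (hpair : ∀ ω, IsFourierPair (fun x => (φ x ω : ℂ)) (fun ξ => Ψ ξ ω))
    (hφV : ∀ ω, eLpNorm (fun x => φ x ω) 2 volume ≤ V ω)
    (hΨV : ∀ ω, eLpNorm (fun x => Ψ x ω) 2 volume ≤ V ω) {g : ℝ → ℝ} (hg : Measurable g)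
    {B : Set (ℝ × Θ)} [SFinite (μ.restrict B)]
    (hfin : ∫⁻ p in B, ‖g p.1‖ₑ * V p.2 ∂μ < ∞) :
    IsFourierPair (fun x => ((∫ p in B, φ x p.2 * g p.1 ∂μ : ℝ) : ℂ))
        (fun ξ => ∫ p in B, Ψ ξ p.2 * (g p.1 : ℂ) ∂μ) ∧
      MemLp (fun x => ((∫ p in B, φ x p.2 * g p.1 ∂μ : ℝ) : ℂ)) 2 volume ∧
      MemLp (fun ξ => ∫ p in B, Ψ ξ p.2 * (g p.1 : ℂ) ∂μ) 2 volume := by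
  have hφ' : Measurable (Function.uncurry fun x ω => (φ x ω : ℂ)) :=
    Complex.measurable_ofReal.comp hφ
  have hK := measurable_uncurry_mul_complex hφ' hg
  have hL := measurable_uncurry_mul_complex hΨ hg
  have hK2 : ∫⁻ p in B, eLpNorm (fun x => (φ x p.2 : ℂ) * (g p.1 : ℂ)) 2 volume ∂μ < ∞ := by
    simp only [eLpNorm_mul_const_complex, eLpNorm_ofReal]
    exact (lintegral_mono fun p => by gcongr; exact hφV _).trans_lt hfin
  have hL2 : ∫⁻ p in B, eLpNorm (fun x => Ψ x p.2 * (g p.1 : ℂ)) 2 volume ∂μ < ∞ := by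
    simp only [eLpNorm_mul_const_complex]
    exact (lintegral_mono fun p => by gcongr; exact hΨV _).trans_lt hfin
  have hre : (fun x => ((∫ p in B, φ x p.2 * g p.1 ∂μ : ℝ) : ℂ))
      = fun x => ∫ p in B, (φ x p.2 : ℂ) * (g p.1 : ℂ) ∂μ := by
    funext x
    rw [← integral_complex_ofReal]
    simp
  rw [hre]
  refine ⟨IsFourierPair.integral hK hL (fun p θ => ?_) hK2 hL2, memLp_integral hK hK2,
    memLp_integral hL hL2⟩
  simp only [← mul_assoc]
  rw [integral_mul_const, integral_mul_const, hpair p.2 θ]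

theorem ae_setIntegral_eq_re_add_im [SFinite m] (hΨ : Measurable (Function.uncurry Ψ))
    (hΨV : ∀ ω, eLpNorm (fun x => Ψ x ω) 2 m ≤ V ω) {g : ℝ → ℝ} (hg : Measurable g)
    {B : Set (ℝ × Θ)} [SFinite (μ.restrict B)]
    (hfin : ∫⁻ p in B, ‖g p.1‖ₑ * V p.2 ∂μ < ∞) :
    ∀ᵐ ξ ∂m, ∫ p in B, Ψ ξ p.2 * (g p.1 : ℂ) ∂μ
      = ((∫ p in B, (Ψ ξ p.2).re * g p.1 ∂μ : ℝ) : ℂ) +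
        ((∫ p in B, (Ψ ξ p.2).im * g p.1 ∂μ : ℝ) : ℂ) * Complex.I := by
  have hL := measurable_uncurry_mul_complex hΨ hg
  have hL2 : ∫⁻ p in B, eLpNorm (fun x => Ψ x p.2 * (g p.1 : ℂ)) 2 m ∂μ < ∞ := by
    simp only [eLpNorm_mul_const_complex]
    exact (lintegral_mono fun p => by gcongr; exact hΨV _).trans_lt hfin
  filter_upwards [ae_lintegral_enorm_lt_top hL hL2] with ξ hξ
  have hi : IntegrableOn (fun p : ℝ × Θ => Ψ ξ p.2 * (g p.1 : ℂ)) B μ :=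
    ⟨hL.of_uncurry_left.aestronglyMeasurable, hξ⟩
  have h1 := integral_re_add_im hi
  simp only [RCLike.re_eq_complex_re, RCLike.im_eq_complex_im, Complex.re_mul_ofReal,
    Complex.im_mul_ofReal] at h1
  exact h1.symm

theorem GoodJumps.eLpNorm_truncField_lt_top [SFinite m] [SFinite ν]
    (hφ : Measurable (Function.uncurry φ))
    (hh : Measurable h) (hμ : GoodJumps μ h V) (hφV : ∀ ω, eLpNorm (fun x => φ x ω) 2 m ≤ V ω)
    {ε : ℝ} (hε : 0 < ε) (hν : ∫⁻ p in bigJumps Θ ε, ‖h p.1‖ₑ * V p.2 ∂ν < ∞) :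
    eLpNorm (truncField μ ν h φ ε) 2 m < ∞ := by
  have := hμ.isFiniteMeasure hε
  have key : ∀ {g : ℝ → ℝ} {ρ : Measure (ℝ × Θ)} [SFinite (ρ.restrict (bigJumps Θ ε))],
      Measurable g → ∫⁻ p in bigJumps Θ ε, ‖g p.1‖ₑ * V p.2 ∂ρ < ∞ →
      MemLp (fun x => ∫ p in bigJumps Θ ε, φ x p.2 * g p.1 ∂ρ) 2 m := by
    intro g ρ _ hg hfin
    refine ⟨(measurable_setIntegral_mul hφ hg).aestronglyMeasurable,
      (eLpNorm_integral_le (measurable_uncurry_mul hφ hg)).trans_lt ?_⟩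
    simp only [eLpNorm_mul_const']
    exact (lintegral_mono fun p => by gcongr; exact hφV _).trans_lt hfin
  exact ((key (g := fun β => β - h β) (measurable_id.sub hh) (hμ.big ε hε)).add
    ((key hh (hμ.big_compensator ε hε)).sub (key hh hν))).2

/-- By linearity the transform is the truncated field with kernel Ψ. It is written through Re Ψ and
Im Ψ because the L² Cauchy estimate is stated for real kernels and is applied to each of the two. -/
theorem GoodJumps.isFourierPair_truncField [SFinite ν] (hφ : Measurable (Function.uncurry φ))
    (hΨ : Measurable (Function.uncurry Ψ)) (hh : Measurable h)
    (hpair : ∀ ω, IsFourierPair (fun x => (φ x ω : ℂ)) (fun ξ => Ψ ξ ω))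
    (hμ : GoodJumps μ h V) (hφV : ∀ ω, eLpNorm (fun x => φ x ω) 2 volume ≤ V ω)
    (hΨV : ∀ ω, eLpNorm (fun x => Ψ x ω) 2 volume ≤ V ω)
    {ε : ℝ} (hε : 0 < ε) (hν : ∫⁻ p in bigJumps Θ ε, ‖h p.1‖ₑ * V p.2 ∂ν < ∞) :
    IsFourierPair (fun x => (truncField μ ν h φ ε x : ℂ))
      (fun ξ => (truncField μ ν h (fun x ω => (Ψ x ω).re) ε ξ : ℂ) +
        (truncField μ ν h (fun x ω => (Ψ x ω).im) ε ξ : ℂ) * Complex.I) := by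
  have := hμ.isFiniteMeasure hε
  have hd : Measurable fun β => β - h β := measurable_id.sub hh
  obtain ⟨a1, b1, c1⟩ := isFourierPair_setIntegral hφ hΨ hpair hφV hΨV hd (hμ.big ε hε)
  obtain ⟨a2, b2, c2⟩ := isFourierPair_setIntegral hφ hΨ hpair hφV hΨV hh
    (hμ.big_compensator ε hε)
  obtain ⟨a3, b3, c3⟩ := isFourierPair_setIntegral hφ hΨ hpair hφV hΨV hh hν
  have h1 := a1.add (a2.sub a3 b2 b3 c2 c3) b1 (b2.sub b3) c1 (c2.sub c3)
  refine h1.congr (ae_of_all _ fun x => ?_) ?_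
  · simp [truncField]
  · filter_upwards [ae_setIntegral_eq_re_add_im hΨ hΨV hd (hμ.big ε hε),
      ae_setIntegral_eq_re_add_im hΨ hΨV hh (hμ.big_compensator ε hε),
      ae_setIntegral_eq_re_add_im hΨ hΨV hh hν] with ξ e1 e2 e3
    rw [e1, e2, e3]
    simp only [truncField]
    push_cast
    ring

end Trunc

/-! ### Convergence of truncations in Sobolev norm -/

section Convergence

variable {d : ℕ} {s : ℝ}

/-- Fatou's lemma along the sequence `e` identifies the limit, while the Cauchy property carries the
estimate to all small ε. -/
theorem exists_eLpNorm_sub_le_of_cauchy {E : Type*} [MeasurableSpace E] {m : Measure E}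
    {U : ℝ → E → ℝ} {u : E → ℝ} (hU : ∀ ε > 0, AEStronglyMeasurable (U ε) m)
    (hc : ∀ η > 0, ∃ δ > 0, ∀ ε, 0 < ε → ε ≤ δ → eLpNorm (fun x => U ε x - U δ x) 2 m ≤ η)
    {e : ℕ → ℝ} (he : ∀ n, 0 < e n) (he0 : Tendsto e atTop (𝓝 0))
    (hlim : ∀ᵐ x ∂m, Tendsto (fun n => U (e n) x) atTop (𝓝 (u x))) {η : ℝ≥0∞} (hη : 0 < η) :
    ∃ δ > 0, ∀ ε, 0 < ε → ε ≤ δ → eLpNorm (fun x => U ε x - u x) 2 m ≤ η := by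
  obtain ⟨δ, hδ, h1⟩ := hc (η / 2) (ENNReal.half_pos hη.ne')
  refine ⟨δ, hδ, fun ε hε hεδ => ?_⟩
  have h2 : eLpNorm (fun x => U ε x - u x) 2 m
      ≤ liminf (fun n => eLpNorm (fun x => U ε x - U (e n) x) 2 m) atTop := by
    refine Lp.eLpNorm_lim_le_liminf_eLpNorm (fun n => (hU ε hε).sub (hU _ (he n))) _ ?_
    filter_upwards [hlim] with x hx
    exact tendsto_const_nhds.sub hx
  refine h2.trans (liminf_le_of_frequently_le' (Eventually.frequently ?_))
  filter_upwards [he0.eventually (ge_mem_nhds hδ)] with n hn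
  have h3 : (fun x => U ε x - U (e n) x)
      = (fun x => U ε x - U δ x) - fun x => U (e n) x - U δ x := by
    funext x
    simp
  rw [h3, ← ENNReal.add_halves η]
  exact (eLpNorm_sub_le ((hU ε hε).sub (hU δ hδ)) ((hU _ (he n)).sub (hU δ hδ))
    (by norm_num)).trans (add_le_add (h1 ε hε hεδ) (h1 _ (he n) hn))

theorem memLp_ofReal {E : Type*} [MeasurableSpace E] {m : Measure E} {f : E → ℝ}
    (hf : MemLp f 2 m) : MemLp (fun x => (f x : ℂ)) 2 m := hf.ofReal

theorem eLpNorm_fourier (g : Lp (α := Rd d) ℂ 2 volume) :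
    eLpNorm (𝓕 g : Lp (α := Rd d) ℂ 2 volume) 2 volume = eLpNorm g 2 volume := by
  have h1 := Lp.norm_fourier_eq g
  rw [Lp.norm_def, Lp.norm_def] at h1
  exact (ENNReal.toReal_eq_toReal_iff' (Lp.eLpNorm_ne_top _) (Lp.eLpNorm_ne_top _)).1 h1

theorem IsFourierPair.eLpNorm_eq {f F : Rd d → ℂ} (h : IsFourierPair f F)
    (hf : MemLp f 2 volume) (hF : MemLp F 2 volume) :
    eLpNorm F 2 volume = eLpNorm f 2 volume := by
  rw [← eLpNorm_congr_ae (h.ae_eq hf hF), eLpNorm_fourier, eLpNorm_congr_ae hf.coeFn_toLp]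

theorem IsFourierPair.sobolevENorm_eq {f : Rd d → ℝ} {F : Rd d → ℂ}
    (h : IsFourierPair (fun x => (f x : ℂ)) F) (hf : MemLp f 2 volume)
    (hF : MemLp F 2 volume) : sobolevENorm s f = eLpNorm F 2 (sobolevMeasure d s) := by
  rw [Lark.sobolevENorm_eq (memLp_ofReal hf)]
  exact eLpNorm_congr_ae
    (sobolevMeasure_absolutelyContinuous.ae_le (h.ae_eq (memLp_ofReal hf) hF))

theorem eLpNorm_re_add_im_le {E : Type*} [MeasurableSpace E] {m : Measure E} {a b : E → ℝ}
    (ha : AEStronglyMeasurable a m) (hb : AEStronglyMeasurable b m) :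
    eLpNorm (fun x => (a x : ℂ) + (b x : ℂ) * Complex.I) 2 m
      ≤ eLpNorm a 2 m + eLpNorm b 2 m := by
  have hb' : eLpNorm (fun x => (b x : ℂ) * Complex.I) 2 m = eLpNorm b 2 m :=
    eLpNorm_congr_norm_ae (ae_of_all _ fun x => by simp)
  rw [← hb', ← eLpNorm_ofReal a]
  exact eLpNorm_add_le (Complex.continuous_ofReal.comp_aestronglyMeasurable ha)
    ((Complex.continuous_ofReal.comp_aestronglyMeasurable hb).mul_const _) (by norm_num)

theorem memLp_re_add_im {E : Type*} [MeasurableSpace E] {m : Measure E} {a b : E → ℝ}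
    (ha : MemLp a 2 m) (hb : MemLp b 2 m) :
    MemLp (fun x => (a x : ℂ) + (b x : ℂ) * Complex.I) 2 m :=
  ⟨(Complex.continuous_ofReal.comp_aestronglyMeasurable ha.1).add
    ((Complex.continuous_ofReal.comp_aestronglyMeasurable hb.1).mul_const _),
    (eLpNorm_re_add_im_le ha.1 hb.1).trans_lt (ENNReal.add_lt_top.2 ⟨ha.2, hb.2⟩)⟩

/-- The deterministic core, for one realization: `T ε` are the truncations and `A ε`, `B ε` the real
and imaginary parts of their transforms. No pointwise limit is assumed on the Fourier side; it is
obtained from Plancherel. -/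
theorem memW_and_tendsto_of_cauchy (hs : 0 ≤ s) {T A B : ℝ → Rd d → ℝ} {f : Rd d → ℝ}
    (hf : Measurable f) (hT : ∀ ε > 0, MemLp (T ε) 2 volume)
    (hA : ∀ ε > 0, MemLp (A ε) 2 (sobolevMeasure d s))
    (hB : ∀ ε > 0, MemLp (B ε) 2 (sobolevMeasure d s))
    (hpair : ∀ ε > 0, IsFourierPair (fun x => (T ε x : ℂ))
      (fun ξ => (A ε ξ : ℂ) + (B ε ξ : ℂ) * Complex.I))
    (cT : ∀ η > 0, ∃ δ > 0, ∀ ε, 0 < ε → ε ≤ δ →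
      eLpNorm (fun x => T ε x - T δ x) 2 volume ≤ η)
    (cA : ∀ η > 0, ∃ δ > 0, ∀ ε, 0 < ε → ε ≤ δ →
      eLpNorm (fun x => A ε x - A δ x) 2 (sobolevMeasure d s) ≤ η)
    (cB : ∀ η > 0, ∃ δ > 0, ∀ ε, 0 < ε → ε ≤ δ →
      eLpNorm (fun x => B ε x - B δ x) 2 (sobolevMeasure d s) ≤ η)
    {e : ℕ → ℝ} (he : ∀ n, 0 < e n) (he0 : Tendsto e atTop (𝓝 0))
    (hlim : ∀ᵐ x, Tendsto (fun n => T (e n) x) atTop (𝓝 (f x))) :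
    (∀ ε > 0, MemW s (T ε)) ∧ MemW s f ∧
      Tendsto (fun ε => sobolevENorm s fun x => T ε x - f x) (𝓝[>] 0) (𝓝 0) := by
  have hle := volume_le_sobolevMeasure (d := d) hs
  have hF : ∀ ε > 0, MemLp (fun ξ => (A ε ξ : ℂ) + (B ε ξ : ℂ) * Complex.I) 2
      (sobolevMeasure d s) := fun ε hε => memLp_re_add_im (hA ε hε) (hB ε hε)
  have hF' : ∀ ε > 0, MemLp (fun ξ => (A ε ξ : ℂ) + (B ε ξ : ℂ) * Complex.I) 2 volume :=
    fun ε hε => (hF ε hε).mono_measure hle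
  have hTf : ∀ η : ℝ≥0∞, 0 < η → ∃ δ > 0, ∀ ε, 0 < ε → ε ≤ δ →
      eLpNorm (fun x => T ε x - f x) 2 volume ≤ η := fun η hη =>
    exists_eLpNorm_sub_le_of_cauchy (fun ε hε => (hT ε hε).1) cT he he0 hlim hη
  have hf2 : MemLp f 2 volume := by
    obtain ⟨δ, hδ, h1⟩ := hTf 1 one_pos
    have h2 : MemLp (fun x => T δ x - f x) 2 volume :=
      ⟨(hT δ hδ).1.sub hf.aestronglyMeasurable, (h1 δ hδ le_rfl).trans_lt ENNReal.one_lt_top⟩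
    have h3 := (hT δ hδ).sub h2
    simpa [Pi.sub_def] using h3
  obtain ⟨C, hC2, hfC⟩ : ∃ C : Rd d → ℂ, MemLp C 2 volume ∧
      IsFourierPair (fun x => (f x : ℂ)) C :=
    ⟨_, Lp.memLp _, (isFourierPair_fourier (memLp_ofReal hf2).toLp).congr
      (memLp_ofReal hf2).coeFn_toLp EventuallyEq.rfl⟩
  have hCm : AEStronglyMeasurable C (sobolevMeasure d s) :=
    hC2.1.mono_ac sobolevMeasure_absolutelyContinuous
  have hsub : ∀ ε > 0, IsFourierPair (fun x => ((T ε x - f x : ℝ) : ℂ))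
      (fun ξ => ((A ε ξ : ℂ) + (B ε ξ : ℂ) * Complex.I) - C ξ) := by
    intro ε hε
    have := (hpair ε hε).sub hfC (memLp_ofReal (hT ε hε)) (memLp_ofReal hf2) (hF' ε hε) hC2
    simpa using this
  have hTf2 : ∀ ε > 0, MemLp (fun x => T ε x - f x) 2 volume := fun ε hε => (hT ε hε).sub hf2
  have hconv : Tendsto (fun n => eLpNorm
      ((fun ξ => (A (e n) ξ : ℂ) + (B (e n) ξ : ℂ) * Complex.I) - C) 2 volume)
      atTop (𝓝 0) := by
    refine ENNReal.tendsto_nhds_zero.2 fun η hη => ?_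
    obtain ⟨δ, hδ, h1⟩ := hTf η hη
    filter_upwards [he0.eventually (ge_mem_nhds hδ)] with n hn
    have h2 := (hsub _ (he n)).eLpNorm_eq (memLp_ofReal (hTf2 _ (he n))) ((hF' _ (he n)).sub hC2)
    rw [eLpNorm_ofReal] at h2
    exact h2.le.trans (h1 _ (he n) hn)
  -- Along this subsequence the transforms converge almost everywhere to `C`, also for the weighted
  -- measure, which is absolutely continuous. Hence the weighted Cauchy limits are Re C and Im C.
  obtain ⟨k, hk, hka⟩ := (tendstoInMeasure_of_tendsto_eLpNorm two_ne_zero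
    (fun n => (hF' _ (he n)).1) hC2.1 hconv).exists_seq_tendsto_ae
  have hka' := sobolevMeasure_absolutelyContinuous (s := s).ae_le hka
  have hre : ∀ᵐ ξ ∂(sobolevMeasure d s), Tendsto (fun n => A (e (k n)) ξ) atTop (𝓝 (C ξ).re) := by
    filter_upwards [hka'] with ξ hξ
    simpa [Function.comp_def] using (Complex.continuous_re.tendsto _).comp hξ
  have him : ∀ᵐ ξ ∂(sobolevMeasure d s), Tendsto (fun n => B (e (k n)) ξ) atTop (𝓝 (C ξ).im) := by
    filter_upwards [hka'] with ξ hξ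
    simpa [Function.comp_def] using (Complex.continuous_im.tendsto _).comp hξ
  have hCre : AEStronglyMeasurable (fun ξ => (C ξ).re) (sobolevMeasure d s) :=
    Complex.continuous_re.comp_aestronglyMeasurable hCm
  have hCim : AEStronglyMeasurable (fun ξ => (C ξ).im) (sobolevMeasure d s) :=
    Complex.continuous_im.comp_aestronglyMeasurable hCm
  have hnorm : ∀ η : ℝ≥0∞, 0 < η → ∃ δ > 0, ∀ ε, 0 < ε → ε ≤ δ →
      eLpNorm (fun ξ => ((A ε ξ : ℂ) + (B ε ξ : ℂ) * Complex.I) - C ξ) 2 (sobolevMeasure d s)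
        ≤ η := by
    intro η hη
    obtain ⟨δ₁, hδ₁, h1⟩ := exists_eLpNorm_sub_le_of_cauchy (fun ε hε => (hA ε hε).1) cA
      (fun n => he (k n)) (he0.comp hk.tendsto_atTop) hre (ENNReal.half_pos hη.ne')
    obtain ⟨δ₂, hδ₂, h2⟩ := exists_eLpNorm_sub_le_of_cauchy (fun ε hε => (hB ε hε).1) cB
      (fun n => he (k n)) (he0.comp hk.tendsto_atTop) him (ENNReal.half_pos hη.ne')
    refine ⟨min δ₁ δ₂, lt_min hδ₁ hδ₂, fun ε hε hεδ => ?_⟩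
    have h3 : (fun ξ => ((A ε ξ : ℂ) + (B ε ξ : ℂ) * Complex.I) - C ξ)
        = fun ξ => ((A ε ξ - (C ξ).re : ℝ) : ℂ) + ((B ε ξ - (C ξ).im : ℝ) : ℂ) * Complex.I := by
      funext ξ
      conv_lhs => rw [← Complex.re_add_im (C ξ)]
      push_cast
      ring
    rw [h3, ← ENNReal.add_halves η]
    exact (eLpNorm_re_add_im_le ((hA ε hε).1.sub hCre) ((hB ε hε).1.sub hCim)).trans
      (add_le_add (h1 ε hε (hεδ.trans (min_le_left _ _)))
        (h2 ε hε (hεδ.trans (min_le_right _ _))))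
  refine ⟨fun ε hε => ?_, ?_, ?_⟩
  · rw [MemW, (hpair ε hε).sobolevENorm_eq (hT ε hε) (hF' ε hε)]
    exact (hF ε hε).2
  · rw [MemW, hfC.sobolevENorm_eq hf2 hC2]
    obtain ⟨δ, hδ, h1⟩ := hnorm 1 one_pos
    have h2 : MemLp (fun ξ => ((A δ ξ : ℂ) + (B δ ξ : ℂ) * Complex.I) - C ξ) 2
        (sobolevMeasure d s) :=
      ⟨(hF δ hδ).1.sub hCm, (h1 δ hδ le_rfl).trans_lt ENNReal.one_lt_top⟩
    have h3 := (hF δ hδ).sub h2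
    have h4 : MemLp C 2 (sobolevMeasure d s) := by simpa [Pi.sub_def] using h3
    exact h4.2
  · refine ENNReal.tendsto_nhds_zero.2 fun η hη => ?_
    obtain ⟨δ, hδ, h1⟩ := hnorm η hη
    filter_upwards [Ioc_mem_nhdsGT hδ] with ε hε
    rw [(hsub ε hε.1).sobolevENorm_eq (hTf2 ε hε.1) ((hF' ε hε.1).sub hC2)]
    exact h1 ε hε.1 hε.2

end Convergence

/-! ### Local compactness of the parameter space -/

section Compact

variable {d : ℕ}

theorem isClosed_posSemidef : IsClosed {A : Matrix (Fin d) (Fin d) ℝ | A.PosSemidef} := by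
  have h1 : {A : Matrix (Fin d) (Fin d) ℝ | A.PosSemidef}
      = {A | A.IsHermitian} ∩ ⋂ x : Fin d → ℝ, {A | 0 ≤ star x ⬝ᵥ A.mulVec x} := by
    ext A
    simp [Matrix.posSemidef_iff_dotProduct_mulVec]
  rw [h1]
  refine (isClosed_eq continuous_id.matrix_conjTranspose continuous_id).inter
    (isClosed_iInter fun x => isClosed_le continuous_const ?_)
  exact Continuous.dotProduct continuous_const (continuous_id.matrix_mulVec continuous_const)

theorem isLocallyClosed_posDef : IsLocallyClosed {A : Matrix (Fin d) (Fin d) ℝ | A.PosDef} := by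
  have h1 : {A : Matrix (Fin d) (Fin d) ℝ | A.PosDef}
      = {A | A.PosSemidef} ∩ {A | A.det ≠ 0} := by
    ext A
    exact ⟨fun h => ⟨h.posSemidef, h.det_pos.ne'⟩,
      fun h => (Matrix.PosSemidef.posDef_iff_det_ne_zero h.1).2 h.2⟩
  rw [h1]
  exact isClosed_posSemidef.isLocallyClosed.inter
    (isOpen_ne_fun continuous_id.matrix_det continuous_const).isLocallyClosed

instance : LocallyCompactSpace (Matrix (Fin d) (Fin d) ℝ) :=
  inferInstanceAs (LocallyCompactSpace (Fin d → Fin d → ℝ))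

instance : LocallyCompactSpace (PosDefMatrix d) :=
  isLocallyClosed_posDef.locallyCompactSpace

/-- The parameter space is σ-compact, so some compact set has positive mass. This turns the local L₁
condition on ν into a condition on ν_β alone. -/
theorem exists_isCompact_measure_ne_zero (π : Measure (LocScale d)) [IsProbabilityMeasure π] :
    ∃ K, IsCompact K ∧ π K ≠ 0 := by
  by_contra! h
  have h1 : π (⋃ n, compactCovering (LocScale d) n) = 0 :=
    measure_iUnion_null fun n => h _ (isCompact_compactCovering _ n)
  rw [iUnion_compactCovering, measure_univ] at h1
  exact one_ne_zero h1

end Compact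

/-! ### Compensators -/

section Comp

variable {Θ : Type*} [MeasurableSpace Θ] {νβ : Measure ℝ} {h : ℝ → ℝ}

theorem lintegral_lt_top_of_le_mul_min
    (hβ : ∫⁻ β, ENNReal.ofReal (min 1 (β ^ 2)) ∂νβ < ∞) {A : Set ℝ} (hA : MeasurableSet A)
    {g : ℝ → ℝ≥0∞} (K : ℝ) (hK : 0 ≤ K)
    (hg : ∀ β ∈ A, g β ≤ ENNReal.ofReal (K * min 1 (β ^ 2))) : ∫⁻ β in A, g β ∂νβ < ∞ := by
  have h1 : ∫⁻ β in A, g β ∂νβ ≤ ∫⁻ β in A, ENNReal.ofReal K * ENNReal.ofReal (min 1 (β ^ 2)) ∂νβ :=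
    setLIntegral_mono' hA fun β hb => by
      rw [← ENNReal.ofReal_mul hK]
      exact hg β hb
  refine (h1.trans (setLIntegral_le_lintegral _ _)).trans_lt ?_
  rw [lintegral_const_mul' _ _ ENNReal.ofReal_ne_top]
  exact ENNReal.mul_lt_top ENNReal.ofReal_lt_top hβ

theorem measure_abs_gt_ne_top (hβ : ∫⁻ β, ENNReal.ofReal (min 1 (β ^ 2)) ∂νβ < ∞) {ε : ℝ}
    (hε : 0 < ε) : νβ {β | ε < |β|} ≠ ∞ := by
  have hm : MeasurableSet {β : ℝ | ε < |β|} :=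
    measurableSet_lt measurable_const continuous_abs.measurable
  have hc : 0 < min 1 (ε ^ 2) := lt_min one_pos (by positivity)
  have h1 := lintegral_lt_top_of_le_mul_min hβ hm (g := 1) (min 1 (ε ^ 2))⁻¹ (by positivity)
    fun β hb => by
      have h2 : ε < |β| := hb
      rw [Pi.one_apply, ENNReal.one_le_ofReal, inv_mul_eq_div, one_le_div hc, ← sq_abs β]
      gcongr
  simpa using h1.ne

/-- Near 0 both |h|² and |β − h| are O(β²), and away from 0 boundedness suffices; each is thus at
most a multiple of 1 ∧ β² on the relevant range. -/
theorem admissibleCompensator_of_isBigO (hβ : ∫⁻ β, ENNReal.ofReal (min 1 (β ^ 2)) ∂νβ < ∞)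
    (h0 : νβ {0} = 0) (hm : Measurable h) {C : ℝ} (hC : ∀ β, |h β| ≤ C)
    (hO : (fun β => h β - β) =O[𝓝 0] (fun β => β ^ 2)) : AdmissibleCompensator νβ h := by
  have hC0 : 0 ≤ C := (abs_nonneg _).trans (hC 0)
  obtain ⟨K, hK0, hK⟩ := hO.exists_nonneg
  obtain ⟨δ, hδ, hball⟩ := Metric.eventually_nhds_iff.1 hK.bound
  have hnear : ∀ β, |β| < δ → |h β - β| ≤ K * β ^ 2 := fun β hb => by
    simpa using hball (y := β) (by simpa using hb)
  have hfar : ∀ β, δ ≤ |β| → 1 ≤ β ^ 2 / δ ^ 2 := fun β hb => by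
    rw [one_le_div (by positivity), ← sq_abs β]
    gcongr
  refine ⟨hm, ?_, ?_, fun ε hε => measure_abs_gt_ne_top hβ hε, h0⟩
  · rw [← setLIntegral_univ]
    -- The three terms of the constant cover |β| < δ, δ ≤ |β| ≤ 1 and |β| ≥ 1.
    refine lintegral_lt_top_of_le_mul_min hβ MeasurableSet.univ
      ((1 + K * δ) ^ 2 + C ^ 2 / δ ^ 2 + C ^ 2) (by positivity) fun β _ => ?_
    rw [← ofReal_norm, ← ENNReal.ofReal_pow (norm_nonneg _), Real.norm_eq_abs]
    refine ENNReal.ofReal_le_ofReal ?_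
    have hsq : |h β| ^ 2 ≤ C ^ 2 := by
      gcongr
      exact hC β
    have p1 : 0 ≤ (1 + K * δ) ^ 2 := by positivity
    have p2 : 0 ≤ C ^ 2 / δ ^ 2 := by positivity
    rcases le_total 1 (β ^ 2) with hb | hb
    · rw [min_eq_left hb, mul_one]
      linarith
    · rw [min_eq_right hb]
      have p3 : 0 ≤ (1 + K * δ) ^ 2 * β ^ 2 := by positivity
      have p4 : 0 ≤ C ^ 2 / δ ^ 2 * β ^ 2 := by positivity
      have p5 : 0 ≤ C ^ 2 * β ^ 2 := by positivity
      rcases lt_or_ge |β| δ with hb' | hb'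
      · have h1 : |h β| ≤ (1 + K * δ) * |β| := by
          have h2 : |h β| ≤ |h β - β| + |β| := by
            simpa using abs_add_le (h β - β) β
          have h3 : K * β ^ 2 ≤ K * δ * |β| := by
            rw [← sq_abs β, sq, mul_assoc]
            gcongr
          linarith [hnear β hb']
        have h4 : |h β| ^ 2 ≤ ((1 + K * δ) * |β|) ^ 2 := by gcongr
        rw [mul_pow, sq_abs β] at h4
        linarith
      · have h5 : C ^ 2 * 1 ≤ C ^ 2 * (β ^ 2 / δ ^ 2) := by
          gcongr
          exact hfar β hb'
        have h6 : C ^ 2 * (β ^ 2 / δ ^ 2) = C ^ 2 / δ ^ 2 * β ^ 2 := by ring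
        linarith
  -- K serves for |β| < δ; for δ ≤ |β| ≤ 1 one has |h − β| ≤ 1 + C and β²/δ² ≥ 1.
  · refine lintegral_lt_top_of_le_mul_min hβ
      (measurableSet_le continuous_abs.measurable measurable_const)
      (K + (1 + C) / δ ^ 2) (by positivity) fun β hb => ?_
    have hb1 : |β| ≤ 1 := hb
    rw [← ofReal_norm, Real.norm_eq_abs]
    refine ENNReal.ofReal_le_ofReal ?_
    have hb2 : β ^ 2 ≤ 1 := (sq_le_one_iff_abs_le_one β).2 hb1
    rw [min_eq_right hb2, abs_sub_comm]
    have p1 : 0 ≤ (1 + C) / δ ^ 2 * β ^ 2 := by positivity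
    have p2 : 0 ≤ K * β ^ 2 := by positivity
    rcases lt_or_ge |β| δ with hb' | hb'
    · linarith [hnear β hb']
    · have h1 : |h β - β| ≤ |h β| + |β| := abs_sub _ _
      have h2 : (1 + C) * 1 ≤ (1 + C) * (β ^ 2 / δ ^ 2) := by
        gcongr
        exact hfar β hb'
      have h3 : (1 + C) * (β ^ 2 / δ ^ 2) = (1 + C) / δ ^ 2 * β ^ 2 := by ring
      linarith [hC β]

theorem LocalL1.lintegral_lt_top [TopologicalSpace Θ] {π : Measure Θ} [SFinite νβ] [SFinite π]
    (hL : LocalL1 (νβ.prod π)) {K : Set Θ} (hK : IsCompact K) (hπ : π K ≠ 0) :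
    ∫⁻ β, ENNReal.ofReal (min 1 |β|) ∂νβ < ∞ := by
  have h1 := hL K hK
  rw [← Measure.prod_restrict, Measure.restrict_univ] at h1
  have h2 := lintegral_prod_mul (μ := νβ) (ν := π.restrict K)
    (f := fun β => ENNReal.ofReal (min 1 |β|)) (g := fun _ => 1)
    (by fun_prop) aemeasurable_const
  simp only [mul_one, lintegral_const, one_mul, Measure.restrict_apply_univ] at h2
  rw [h2] at h1
  exact lt_of_not_ge fun h3 => h1.ne (by rw [top_le_iff.1 h3, ENNReal.top_mul hπ])

/-- In the case h = 0 the residual is |β| on |β| ≤ 1, and its integral is finite by the local L₁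
condition on a compact set of positive π-mass. -/
theorem IsCompensator.admissibleCompensator {d : ℕ} {π : Measure (LocScale d)}
    [IsProbabilityMeasure π] [SFinite νβ] (hν : IsLevyMeasure (νβ.prod π))
    (hβ : ∫⁻ β, ENNReal.ofReal (min 1 (β ^ 2)) ∂νβ < ∞) (hh : IsCompensator (νβ.prod π) h) :
    AdmissibleCompensator νβ h := by
  have h0 : νβ {0} = 0 := by
    have := hν.zero
    rwa [Measure.prod_prod, measure_univ, mul_one] at this
  rcases hh with ⟨hm, ⟨C, hC⟩, hO⟩ | ⟨rfl, hL⟩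
  · exact admissibleCompensator_of_isBigO hβ h0 hm hC hO
  · obtain ⟨K, hK, hπ⟩ := exists_isCompact_measure_ne_zero π
    have h1 := hL.lintegral_lt_top hK hπ
    refine ⟨measurable_const, by simp, ?_, fun ε hε => measure_abs_gt_ne_top hβ hε, h0⟩
    refine (le_trans (setLIntegral_mono' (measurableSet_le continuous_abs.measurable
      measurable_const) fun β hb => ?_) (setLIntegral_le_lintegral _ _)).trans_lt h1
    have hb1 : |β| ≤ 1 := hb
    rw [min_eq_right hb1, Pi.zero_apply, sub_zero, ← ofReal_norm, Real.norm_eq_abs]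

end Comp

/-! ### Location-scale Lévy fields in Sobolev spaces -/

section Main

variable {d : ℕ} {s : ℝ} {νβ : Measure ℝ} {π : Measure (LocScale d)}

/-- The integral factors over the product measure, and 1 + ρ^{2s} ≤ 2(1 + ρ)^{2s}. -/
theorem sobolevLevyCondition_prod (hs : 0 ≤ s) [SFinite νβ] [SFinite π]
    (hβ : ∫⁻ β, ENNReal.ofReal (min 1 (β ^ 2)) ∂νβ < ∞)
    (hω : ∫⁻ ω, invDet ω * (1 + specRad ω) ^ (2 * s) ∂π < ∞) :
    SobolevLevyCondition s (νβ.prod π) := by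
  have h1 : ∫⁻ ω, invDet ω * (1 + specRad ω ^ (2 * s)) ∂π < ∞ := by
    have h2 : ∀ ω : LocScale d, invDet ω * (1 + specRad ω ^ (2 * s))
        ≤ 2 * (invDet ω * (1 + specRad ω) ^ (2 * s)) := by
      intro ω
      have h3 : specRad ω ^ (2 * s) ≤ (1 + specRad ω) ^ (2 * s) :=
        ENNReal.rpow_le_rpow le_add_self (by positivity)
      calc invDet ω * (1 + specRad ω ^ (2 * s))
          ≤ invDet ω * ((1 + specRad ω) ^ (2 * s) + (1 + specRad ω) ^ (2 * s)) := by
            gcongr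
            exact one_le_one_add_specRad_rpow hs ω
        _ = 2 * (invDet ω * (1 + specRad ω) ^ (2 * s)) := by ring
    refine (lintegral_mono h2).trans_lt ?_
    rw [lintegral_const_mul' _ _ ENNReal.ofNat_ne_top]
    exact ENNReal.mul_lt_top ENNReal.ofNat_lt_top hω
  refine (lintegral_prod_le _).trans_lt ?_
  simp only
  have h4 : ∀ β : ℝ, ∫⁻ ω : LocScale d,
      invDet ω * (1 + specRad ω ^ (2 * s)) * ENNReal.ofReal (min 1 (β ^ 2)) ∂π
      = (∫⁻ ω, invDet ω * (1 + specRad ω ^ (2 * s)) ∂π) * ENNReal.ofReal (min 1 (β ^ 2)) :=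
    fun β => lintegral_mul_const' _ _ ENNReal.ofReal_ne_top
  simp only [h4]
  rw [lintegral_const_mul' _ _ h1.ne]
  exact ENNReal.mul_lt_top h1 hβ

theorem MemW.exists_fourier {G : Rd d → ℝ} (hG : MemW s G) :
    MemLp G 2 volume ∧ ∃ F : Rd d → ℂ, Measurable F ∧ MemLp F 2 (sobolevMeasure d s) ∧
      IsFourierPair (fun x => (G x : ℂ)) F := by
  have h1 : MemLp (fun x => (G x : ℂ)) 2 volume := by
    by_contra h1
    rw [MemW, sobolevENorm, dif_neg h1] at hG
    exact lt_irrefl _ hG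
  have h2 : MemLp G 2 volume := by simpa using h1.re
  refine ⟨h2, _, (Lp.stronglyMeasurable (𝓕 h1.toLp)).measurable, ?_,
    (isFourierPair_fourier h1.toLp).congr h1.coeFn_toLp EventuallyEq.rfl⟩
  refine ⟨(Lp.stronglyMeasurable _).aestronglyMeasurable, ?_⟩
  rw [← sobolevENorm_eq h1]
  exact hG

theorem lintegral_sq_eLpNorm_lt_top {m : Measure (Rd d)} {E : Type*} [NormedAddCommGroup E]
    {κ : Rd d → LocScale d → E} {c : ℝ≥0∞} (hc : c < ∞)
    (hω : ∫⁻ ω, invDet ω * (1 + specRad ω) ^ (2 * s) ∂π < ∞)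
    (hκ : ∀ ω, eLpNorm (fun x => κ x ω) 2 m ^ 2
      ≤ invDet ω * (1 + specRad ω) ^ (2 * s) * c ^ 2) :
    ∫⁻ ω, eLpNorm (fun x => κ x ω) 2 m ^ 2 ∂π < ∞ := by
  refine (lintegral_mono hκ).trans_lt ?_
  rw [lintegral_mul_const' _ _ (ENNReal.pow_ne_top hc.ne)]
  exact ENNReal.mul_lt_top hω (ENNReal.pow_lt_top hc)

theorem measurable_eLpNorm_two_complex {Θ : Type*} [MeasurableSpace Θ] {m : Measure (Rd d)}
    [SFinite m] {Ψ : Rd d → Θ → ℂ} (hΨ : Measurable (Function.uncurry Ψ)) :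
    Measurable fun ω => eLpNorm (fun x => Ψ x ω) 2 m := by
  simp only [eLpNorm_two_eq]
  exact (Measurable.lintegral_prod_left (hΨ.enorm.pow_const 2)).pow_const _

end Main

end Lark

end

/-! ### Assembly of the estimates in space and on the Fourier side. -/

theorem corollary4 {d : ℕ} (s : ℝ) (hs : 0 ≤ s)
    (G : Lark.Rd d → ℝ) (hGm : Measurable G) (hG : Lark.MemW s G)
    (νβ : Measure ℝ) [SigmaFinite νβ]
    (π : Measure (Lark.LocScale d)) [IsProbabilityMeasure π]
    (hν : Lark.IsLevyMeasure (νβ.prod π))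
    (hβ : ∫⁻ β, ENNReal.ofReal (min 1 (β ^ 2)) ∂νβ < ∞)
    (hω : ∫⁻ ω, Lark.invDet ω * (1 + Lark.specRad ω) ^ (2 * s) ∂π < ∞) :
    Lark.SobolevLevyCondition s (νβ.prod π) ∧
    ∀ (h : ℝ → ℝ), Lark.IsCompensator (νβ.prod π) h →
    ∀ {W : Type*} [MeasurableSpace W] (P : Measure W) [IsProbabilityMeasure P]
      (N : W → Measure (ℝ × Lark.LocScale d)),
      Lark.IsPoissonRandomMeasure N (νβ.prod π) P →
      (∃ f : Lark.Rd d → W → ℝ,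
        Lark.IsKernelIntegral N (νβ.prod π) P h (Lark.locScaleKernel G) f) ∧
      ∀ f : Lark.Rd d → W → ℝ,
        Lark.IsKernelIntegral N (νβ.prod π) P h (Lark.locScaleKernel G) f →
        ∀ᵐ w ∂P,
          (∀ ε : ℝ, 0 < ε →
            (∀ᵐ x : Lark.Rd d,
              Lark.TruncConverges (N w) (νβ.prod π) h (Lark.locScaleKernel G) ε x) ∧
            Lark.MemW s (Lark.truncField (N w) (νβ.prod π) h (Lark.locScaleKernel G) ε)) ∧
          Lark.MemW s (fun x => f x w) ∧
          Tendsto (fun ε : ℝ => Lark.sobolevENorm s (fun x =>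
              Lark.truncField (N w) (νβ.prod π) h (Lark.locScaleKernel G) ε x - f x w))
            (𝓝[>] 0) (𝓝 0) := by
  refine ⟨Lark.sobolevLevyCondition_prod hs hβ hω, fun h hh W _ P _ N hN => ?_⟩
  have H := hh.admissibleCompensator hν hβ
  obtain ⟨hG2, F, hFm, hF2, hGF⟩ := hG.exists_fourier
  have hle := Lark.volume_le_sobolevMeasure (d := d) hs
  have hφ := Lark.measurable_locScaleKernel hGm
  have hΨ := Lark.measurable_locScaleTransform hFm
  set Ψ := Lark.locScaleTransform F with hΨ_def
  have hre : Measurable (Function.uncurry fun x ω => (Ψ x ω).re) := Complex.measurable_re.comp hΨ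
  have him : Measurable (Function.uncurry fun x ω => (Ψ x ω).im) := Complex.measurable_im.comp hΨ
  have hpair : ∀ ω, Lark.IsFourierPair (fun x => (Lark.locScaleKernel G x ω : ℂ))
      (fun ξ => Ψ ξ ω) := fun ω => hGF.locScale ω
  set Vφ : Lark.LocScale d → ℝ≥0∞ :=
    fun ω => eLpNorm (fun x => Lark.locScaleKernel G x ω) 2 volume with hVφ
  set VΨ : Lark.LocScale d → ℝ≥0∞ :=
    fun ω => eLpNorm (fun x => Ψ x ω) 2 (Lark.sobolevMeasure d s) with hVΨ
  have hre_le : ∀ ω, eLpNorm (fun x => (Ψ x ω).re) 2 (Lark.sobolevMeasure d s) ≤ VΨ ω := fun ω =>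
    eLpNorm_mono fun x => by simpa using Complex.abs_re_le_norm (Ψ x ω)
  have him_le : ∀ ω, eLpNorm (fun x => (Ψ x ω).im) 2 (Lark.sobolevMeasure d s) ≤ VΨ ω := fun ω =>
    eLpNorm_mono fun x => by simpa using Complex.abs_im_le_norm (Ψ x ω)
  have hφ2 : ∫⁻ ω, Vφ ω ^ 2 ∂π < ∞ := by
    refine Lark.lintegral_sq_eLpNorm_lt_top hG2.2 hω fun ω => ?_
    rw [Lark.eLpNorm_locScale_sq, mul_assoc]
    gcongr
    exact le_mul_of_one_le_left' (Lark.one_le_one_add_specRad_rpow hs ω)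
  have hΨ2 : ∫⁻ ω, VΨ ω ^ 2 ∂π < ∞ :=
    Lark.lintegral_sq_eLpNorm_lt_top hF2.2 hω (Lark.eLpNorm_locScaleTransform_sq_le hs F)
  have hVφm : Measurable Vφ := Lark.measurable_eLpNorm_two hφ
  have hVΨm : Measurable VΨ := Lark.measurable_eLpNorm_two_complex hΨ
  have hre2 : ∫⁻ ω, eLpNorm (fun x => (Ψ x ω).re) 2 (Lark.sobolevMeasure d s) ^ 2 ∂π < ∞ :=
    (lintegral_mono fun ω => pow_le_pow_left' (hre_le ω) 2).trans_lt hΨ2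
  have him2 : ∫⁻ ω, eLpNorm (fun x => (Ψ x ω).im) 2 (Lark.sobolevMeasure d s) ^ 2 ∂π < ∞ :=
    (lintegral_mono fun ω => pow_le_pow_left' (him_le ω) 2).trans_lt hΨ2
  -- A single weight dominates the norms of the kernel, of its transform and of the real and
  -- imaginary parts, so one notion of good realization serves all the fields.
  have hVm : Measurable (Vφ + VΨ) := hVφm.add hVΨm
  have hV2 : ∫⁻ ω, (Vφ + VΨ) ω ^ 2 ∂π < ∞ := by
    refine (lintegral_mono fun ω => Lark.ennreal_add_sq_le (Vφ ω) (VΨ ω)).trans_lt ?_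
    rw [lintegral_const_mul' _ _ ENNReal.ofNat_ne_top, lintegral_add_left (hVφm.pow_const 2)]
    exact ENNReal.mul_lt_top ENNReal.ofNat_lt_top (ENNReal.add_lt_top.2 ⟨hφ2, hΨ2⟩)
  have hφV : ∀ ω, Vφ ω ≤ (Vφ + VΨ) ω := fun ω => le_self_add
  have hΨV : ∀ ω, VΨ ω ≤ (Vφ + VΨ) ω := fun ω => le_add_self
  refine ⟨H.exists_isKernelIntegral hN hφ hφ2, fun f hf => ?_⟩
  filter_upwards [H.ae_goodJumps hN hVm hV2,
    H.ae_forall_exists_eLpNorm_truncField_sub_le hN hφ hφ2,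
    H.ae_forall_exists_eLpNorm_truncField_sub_le hN hre hre2,
    H.ae_forall_exists_eLpNorm_truncField_sub_le hN him him2,
    H.ae_exists_tendsto_truncField hN hφ hφ2 hf] with w hw cφ cre cim hlim
  obtain ⟨e, he, he0, hlim⟩ := hlim
  have hνfin := fun ε (hε : 0 < ε) => H.setLIntegral_bigJumps_lt_top hVm hV2 hε
  obtain ⟨h1, h2, h3⟩ := Lark.memW_and_tendsto_of_cauchy hs (f := fun x => f x w)
    hf.1.of_uncurry_right
    (fun ε hε => ⟨(hw.measurable_truncField hφ H.measurable hε).aestronglyMeasurable,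
      hw.eLpNorm_truncField_lt_top hφ H.measurable hφV hε (hνfin ε hε)⟩)
    (fun ε hε => ⟨(hw.measurable_truncField hre H.measurable hε).aestronglyMeasurable,
      hw.eLpNorm_truncField_lt_top hre H.measurable (fun ω => (hre_le ω).trans (hΨV ω)) hε
        (hνfin ε hε)⟩)
    (fun ε hε => ⟨(hw.measurable_truncField him H.measurable hε).aestronglyMeasurable,
      hw.eLpNorm_truncField_lt_top him H.measurable (fun ω => (him_le ω).trans (hΨV ω)) hε
        (hνfin ε hε)⟩)
    (fun ε hε => hw.isFourierPair_truncField hφ hΨ H.measurable hpair hφV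
      (fun ω => (eLpNorm_mono_measure _ hle).trans (hΨV ω)) hε (hνfin ε hε))
    cφ cre cim he he0 hlim
  exact ⟨fun ε hε => ⟨(hw.mono hφV).ae_truncConverges hφ H.measurable hε
    (H.setLIntegral_bigJumps_lt_top hVφm hφ2 hε), h1 ε hε⟩, h2, h3⟩
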